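/- **Setting.** For an $n$-qubit matrix $A$ write $a_P=2^{-n}\mathrm{Tr}[PA]$ for its Pauli coefficients, $P\in\{I,X,Y,Z\}^{\otimes n}$, and $|P|$ for the number of non-identity factors of $P$. A $k$-local Hamiltonian is a self-adjoint $H$ with $h_P=0$ whenever $|P|>k$; its Gibbs state at inverse temperature $\beta>0$ is $\rho_H=e^{-\beta H}/\mathrm{Tr}[e^{-\beta H}]$. $\|\cdot\|_{\mathrm{tr}}$ is the sum of the singular values. For $\varepsilon\in(0,1)$ put $$\varepsilon'=\frac{\varepsilon^2}{100\max\{\beta,1\}\,n^k},\qquad \eta=\frac{\varepsilon'}{200\,\beta\, n^k},$$ let $\mathcal H$ be the set of traceless $k$-local Hamiltonians all of whose Pauli coefficients lie in $\eta\mathbb Z\cap[-1,1]$, and let $\mathcal S=\{\rho_{H}: H\in\mathcal H\}$. **Algorithm.** Measure each of $N$ copies of an unknown state $\rho$ separately, every qubit in a uniformly random basis among $X,Y,Z$. For $|P|\le k$ let $\widehat p_P$ be the classical-shadow estimate of $\mathrm{Tr}[P\rho]$: the average over the $N$ copies of $3^{|P|}$ times the product of the $\pm1$ outcomes on the support of $P$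 if $P$ agrees with the measured bases on its support, and of $0$ otherwise. For $H,H'\in\mathcal H$ let $\widehat\Delta_{H,H'}=\sum_{|P|\le k}(h_P-h'_P)\,\widehat p_P$. Output (the coefficients of a Hamiltonian in $\mathcal H$ whose Gibbs state is) $$\rho'\in\operatorname*{argmin}_{\tau\in\mathcal S}\ \max_{H,H'\in\mathcal H}\bigl|\widehat\Delta_{H,H'}-\mathrm{Tr}[(H-H')\tau]\bigr|.$$ **Theorem.** There are universal constants $C_1,C_2>0$ and one program for the classical post-processing such that for all $n\ge2$, $k\ge1$, $\beta>0$ and $\varepsilon,\delta\in(0,1)$ the following holds with $$N=\left\lceil C_1\,\frac{3^k n^{2k}\,k\log(n/\delta)\max\{\beta,1\}^2}{\varepsilon^4}\right\rceil .$$ 1. $\mathcal S$ is finite, and for every $k$-local $H$ with $|h_P|\le1$ for all $P$ there is $\tau\in\mathcal S$ with $\|\rho_H-\tau\|_{\mathrm{tr}}\le\varepsilon'$. 2. On all measurement data of $N$ copies, the program outputs a minimizer $\rho'\in\mathcal S$ as above, in at most $$\left(\frac{n^k\max\{\beta,1\}}{\varepsilon}\right)^{C_2n^k}\log(n/\delta)$$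 steps. Steps are counted in a model with exact arithmetic: one step per scalar operation or comparison, the square of the total bit length per operation on natural numbers, $d^3$ steps beyond the computation of the entries for the exponential of a $d\times d$ matrix, and the sum over the rounds for an iteration. 3. If the $N$ copies are of $\rho=\rho_H$ with $H$ a $k$-local Hamiltonian such that $|h_P|\le1$ for all $P$, then $\|\rho'-\rho\|_{\mathrm{tr}}\le\varepsilon$ with probability at least $1-\delta$. -/

import Mathlib

noncomputable section

namespace GibbsLearning

/-! ### Pauli strings and Hamiltonians on `n` qubits -/

/-- The one-qubit Pauli matrices; `0, 1, 2, 3` stand for `I, X, Y, Z`. -/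
def pauli : Fin 4 → Matrix (Fin 2) (Fin 2) ℂ :=
  ![1, !![0, 1; 1, 0], !![0, -Complex.I; Complex.I, 0], !![1, 0; 0, -1]]

/-- Matrices acting on `n` qubits, in the computational basis. -/
abbrev QMatrix (n : ℕ) : Type := Matrix (Fin n → Fin 2) (Fin n → Fin 2) ℂ

/-- Labels of the Pauli strings of length `n`; the label `0` is the identity string. -/
abbrev PauliString (n : ℕ) : Type := Fin n → Fin 4

/-- The tensor product `A 0 ⊗ ⋯ ⊗ A (n-1)` of one-qubit matrices. -/
def tensor {n : ℕ} (A : Fin n → Matrix (Fin 2) (Fin 2) ℂ) : QMatrix n :=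
  Matrix.of fun x y => ∏ i, A i (x i) (y i)

/-- The Pauli string `P` as a matrix. -/
def PauliString.toMatrix {n : ℕ} (P : PauliString n) : QMatrix n :=
  tensor fun i => pauli (P i)

/-- The weight `|P|`: the number of qubits on which `P` is not the identity. -/
def PauliString.weight {n : ℕ} (P : PauliString n) : ℕ :=
  (Finset.univ.filter fun i => P i ≠ 0).card

/-- The Pauli coefficient `a_P = 2⁻ⁿ Tr[P A]`. -/
def pauliCoeff {n : ℕ} (A : QMatrix n) (P : PauliString n) : ℂ :=
  (P.toMatrix * A).trace / 2 ^ n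

/-- A `k`-local Hamiltonian: self-adjoint, with no Pauli coefficient of weight above `k`. -/
def IsLocalHamiltonian {n : ℕ} (k : ℕ) (H : QMatrix n) : Prop :=
  H.IsHermitian ∧ ∀ P : PauliString n, k < P.weight → pauliCoeff H P = 0

/-- The Gibbs state `e^{-βH} / Tr[e^{-βH}]`. -/
def gibbs {n : ℕ} (β : ℝ) (H : QMatrix n) : QMatrix n :=
  (NormedSpace.exp (-(β : ℂ) • H)).trace⁻¹ • NormedSpace.exp (-(β : ℂ) • H)

/-- The trace norm: the sum of the singular values. -/
def traceNorm {n : ℕ} (A : QMatrix n) : ℝ :=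
  ∑ i, Real.sqrt ((Matrix.isHermitian_conjTranspose_mul_self A).eigenvalues i)

/-! ### The covering net -/

/-- The grid step `η = ε / (200 β n^k)`. -/
def gridStep (ε : ℝ) (k n : ℕ) (β : ℝ) : ℝ := ε / (200 * β * (n : ℝ) ^ k)

/-- The (traceless) `k`-local Hamiltonians whose Pauli coefficients lie in `ηℤ ∩ [-1, 1]`. -/
def hamiltonianNet (ε : ℝ) (k n : ℕ) (β : ℝ) : Set (QMatrix n) :=
  {H | IsLocalHamiltonian k H ∧ pauliCoeff H 0 = 0 ∧
    ∀ P : PauliString n, ∃ m : ℤ, |gridStep ε k n β * m| ≤ 1 ∧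
      pauliCoeff H P = ((gridStep ε k n β * m : ℝ) : ℂ)}

/-- The Gibbs states of the Hamiltonians in the net. -/
def gibbsNet (ε : ℝ) (k n : ℕ) (β : ℝ) : Set (QMatrix n) :=
  gibbs β '' hamiltonianNet ε k n β

/-! ### Random Pauli measurements on single copies and classical shadows -/

/-- The record of the measurement of one copy: for each qubit the measured Pauli
(`0, 1, 2` for `X, Y, Z`), and for each qubit the outcome (`0` for `+1`, `1` for `-1`). -/
abbrev Record (n : ℕ) : Type := (Fin n → Fin 3) × (Fin n → Fin 2)

/-- The probability of a record when the bases are uniformly random and the outcomes follow the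
Born rule: `3⁻ⁿ Tr[ρ ⊗ᵢ (1 + sᵢ σᵢ)/2]`. -/
def recordProb {n : ℕ} (ρ : QMatrix n) (r : Record n) : ℝ :=
  (1 / 3 : ℝ) ^ n * (ρ * tensor fun i =>
    (1 / 2 : ℂ) • (1 + (-1 : ℂ) ^ (r.2 i : ℕ) • pauli (r.1 i).succ)).trace.re

/-- The probability of the event `E` when `N` copies of `ρ` are measured one by one. -/
def dataProb {n N : ℕ} (ρ : QMatrix n) (E : Set (Fin N → Record n)) : ℝ :=
  ∑ ω, E.indicator (fun ω => ∏ t, recordProb ρ (ω t)) ω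

/-- The classical-shadow estimate of `Tr[P ρ] = 2ⁿ ρ_P`: the empirical mean of `3^{|P|} ∏ sᵢ`
(product over the support of `P`) over the copies on which `P` was measured on its support,
the other copies counting as `0`. -/
def shadowEstimate {n N : ℕ} (ω : Fin N → Record n) (P : PauliString n) : ℝ :=
  (∑ t, ∏ i, if P i = 0 then (1 : ℝ)
    else if ((ω t).1 i).succ = P i then 3 * (-1) ^ ((ω t).2 i : ℕ) else 0) / N

/-- The estimate of `Tr[(H - H') ρ]` for two `k`-local Hamiltonians. -/
def shadowDifference {n N : ℕ} (k : ℕ) (ω : Fin N → Record n) (H H' : QMatrix n) : ℝ :=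
  ∑ P : PauliString n with P.weight ≤ k,
    (pauliCoeff H P - pauliCoeff H' P).re * shadowEstimate ω P

/-- The distance between the data and a candidate state `τ`: the largest deviation of
`Tr[(H - H') τ]` from its estimate, over all pairs `H, H'` in the net. -/
def shadowDistance {n N : ℕ} (ε : ℝ) (k : ℕ) (β : ℝ) (ω : Fin N → Record n) (τ : QMatrix n) : ℝ :=
  ⨆ q : hamiltonianNet ε k n β × hamiltonianNet ε k n β,
    |shadowDifference k ω q.1.1 q.2.1 - (((q.1.1 : QMatrix n) - q.2.1) * τ).trace.re|

/-! ### Programs with a step count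

The classical post-processing is a program in a small language with bounded iteration, over
natural numbers and exact complex scalars. Scalar arithmetic, comparison and reading a variable or
an input cost one step, arithmetic on natural numbers costs the square of the bit lengths involved,
the exponential of a `d × d` matrix costs `d ^ 3` steps beyond the computation of its entries, and
an iteration costs the sum over its rounds. A program is fixed once and for all: the number of
qubits, the locality, the number of copies, `β`, `ε` and the measurement records are its inputs. -/

/-- The two types of values. -/
inductive Kind
  | nat
  | scalar

/-- Values of each type. -/
abbrev Kind.Val : Kind → Type
  | .nat => ℕ
  | .scalar => ℂ

/-- Operations on natural numbers. -/
inductive NatOp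
  | add
  | sub
  | mul
  | div
  | mod
  | pow
  | le

/-- The value of an operation; `le` yields `1` for true and `0` for false. -/
def NatOp.apply : NatOp → ℕ → ℕ → ℕ
  | .add, a, b => a + b
  | .sub, a, b => a - b
  | .mul, a, b => a * b
  | .div, a, b => a / b
  | .mod, a, b => a % b
  | .pow, a, b => a ^ b
  | .le, a, b => if a ≤ b then 1 else 0

/-- The number of steps of an operation on natural numbers: the square of the total bit length. -/
def NatOp.cost (o : NatOp) (a b : ℕ) : ℕ :=
  (1 + a.size + b.size + (o.apply a b).size) ^ 2

/-- Operations on scalars. -/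
inductive ScalarOp
  | add
  | sub
  | mul
  | div

/-- The value of an operation on scalars. -/
def ScalarOp.apply : ScalarOp → ℂ → ℂ → ℂ
  | .add, a, b => a + b
  | .sub, a, b => a - b
  | .mul, a, b => a * b
  | .div, a, b => a / b

/-- The least index below `b` at which `f` is smallest (`0` if `b = 0`). -/
def argminBelow (f : ℕ → ℝ) : ℕ → ℕ
  | 0 => 0
  | b + 1 => if f b < f (argminBelow f b) then b else argminBelow f b

/-- Programs. Variables hold natural numbers and are counted from the innermost binder. -/
inductive Code : Kind → Type
  /-- the `i`-th variable -/
  | var (i : ℕ) : Code .nat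
  /-- a natural number constant -/
  | lit (a : ℕ) : Code .nat
  /-- an operation on natural numbers -/
  | natOp (o : NatOp) (a b : Code .nat) : Code .nat
  /-- `∑ j < b, f j` in the natural numbers -/
  | natSum (b f : Code .nat) : Code .nat
  /-- the least `j < b` with the smallest real part of `f j` -/
  | argmin (b : Code .nat) (f : Code .scalar) : Code .nat
  /-- `1` if `Re a ≤ Re b` and `0` otherwise -/
  | scalarLe (a b : Code .scalar) : Code .nat
  /-- the floor of the real part (`0` if negative) -/
  | floor (a : Code .scalar) : Code .nat
  /-- the Pauli (`1, 2, 3` for `X, Y, Z`) measured on qubit `i` of copy `t` -/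
  | basis (t i : Code .nat) : Code .nat
  /-- the outcome (`0` for `+1`, `1` for `-1`) on qubit `i` of copy `t` -/
  | outcome (t i : Code .nat) : Code .nat
  /-- the input `β` -/
  | beta : Code .scalar
  /-- the input `ε` -/
  | eps : Code .scalar
  /-- the imaginary unit -/
  | imag : Code .scalar
  /-- a natural number as a scalar -/
  | cast (a : Code .nat) : Code .scalar
  /-- an operation on scalars -/
  | scalarOp (o : ScalarOp) (a b : Code .scalar) : Code .scalar
  /-- `∑ j < b, f j` in the scalars -/
  | scalarSum (b : Code .nat) (f : Code .scalar) : Code .scalar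
  /-- `∏ j < b, f j` in the scalars -/
  | scalarProd (b : Code .nat) (f : Code .scalar) : Code .scalar
  /-- the entry `(i, j)` of the exponential of the `d × d` matrix whose entry at row `x` and
  column `y` is `f`, with `x` as variable `0` and `y` as variable `1` (`0` if out of range) -/
  | expEntry (d : Code .nat) (f : Code .scalar) (i j : Code .nat) : Code .scalar
  /-- `a` if `c` is not `0`, and `b` otherwise -/
  | cond {s : Kind} (c : Code .nat) (a b : Code s) : Code s
  /-- evaluate `a` once and bind its value as variable `0` of `b` -/
  | bind {s : Kind} (a : Code .nat) (b : Code s) : Code s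

/-- The inputs of a program other than the initial values of its variables. -/
structure Input where
  /-- the inverse temperature -/
  beta : ℝ
  /-- the accuracy -/
  eps : ℝ
  /-- the measured Paulis -/
  basis : ℕ → ℕ → ℕ
  /-- the outcomes -/
  outcome : ℕ → ℕ → ℕ

/-- The entry `(i, j)` of the exponential of the `d × d` matrix with entries `f x y`
(`0` if out of range). -/
def expEntryValue (d : ℕ) (f : ℕ → ℕ → ℂ) (i j : ℕ) : ℂ :=
  if h : i < d ∧ j < d then
    (NormedSpace.exp (Matrix.of fun x y : Fin d => f x y) : Matrix (Fin d) (Fin d) ℂ)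
      ⟨i, h.1⟩ ⟨j, h.2⟩
  else 0

/-- The value of a program on an input, given the values of the variables. -/
def Code.eval (x : Input) : {s : Kind} → Code s → List ℕ → s.Val
  | _, .var i, e => e.getD i 0
  | _, .lit a, _ => a
  | _, .natOp o a b, e => o.apply (a.eval x e) (b.eval x e)
  | _, .natSum b f, e => Finset.sum (M := ℕ) (Finset.range (b.eval x e)) fun j => f.eval x (j :: e)
  | _, .argmin b f, e => argminBelow (fun j => Complex.re (f.eval x (j :: e))) (b.eval x e)
  | _, .scalarLe a b, e => if Complex.re (a.eval x e) ≤ Complex.re (b.eval x e) then (1 : ℕ) else 0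
  | _, .floor a, e => ⌊Complex.re (a.eval x e)⌋₊
  | _, .basis t i, e => x.basis (t.eval x e) (i.eval x e)
  | _, .outcome t i, e => x.outcome (t.eval x e) (i.eval x e)
  | _, .beta, _ => (x.beta : ℂ)
  | _, .eps, _ => (x.eps : ℂ)
  | _, .imag, _ => Complex.I
  | _, .cast a, e => Nat.cast (R := ℂ) (a.eval x e)
  | _, .scalarOp o a b, e => o.apply (a.eval x e) (b.eval x e)
  | _, .scalarSum b f, e =>
      Finset.sum (M := ℂ) (Finset.range (b.eval x e)) fun j => f.eval x (j :: e)
  | _, .scalarProd b f, e =>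
      Finset.prod (M := ℂ) (Finset.range (b.eval x e)) fun j => f.eval x (j :: e)
  | _, .expEntry d f i j, e =>
      expEntryValue (d.eval x e) (fun r c => f.eval x (r :: c :: e)) (i.eval x e) (j.eval x e)
  | _, .cond c a b, e => if (c.eval x e : ℕ) = 0 then b.eval x e else a.eval x e
  | _, .bind a b, e => b.eval x (a.eval x e :: e)

/-- The value of a program for a natural number. -/
abbrev Code.natVal (x : Input) (c : Code .nat) (e : List ℕ) : ℕ := c.eval x e

/-- The value of a program for a scalar. -/
abbrev Code.scalarVal (x : Input) (c : Code .scalar) (e : List ℕ) : ℂ := c.eval x e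

/-- The number of steps of a program on an input, given the values of the variables. -/
def Code.cost (x : Input) : {s : Kind} → Code s → List ℕ → ℕ
  | _, .var _, _ => 1
  | _, .lit a, _ => 1 + a.size
  | _, .natOp o a b, e => a.cost x e + b.cost x e + o.cost (a.natVal x e) (b.natVal x e)
  | _, .natSum b f, e => 1 + b.cost x e + ∑ j ∈ Finset.range (b.natVal x e),
      (1 + f.cost x (j :: e) +
        NatOp.add.cost (∑ l ∈ Finset.range j, f.natVal x (l :: e)) (f.natVal x (j :: e)))
  | _, .argmin b f, e =>
      1 + b.cost x e + ∑ j ∈ Finset.range (b.natVal x e), (1 + f.cost x (j :: e))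
  | _, .scalarLe a b, e => 1 + a.cost x e + b.cost x e
  | _, .floor a, e => 1 + a.cost x e + ⌊(a.scalarVal x e).re⌋₊.size
  | _, .basis t i, e => 1 + t.cost x e + i.cost x e
  | _, .outcome t i, e => 1 + t.cost x e + i.cost x e
  | _, .beta, _ => 1
  | _, .eps, _ => 1
  | _, .imag, _ => 1
  | _, .cast a, e => 1 + a.cost x e + (a.natVal x e).size
  | _, .scalarOp _ a b, e => 1 + a.cost x e + b.cost x e
  | _, .scalarSum b f, e =>
      1 + b.cost x e + ∑ j ∈ Finset.range (b.natVal x e), (1 + f.cost x (j :: e))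
  | _, .scalarProd b f, e =>
      1 + b.cost x e + ∑ j ∈ Finset.range (b.natVal x e), (1 + f.cost x (j :: e))
  | _, .expEntry d f i j, e =>
      1 + d.cost x e + i.cost x e + j.cost x e + d.natVal x e ^ 3 +
        ∑ r ∈ Finset.range (d.natVal x e), ∑ c ∈ Finset.range (d.natVal x e),
          (1 + f.cost x (r :: c :: e))
  | _, .cond c a b, e =>
      1 + c.cost x e + if c.natVal x e = 0 then b.cost x e else a.cost x e
  | _, .bind a b, e => 1 + a.cost x e + b.cost x (a.natVal x e :: e)

/-- The input formed by `β`, `ε` and the measurement records. -/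
def inputOf {n N : ℕ} (β ε : ℝ) (ω : Fin N → Record n) : Input where
  beta := β
  eps := ε
  basis t i := if h : t < N ∧ i < n then ((ω ⟨t, h.1⟩).1 ⟨i, h.2⟩ : ℕ) + 1 else 0
  outcome t i := if h : t < N ∧ i < n then ((ω ⟨t, h.1⟩).2 ⟨i, h.2⟩ : ℕ) else 0

/-- The Hamiltonian that the program `c` outputs: run with the variables `p, n, k, N`, it returns
the Pauli coefficient of the string with label `∑ i, P i * 4 ^ i = p`. -/
def outputHamiltonian {n N : ℕ} (c : Code .scalar) (k : ℕ) (β ε : ℝ) (ω : Fin N → Record n) :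
    QMatrix n :=
  ∑ P : PauliString n,
    c.scalarVal (inputOf β ε ω) [(finFunctionFinEquiv P : ℕ), n, k, N] • P.toMatrix

/-- The number of steps that the program takes to output all the Pauli coefficients. -/
def runningTime {n N : ℕ} (c : Code .scalar) (k : ℕ) (β ε : ℝ) (ω : Fin N → Record n) : ℕ :=
  ∑ p ∈ Finset.range (4 ^ n), (1 + c.cost (inputOf β ε ω) [p, n, k, N])

end GibbsLearning

end

open GibbsLearning

/-! Everything rests on one inequality for Gibbs states (`sq_traceNorm_gibbs_sub_le`): the squared
trace distance of `ρ_H` and `ρ_{H'}` is at most `β Tr[(H' - H)(ρ_H - ρ_{H'})]`. It is a Pinsker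
bound for the symmetrized relative entropy. For `e^A`, `e^B` of trace one put `X = e^{A/2}`, `Y =
e^{B/2}`; Cauchy–Schwarz bounds the squared trace norm of `X² - Y²` by `4 ‖X - Y‖²` in the
Hilbert–Schmidt norm. Expanding over the two eigenbases reduces the rest to the scalar inequality `4
(e^{a/2} - e^{b/2})² ≤ (a - b)(e^a - e^b)`, that is, to `sinh t ≤ t cosh t`.

In the Pauli expansion of `H' - H` only the strings of weight at most `k` occur, and there are at
most `21 n^k` of them. If the coefficients differ by at most `c`, the squared distance is at most `β
c` times the sum of the differences of the low-weight Pauli expectations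
(`sq_traceNorm_gibbs_sub_le_sum`). This is used twice. With `c = η` the expectations are again
bounded by the trace distance, one factor cancels, and the grid is a cover
(`exists_net_traceNorm_le`). With `c = 2` it says that agreement of the low-weight expectations
forces closeness of the states, whatever the coefficients are.

The coefficients of the net fill a full symmetric grid in a box, so the maximum over pairs `H, H'`
is attained at opposite corners. The distance to the data is therefore a fixed multiple of the `ℓ¹`
deviation of the low-weight expectations (`shadowDistance_eq`), and the program can minimize the
latter. A shadow estimate is unbiased, with second moment and absolute value at most `3^k`, so
Bernstein's inequality and a union bound make all low-weight estimates accurate. The minimizer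
deviates from the data at most as much as the net point near the true state; the triangle inequality
bounds the differences of their expectations, and the case `c = 2` bounds their trace distance
(`traceNorm_sub_le_of_minimizer`).

The program numbers the net by digits in base `2m + 1`, one digit per low-weight string, and
searches exhaustively. Its cost is bounded structurally (`Code.exists_cost_le`): a fixed program
costs at most `T V^d`, where `V` bounds the natural numbers in its run and `T` the number of copies,
which only enters through loops that are not nested. With `L = n^k max(β,1)/ε`, all of these numbers
except the number of copies are at most a fixed power of `L^{n^k}`; the number of copies alone
contributes `log (n/δ)`, to the first power. -/

noncomputable section

namespace GibbsLearning

/-! ### Tensor products of one-qubit matrices -/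

lemma tensor_mul {n : ℕ} (A B : Fin n → Matrix (Fin 2) (Fin 2) ℂ) :
    tensor A * tensor B = tensor fun i => A i * B i := by
  ext x y
  simp only [tensor, Matrix.mul_apply, Matrix.of_apply, ← Finset.prod_mul_distrib]
  exact (Fintype.prod_sum fun i j => A i (x i) j * B i j (y i)).symm

lemma trace_tensor {n : ℕ} (A : Fin n → Matrix (Fin 2) (Fin 2) ℂ) :
    (tensor A).trace = ∏ i, (A i).trace := by
  simp only [Matrix.trace, Matrix.diag, tensor, Matrix.of_apply]
  exact (Fintype.prod_sum fun i j => A i j j).symm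

lemma conjTranspose_tensor {n : ℕ} (A : Fin n → Matrix (Fin 2) (Fin 2) ℂ) :
    (tensor A).conjTranspose = tensor fun i => (A i).conjTranspose := by
  ext x y
  simp [tensor, Matrix.conjTranspose_apply]

lemma tensor_one {n : ℕ} : tensor (fun _ : Fin n => 1) = (1 : QMatrix n) := by
  ext x y
  simp only [tensor, Matrix.of_apply, Matrix.one_apply]
  rw [Finset.prod_ite_zero]
  simp [funext_iff]

lemma tensor_smul {n : ℕ} (c : Fin n → ℂ) (A : Fin n → Matrix (Fin 2) (Fin 2) ℂ) :
    tensor (fun i => c i • A i) = (∏ i, c i) • tensor A := by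
  ext x y
  simp [tensor, Finset.prod_mul_distrib]

lemma sum_tensor {n : ℕ} {ι : Type*} [Fintype ι]
    (g : Fin n → ι → Matrix (Fin 2) (Fin 2) ℂ) :
    ∑ f : Fin n → ι, tensor (fun i => g i (f i)) = tensor fun i => ∑ a, g i a := by
  ext x y
  simp only [tensor, Matrix.sum_apply, Matrix.of_apply]
  exact (Fintype.prod_sum fun i j => g i j (x i) (y i)).symm

/-! ### Pauli matrices -/

lemma pauli_zero : pauli 0 = 1 := rfl

lemma pauli_isHermitian (q : Fin 4) : (pauli q).IsHermitian := by
  fin_cases q <;> ext i j <;> fin_cases i <;> fin_cases j <;> simp [pauli]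

lemma pauli_mul_self (q : Fin 4) : pauli q * pauli q = 1 := by
  fin_cases q <;> ext i j <;> fin_cases i <;> fin_cases j <;>
    simp [pauli, Matrix.mul_apply]

lemma trace_pauli_mul (p q : Fin 4) :
    (pauli p * pauli q).trace = if p = q then 2 else 0 := by
  fin_cases p <;> fin_cases q <;>
    simp [pauli, Matrix.trace, Fin.sum_univ_two] <;> norm_num

/-- The sum of `σ ⊗ σ` over the four Pauli matrices is twice the swap of two qubits; its tensor
powers give the completeness of the Pauli strings. -/
lemma sum_pauli_mul_pauli (a b c d : Fin 2) :
    ∑ q, pauli q a b * pauli q c d = if a = d ∧ b = c then 2 else 0 := by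
  fin_cases a <;> fin_cases b <;> fin_cases c <;> fin_cases d <;>
    simp [pauli, Fin.sum_univ_four] <;> norm_num

namespace PauliString

variable {n : ℕ}

lemma toMatrix_isHermitian (P : PauliString n) : P.toMatrix.IsHermitian := by
  rw [Matrix.IsHermitian, toMatrix, conjTranspose_tensor]
  exact congrArg tensor (funext fun i => pauli_isHermitian _)

lemma toMatrix_mul_self (P : PauliString n) : P.toMatrix * P.toMatrix = 1 := by
  simp only [toMatrix, tensor_mul, pauli_mul_self, tensor_one]

lemma toMatrix_zero : toMatrix (0 : PauliString n) = 1 := by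
  rw [toMatrix]
  simp only [Pi.zero_apply, pauli_zero, tensor_one]

lemma trace_toMatrix_mul (P Q : PauliString n) :
    (P.toMatrix * Q.toMatrix).trace = if P = Q then 2 ^ n else 0 := by
  simp only [toMatrix, tensor_mul, trace_tensor, trace_pauli_mul]
  rw [Finset.prod_ite_zero]
  simp [funext_iff]

end PauliString

/-! ### Pauli expansions of matrices. -/

variable {n : ℕ}

lemma pauliCoeff_toMatrix (P Q : PauliString n) :
    pauliCoeff Q.toMatrix P = if P = Q then 1 else 0 := by
  rw [pauliCoeff, PauliString.trace_toMatrix_mul]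
  split_ifs <;> simp

lemma pauliCoeff_sub (A B : QMatrix n) (P : PauliString n) :
    pauliCoeff (A - B) P = pauliCoeff A P - pauliCoeff B P := by
  simp [pauliCoeff, mul_sub, sub_div]

lemma pauliCoeff_sum_smul (h : PauliString n → ℂ) (P : PauliString n) :
    pauliCoeff (∑ Q : PauliString n, h Q • Q.toMatrix) P = h P := by
  have : pauliCoeff (∑ Q : PauliString n, h Q • Q.toMatrix) P =
      ∑ Q : PauliString n, h Q * pauliCoeff Q.toMatrix P := by
    simp [pauliCoeff, Finset.mul_sum, Matrix.trace_sum, Finset.sum_div, mul_div_assoc]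
  simp [this, pauliCoeff_toMatrix]

/-- Every matrix is the sum of its Pauli components. -/
lemma sum_pauliCoeff_smul (A : QMatrix n) :
    ∑ P : PauliString n, pauliCoeff A P • P.toMatrix = A := by
  -- Completeness: the sum of `P ⊗ P` over all strings is `2 ^ n` times the swap, qubit by qubit.
  have key (u v x y : Fin n → Fin 2) :
      ∑ P : PauliString n, P.toMatrix u v * P.toMatrix x y =
        if u = y ∧ v = x then 2 ^ n else 0 := by
    simp only [PauliString.toMatrix, tensor, Matrix.of_apply, ← Finset.prod_mul_distrib]
    rw [← Fintype.prod_sum fun i q => pauli q (u i) (v i) * pauli q (x i) (y i)]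
    simp only [sum_pauli_mul_pauli]
    rw [Finset.prod_ite_zero]
    simp [funext_iff, forall_and]
  ext x y
  simp only [Matrix.sum_apply, Matrix.smul_apply, pauliCoeff, smul_eq_mul, Matrix.trace,
    Matrix.diag, Matrix.mul_apply, Finset.sum_div, Finset.sum_mul]
  rw [Finset.sum_comm]
  calc ∑ u, ∑ P : PauliString n, ∑ v, P.toMatrix u v * A v u / 2 ^ n * P.toMatrix x y
      = ∑ u, ∑ v, A v u / 2 ^ n * ∑ P : PauliString n, P.toMatrix u v * P.toMatrix x y := by
        refine Finset.sum_congr rfl fun u _ => ?_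
        rw [Finset.sum_comm]
        refine Finset.sum_congr rfl fun v _ => ?_
        rw [Finset.mul_sum]
        exact Finset.sum_congr rfl fun P _ => by ring
    _ = A x y := by
        simp only [key]
        rw [Finset.sum_eq_single y, Finset.sum_eq_single x]
        · simp
        · intro v _ hv; simp [hv]
        · simp
        · intro u _ hu; simp [hu]
        · simp

lemma trace_mul_eq_sum_pauliCoeff (A B : QMatrix n) :
    (A * B).trace = ∑ P : PauliString n, pauliCoeff A P * (P.toMatrix * B).trace := by
  conv_lhs => rw [← sum_pauliCoeff_smul A]
  simp [Finset.sum_mul, Matrix.trace_sum]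

lemma pauliCoeff_ext {A B : QMatrix n} (h : ∀ P, pauliCoeff A P = pauliCoeff B P) : A = B := by
  rw [← sum_pauliCoeff_smul A, ← sum_pauliCoeff_smul B]
  simp [h]

lemma isHermitian_sum_smul (h : PauliString n → ℝ) :
    (∑ P : PauliString n, (h P : ℂ) • P.toMatrix).IsHermitian := by
  rw [Matrix.IsHermitian, Matrix.conjTranspose_sum]
  refine Finset.sum_congr rfl fun P _ => ?_
  rw [Matrix.conjTranspose_smul, P.toMatrix_isHermitian.eq]
  simp

lemma trace_mul_im_eq_zero {ι : Type*} [Fintype ι] {A B : Matrix ι ι ℂ} (hA : A.IsHermitian)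
    (hB : B.IsHermitian) : (A * B).trace.im = 0 := by
  have : star (A * B).trace = (A * B).trace := by
    rw [← Matrix.trace_conjTranspose, Matrix.conjTranspose_mul, hA.eq, hB.eq, Matrix.trace_mul_comm]
  exact Complex.conj_eq_iff_im.1 this

lemma pauliCoeff_eq_ofReal {A : QMatrix n} (hA : A.IsHermitian) (P : PauliString n) :
    pauliCoeff A P = ((pauliCoeff A P).re : ℂ) := by
  have h := trace_mul_im_eq_zero P.toMatrix_isHermitian hA
  have h2 : (P.toMatrix * A).trace = ((P.toMatrix * A).trace.re : ℂ) := by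
    apply Complex.ext <;> simp [h]
  have : pauliCoeff A P = (((P.toMatrix * A).trace.re / 2 ^ n : ℝ) : ℂ) := by
    rw [pauliCoeff, h2]; push_cast; simp
  rw [this, Complex.ofReal_re]

/-! ### The number of low-weight Pauli strings -/

/-- The weight enumerator factorizes over the qubits: each contributes `1` for the identity and `x`
for each of the three other Paulis. -/
lemma sum_pow_weight (x : ℝ) : ∑ P : PauliString n, x ^ P.weight = (1 + 3 * x) ^ n := by
  have h (P : PauliString n) : x ^ P.weight = ∏ i, if P i = 0 then 1 else x := by
    rw [Finset.prod_ite, PauliString.weight]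
    simp
  simp only [h]
  rw [← Fintype.prod_sum fun (_ : Fin n) (q : Fin 4) => if q = 0 then (1 : ℝ) else x]
  have : ∑ q : Fin 4, (if q = 0 then (1 : ℝ) else x) = 1 + 3 * x := by
    simp [Fin.sum_univ_four]; ring
  simp [this]

/-- Evaluating the weight enumerator at `x = 1/n` counts every string of weight at most `k` with at
least `n^{-k}`, while the total is `(1 + 3/n)^n ≤ e³ < 21`. The constant does not depend on `k`. -/
lemma card_weight_le (k : ℕ) (hn : 1 ≤ n) :
    ((Finset.univ.filter fun P : PauliString n => P.weight ≤ k).card : ℝ) ≤ 21 * (n : ℝ) ^ k := by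
  have hn0 : (0 : ℝ) < n := by exact_mod_cast hn
  have hx0 : (0 : ℝ) < (n : ℝ)⁻¹ := inv_pos.2 hn0
  have hx1 : (n : ℝ)⁻¹ ≤ 1 := inv_le_one_of_one_le₀ (by exact_mod_cast hn)
  have h1 : ((Finset.univ.filter fun P : PauliString n => P.weight ≤ k).card : ℝ) * (n : ℝ)⁻¹ ^ k
      ≤ (1 + 3 * (n : ℝ)⁻¹) ^ n := by
    rw [← sum_pow_weight, ← nsmul_eq_mul, ← Finset.sum_const]
    calc _ ≤ ∑ P : PauliString n with P.weight ≤ k, (n : ℝ)⁻¹ ^ P.weight :=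
          Finset.sum_le_sum fun P hP =>
            pow_le_pow_of_le_one hx0.le hx1 (Finset.mem_filter.1 hP).2
      _ ≤ _ := Finset.sum_le_sum_of_subset_of_nonneg (Finset.filter_subset _ _)
          fun P _ _ => pow_nonneg hx0.le _
  have h2 : (1 + 3 * (n : ℝ)⁻¹) ^ n ≤ 21 := by
    calc (1 + 3 * (n : ℝ)⁻¹) ^ n ≤ Real.exp (3 * (n : ℝ)⁻¹) ^ n := by
          refine pow_le_pow_left₀ (by positivity) ?_ n
          rw [add_comm]; exact Real.add_one_le_exp _
      _ = Real.exp 1 ^ 3 := by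
          rw [← Real.exp_nat_mul, ← Real.exp_nat_mul]
          congr 1
          field_simp
          norm_num
      _ ≤ 2.7182818286 ^ 3 := by
          exact pow_le_pow_left₀ (Real.exp_pos _).le Real.exp_one_lt_d9.le 3
      _ ≤ 21 := by norm_num
  have h3 := h1.trans h2
  rw [inv_pow, ← div_eq_mul_inv, div_le_iff₀ (by positivity)] at h3
  exact h3

/-! ### Spectral calculus for Hermitian matrices -/

section Spectral

variable {ι : Type*} [Fintype ι]

/-- The square of the Hilbert–Schmidt norm. -/
def hsNormSq (A : Matrix ι ι ℂ) : ℝ := ∑ i, ∑ j, ‖A i j‖ ^ 2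

lemma re_trace_conjTranspose_mul_self (A : Matrix ι ι ℂ) :
    (A.conjTranspose * A).trace.re = hsNormSq A := by
  rw [hsNormSq, Finset.sum_comm, Matrix.trace, Complex.re_sum]
  refine Finset.sum_congr rfl fun i _ => ?_
  rw [Matrix.diag_apply, Matrix.mul_apply, Complex.re_sum]
  refine Finset.sum_congr rfl fun j _ => ?_
  have : A.conjTranspose i j * A j i = ((‖A j i‖ ^ 2 : ℝ) : ℂ) := by
    push_cast
    rw [← Complex.conj_mul', Matrix.conjTranspose_apply, starRingEnd_apply]
  rw [this, Complex.ofReal_re]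

lemma hsNormSq_nonneg (A : Matrix ι ι ℂ) : 0 ≤ hsNormSq A :=
  Finset.sum_nonneg fun _ _ => Finset.sum_nonneg fun _ _ => sq_nonneg _

lemma hsNormSq_conjTranspose (A : Matrix ι ι ℂ) : hsNormSq A.conjTranspose = hsNormSq A := by
  rw [hsNormSq, hsNormSq, Finset.sum_comm]
  simp

lemma sq_re_trace_mul_le (A B : Matrix ι ι ℂ) :
    (A * B).trace.re ^ 2 ≤ hsNormSq A * hsNormSq B := by
  have h1 : |(A * B).trace.re| ≤ ∑ p : ι × ι, ‖A p.1 p.2‖ * ‖B p.2 p.1‖ := by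
    calc |(A * B).trace.re| ≤ ‖(A * B).trace‖ := Complex.abs_re_le_norm _
      _ ≤ _ := by
        rw [Matrix.trace, Fintype.sum_prod_type]
        refine (norm_sum_le _ _).trans (Finset.sum_le_sum fun i _ => ?_)
        rw [Matrix.diag_apply, Matrix.mul_apply]
        refine (norm_sum_le _ _).trans (Finset.sum_le_sum fun j _ => ?_)
        rw [norm_mul]
  calc (A * B).trace.re ^ 2 = |(A * B).trace.re| ^ 2 := (sq_abs _).symm
    _ ≤ (∑ p : ι × ι, ‖A p.1 p.2‖ * ‖B p.2 p.1‖) ^ 2 :=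
        pow_le_pow_left₀ (abs_nonneg _) h1 2
    _ ≤ (∑ p : ι × ι, ‖A p.1 p.2‖ ^ 2) * ∑ p : ι × ι, ‖B p.2 p.1‖ ^ 2 :=
        Finset.sum_mul_sq_le_sq_mul_sq _ _ _
    _ = hsNormSq A * hsNormSq B := by
        rw [← hsNormSq_conjTranspose B]
        simp [hsNormSq, Fintype.sum_prod_type]

variable [DecidableEq ι]

/-- The matrix with eigenvalues `f` and eigenvectors the columns of `U`. -/
def unitaryConj (U : Matrix ι ι ℂ) (f : ι → ℝ) : Matrix ι ι ℂ :=
  U * Matrix.diagonal (fun i => (f i : ℂ)) * U.conjTranspose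

lemma exists_unitaryConj {A : Matrix ι ι ℂ} (hA : A.IsHermitian) :
    ∃ (U : Matrix ι ι ℂ) (f : ι → ℝ), U.conjTranspose * U = 1 ∧ U * U.conjTranspose = 1 ∧
      A = unitaryConj U f := by
  refine ⟨hA.eigenvectorUnitary, hA.eigenvalues, ?_, ?_, ?_⟩
  · exact Unitary.coe_star_mul_self hA.eigenvectorUnitary
  · exact Unitary.coe_mul_star_self hA.eigenvectorUnitary
  · conv_lhs => rw [hA.spectral_theorem, Unitary.conjStarAlgAut_apply]
    rfl

lemma unitaryConj_isHermitian (U : Matrix ι ι ℂ) (f : ι → ℝ) :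
    (unitaryConj U f).IsHermitian := by
  rw [Matrix.IsHermitian, unitaryConj, Matrix.conjTranspose_mul, Matrix.conjTranspose_mul,
    Matrix.conjTranspose_conjTranspose, Matrix.diagonal_conjTranspose, ← mul_assoc]
  congr 3
  ext i
  simp

lemma unitaryConj_mul {U : Matrix ι ι ℂ} (hU : U.conjTranspose * U = 1) (f g : ι → ℝ) :
    unitaryConj U f * unitaryConj U g = unitaryConj U (fun i => f i * g i) := by
  calc unitaryConj U f * unitaryConj U g
      = U * Matrix.diagonal (fun i => (f i : ℂ)) * (U.conjTranspose * U) *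
          Matrix.diagonal (fun i => (g i : ℂ)) * U.conjTranspose := by
        simp only [unitaryConj, mul_assoc]
    _ = _ := by
        rw [hU, mul_one, mul_assoc U, Matrix.diagonal_mul_diagonal, unitaryConj]
        simp

lemma unitaryConj_one {U : Matrix ι ι ℂ} (hU : U * U.conjTranspose = 1) :
    unitaryConj U (fun _ => 1) = 1 := by
  simp [unitaryConj, hU]

lemma exp_unitaryConj {U : Matrix ι ι ℂ} (hU : U * U.conjTranspose = 1) (f : ι → ℝ) :
    NormedSpace.exp (unitaryConj U f) = unitaryConj U (fun i => Real.exp (f i)) := by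
  have hinv : U⁻¹ = U.conjTranspose := Matrix.inv_eq_right_inv hU
  have hu : IsUnit U := IsUnit.of_mul_eq_one _ hU
  rw [unitaryConj, ← hinv, Matrix.exp_conj U _ hu, Matrix.exp_diagonal, unitaryConj, hinv]
  congr 3
  ext i
  rw [Pi.coe_exp, ← Complex.exp_eq_exp_ℂ, Complex.ofReal_exp]

lemma trace_unitaryConj {U : Matrix ι ι ℂ} (hU : U.conjTranspose * U = 1) (f : ι → ℝ) :
    (unitaryConj U f).trace = ((∑ i, f i : ℝ) : ℂ) := by
  rw [unitaryConj, Matrix.trace_mul_comm, ← mul_assoc, hU, one_mul]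
  simp [Matrix.trace]

lemma trace_mul_unitaryConj (U V : Matrix ι ι ℂ) (f : ι → ℝ) :
    (V * unitaryConj U f).trace = ∑ i, (U.conjTranspose * V * U) i i * f i := by
  rw [unitaryConj, ← mul_assoc, Matrix.trace_mul_comm, ← mul_assoc, ← mul_assoc]
  simp [Matrix.trace, Matrix.mul_diagonal]

/-- The squared overlaps of two eigenbases act as nonnegative weights. Traces of products of
functions of two noncommuting matrices become weighted double sums, to which scalar inequalities
apply termwise. -/
lemma re_trace_unitaryConj_mul (U V : Matrix ι ι ℂ) (f g : ι → ℝ) :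
    (unitaryConj U f * unitaryConj V g).trace.re =
      ∑ i, ∑ j, ‖(U.conjTranspose * V) i j‖ ^ 2 * (f i * g j) := by
  set W := U.conjTranspose * V with hW
  have hWs : V.conjTranspose * U = W.conjTranspose := by simp [hW, Matrix.conjTranspose_mul]
  have : (unitaryConj U f * unitaryConj V g).trace =
      (Matrix.diagonal (fun i => (f i : ℂ)) * W * Matrix.diagonal (fun i => (g i : ℂ)) *
        W.conjTranspose).trace := by
    rw [← hWs, hW, unitaryConj, unitaryConj]
    simp only [mul_assoc]
    rw [Matrix.trace_mul_comm]
    simp only [mul_assoc]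
  rw [this, Matrix.trace, Complex.re_sum]
  refine Finset.sum_congr rfl fun i _ => ?_
  rw [Matrix.diag_apply, Matrix.mul_apply, Complex.re_sum]
  refine Finset.sum_congr rfl fun j _ => ?_
  rw [Matrix.mul_diagonal, Matrix.diagonal_mul, Matrix.conjTranspose_apply]
  have h : (f i : ℂ) * W i j * (g j : ℂ) * star (W i j) =
      ((‖W i j‖ ^ 2 * (f i * g j) : ℝ) : ℂ) := by
    push_cast
    rw [← Complex.mul_conj', starRingEnd_apply]
    ring
  rw [h, Complex.ofReal_re]

lemma hsNormSq_unitary_mul {S : Matrix ι ι ℂ} (hS : S.conjTranspose * S = 1) (A : Matrix ι ι ℂ) :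
    hsNormSq (S * A) = hsNormSq A := by
  rw [← re_trace_conjTranspose_mul_self, ← re_trace_conjTranspose_mul_self,
    Matrix.conjTranspose_mul, mul_assoc, ← mul_assoc _ S, hS, one_mul]

end Spectral

/-! ### The trace norm -/

/-- The eigenvalues of `MᴴM` come in an order of their own, so they match the numbers `f i ^ 2` only
as a multiset. The comparison goes through the roots of the characteristic polynomial, and the sum
of the square roots does not depend on the order. -/
lemma traceNorm_unitaryConj {U : QMatrix n} (hU : U.conjTranspose * U = 1)
    (f : (Fin n → Fin 2) → ℝ) : traceNorm (unitaryConj U f) = ∑ i, |f i| := by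
  set M := unitaryConj U f with hM
  have hMM : M.conjTranspose * M = unitaryConj U (fun i => f i * f i) := by
    rw [(unitaryConj_isHermitian U f).eq, unitaryConj_mul hU]
  have hroots := (Matrix.isHermitian_conjTranspose_mul_self M).roots_charpoly_eq_eigenvalues
  have hcp : (M.conjTranspose * M).charpoly =
      ∏ i, (Polynomial.X - Polynomial.C ((f i * f i : ℝ) : ℂ)) := by
    rw [hMM, unitaryConj, Matrix.charpoly_mul_comm, ← mul_assoc, hU, one_mul,
      Matrix.charpoly_diagonal]
  rw [hcp, Polynomial.roots_prod _ _ 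
    (Finset.prod_ne_zero_iff.2 fun _ _ => Polynomial.X_sub_C_ne_zero _)] at hroots
  simp only [Polynomial.roots_X_sub_C] at hroots
  rw [Multiset.bind_singleton] at hroots
  have h2 := congrArg (fun s : Multiset ℂ => (s.map fun z => Real.sqrt z.re).sum) hroots
  simp only [Multiset.map_map, Function.comp_def] at h2
  have h3 : ∑ i, Real.sqrt (f i * f i) = traceNorm M := h2
  rw [← h3]
  exact Finset.sum_congr rfl fun i _ => Real.sqrt_mul_self_eq_abs _

/-- The witness is the sign of `M`, with sign `1` on the kernel to keep it unitary. With the next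
lemma this gives the dual description of the trace norm, from which the triangle inequality follows.
-/
lemma exists_traceNorm_eq {M : QMatrix n} (hM : M.IsHermitian) :
    ∃ S : QMatrix n, S.conjTranspose * S = 1 ∧ traceNorm M = (S * M).trace.re := by
  obtain ⟨U, f, hU, hU', rfl⟩ := exists_unitaryConj hM
  refine ⟨unitaryConj U (fun i => if 0 ≤ f i then 1 else -1), ?_, ?_⟩
  · rw [(unitaryConj_isHermitian U _).eq, unitaryConj_mul hU, ← unitaryConj_one hU']
    congr 1
    ext i
    split_ifs <;> norm_num
  · rw [traceNorm_unitaryConj hU, unitaryConj_mul hU, trace_unitaryConj hU, Complex.ofReal_re]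
    refine Finset.sum_congr rfl fun i _ => ?_
    split_ifs with h
    · rw [abs_of_nonneg h, one_mul]
    · rw [abs_of_neg (not_le.1 h), neg_one_mul]

/-- In an eigenbasis of `M` the trace is a sum of eigenvalues times diagonal entries of a unitary
matrix, which have modulus at most one. Pauli strings are the main instances of `V`. -/
lemma abs_re_trace_mul_le_traceNorm {M V : QMatrix n} (hM : M.IsHermitian)
    (hV : V.conjTranspose * V = 1) : |(V * M).trace.re| ≤ traceNorm M := by
  obtain ⟨U, f, hU, hU', rfl⟩ := exists_unitaryConj hM
  rw [traceNorm_unitaryConj hU, trace_mul_unitaryConj]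
  have hW : U.conjTranspose * V * U ∈ Matrix.unitaryGroup (Fin n → Fin 2) ℂ := by
    rw [Matrix.mem_unitaryGroup_iff', Matrix.star_eq_conjTranspose]
    calc (U.conjTranspose * V * U).conjTranspose * (U.conjTranspose * V * U)
        = U.conjTranspose * (V.conjTranspose * (U * U.conjTranspose) * V) * U := by
          simp only [Matrix.conjTranspose_mul, Matrix.conjTranspose_conjTranspose, mul_assoc]
      _ = 1 := by rw [hU', mul_one, hV, mul_one, hU]
  refine (Complex.abs_re_le_norm _).trans ((norm_sum_le _ _).trans
    (Finset.sum_le_sum fun i _ => ?_))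
  rw [norm_mul, Complex.norm_real, Real.norm_eq_abs]
  exact mul_le_of_le_one_left (abs_nonneg _) (entry_norm_bound_of_unitary hW i i)

lemma traceNorm_add_le {A B : QMatrix n} (hA : A.IsHermitian) (hB : B.IsHermitian) :
    traceNorm (A + B) ≤ traceNorm A + traceNorm B := by
  obtain ⟨S, hS, h⟩ := exists_traceNorm_eq (hA.add hB)
  rw [h, mul_add, Matrix.trace_add, Complex.add_re]
  exact add_le_add ((le_abs_self _).trans (abs_re_trace_mul_le_traceNorm hA hS))
    ((le_abs_self _).trans (abs_re_trace_mul_le_traceNorm hB hS))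

lemma traceNorm_nonneg (A : QMatrix n) : 0 ≤ traceNorm A :=
  Finset.sum_nonneg fun _ _ => Real.sqrt_nonneg _

/-- `4 (e^{a/2} - e^{b/2})² ≤ (a - b)(e^a - e^b)`. -/
lemma four_mul_sq_exp_half_sub_le (a b : ℝ) :
    4 * (Real.exp (a / 2) - Real.exp (b / 2)) ^ 2 ≤ (a - b) * (Real.exp a - Real.exp b) := by
  wlog h : b ≤ a generalizing a b
  · have := this b a (le_of_not_ge h)
    nlinarith
  have ha : Real.exp a = Real.exp (a / 2) ^ 2 := by rw [← Real.exp_nat_mul]; congr 1; push_cast; ring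
  have hb : Real.exp b = Real.exp (b / 2) ^ 2 := by rw [← Real.exp_nat_mul]; congr 1; push_cast; ring
  -- Factoring out `c = e^{(a+b)/4}` leaves `e^{±t}`; after cancelling `16 c² sinh t` the claim
  -- becomes `sinh t ≤ t cosh t`.
  set t := (a - b) / 4 with ht
  have ht0 : 0 ≤ t := by rw [ht]; linarith
  set c := Real.exp ((a + b) / 4) with hc
  have hat : Real.exp (a / 2) = c * Real.exp t := by
    rw [hc, ht, ← Real.exp_add]; congr 1; ring
  have hbt : Real.exp (b / 2) = c * Real.exp (-t) := by
    rw [hc, ht, ← Real.exp_add]; congr 1; ring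
  have hsinh : Real.exp t - Real.exp (-t) = 2 * Real.sinh t := by rw [Real.sinh_eq]; ring
  have hcosh : Real.exp t + Real.exp (-t) = 2 * Real.cosh t := by rw [Real.cosh_eq]; ring
  have hs0 : 0 ≤ Real.sinh t := Real.sinh_nonneg_iff.2 ht0
  have hle : Real.sinh t ≤ t * Real.cosh t := by
    have hmono : MonotoneOn (fun x => x * Real.cosh x - Real.sinh x) (Set.Ici 0) := by
      refine monotoneOn_of_deriv_nonneg (convex_Ici 0) (by fun_prop) (by fun_prop) ?_
      intro x hx
      rw [interior_Ici] at hx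
      have hd : HasDerivAt (fun x => x * Real.cosh x - Real.sinh x)
          (1 * Real.cosh x + x * Real.sinh x - Real.cosh x) x :=
        ((hasDerivAt_id x).mul (Real.hasDerivAt_cosh x)).sub (Real.hasDerivAt_sinh x)
      rw [hd.deriv]
      have := mul_nonneg (le_of_lt hx) (Real.sinh_nonneg_iff.2 (le_of_lt hx))
      linarith
    have := hmono (Set.self_mem_Ici) ht0 ht0
    simp only [zero_mul, Real.sinh_zero, sub_zero] at this
    linarith
  have hab : a - b = 4 * t := by rw [ht]; ring
  rw [ha, hb, hat, hbt, hab]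
  have e1 : 4 * (c * Real.exp t - c * Real.exp (-t)) ^ 2 =
      16 * c ^ 2 * Real.sinh t * Real.sinh t := by
    rw [← mul_sub, hsinh]; ring
  have e2 : 4 * t * ((c * Real.exp t) ^ 2 - (c * Real.exp (-t)) ^ 2) =
      16 * c ^ 2 * Real.sinh t * (t * Real.cosh t) := by
    have : (c * Real.exp t) ^ 2 - (c * Real.exp (-t)) ^ 2 =
      c ^ 2 * (Real.exp t - Real.exp (-t)) * (Real.exp t + Real.exp (-t)) := by ring
    rw [this, hsinh, hcosh]; ring
  rw [e1, e2]
  exact mul_le_mul_of_nonneg_left hle (by positivity)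

/-- A Pinsker-type bound: for density matrices `e^A` and `e^B` the square of the trace distance is
at most the symmetrized relative entropy. -/
lemma sq_traceNorm_exp_sub_le {A B : QMatrix n} (hA : A.IsHermitian) (hB : B.IsHermitian)
    (hAt : (NormedSpace.exp A).trace = 1) (hBt : (NormedSpace.exp B).trace = 1) :
    traceNorm (NormedSpace.exp A - NormedSpace.exp B) ^ 2 ≤
      ((A - B) * (NormedSpace.exp A - NormedSpace.exp B)).trace.re := by
  obtain ⟨U, a, hU, hU', rfl⟩ := exists_unitaryConj hA
  obtain ⟨V, b, hV, hV', rfl⟩ := exists_unitaryConj hB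
  rw [exp_unitaryConj hU'] at hAt ⊢
  rw [exp_unitaryConj hV'] at hBt ⊢
  set w : (Fin n → Fin 2) → (Fin n → Fin 2) → ℝ := fun i j => ‖(U.conjTranspose * V) i j‖ ^ 2
    with hw
  have trUV (f g : (Fin n → Fin 2) → ℝ) : (unitaryConj U f * unitaryConj V g).trace.re =
      ∑ i, ∑ j, w i j * (f i * g j) := re_trace_unitaryConj_mul U V f g
  have trVU (f g : (Fin n → Fin 2) → ℝ) : (unitaryConj V f * unitaryConj U g).trace.re =
      ∑ i, ∑ j, w i j * (g i * f j) := by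
    rw [Matrix.trace_mul_comm, trUV]
  -- The identity, written in the eigenbasis of the other matrix, puts single traces over the same
  -- weights `w`; in effect the overlaps sum to one along each row and column.
  have trU (f : (Fin n → Fin 2) → ℝ) : (unitaryConj U f).trace.re = ∑ i, ∑ j, w i j * f i := by
    have := trUV f (fun _ => 1)
    rw [unitaryConj_one hV', mul_one] at this
    simpa using this
  have trV (f : (Fin n → Fin 2) → ℝ) : (unitaryConj V f).trace.re = ∑ i, ∑ j, w i j * f j := by
    have := trUV (fun _ => 1) f
    rw [unitaryConj_one hU', one_mul] at this
    simpa using this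
  set X := unitaryConj U (fun i => Real.exp (a i / 2)) with hX
  set Y := unitaryConj V (fun i => Real.exp (b i / 2)) with hY
  have hXX : unitaryConj U (fun i => Real.exp (a i)) = X * X := by
    rw [hX, unitaryConj_mul hU]
    congr 1; ext i
    rw [← Real.exp_add]; congr 1; ring
  have hYY : unitaryConj V (fun i => Real.exp (b i)) = Y * Y := by
    rw [hY, unitaryConj_mul hV]
    congr 1; ext i
    rw [← Real.exp_add]; congr 1; ring
  have hXh : X.IsHermitian := unitaryConj_isHermitian _ _
  have hYh : Y.IsHermitian := unitaryConj_isHermitian _ _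
  have hXXt : (X * X).trace.re = 1 := by rw [← hXX, hAt]; rfl
  have hYYt : (Y * Y).trace.re = 1 := by rw [← hYY, hBt]; rfl
  have hcomm : (Y * X).trace.re = (X * Y).trace.re := by rw [Matrix.trace_mul_comm]
  have hD : hsNormSq (X - Y) = 2 - 2 * (X * Y).trace.re := by
    rw [← re_trace_conjTranspose_mul_self, (hXh.sub hYh).eq]
    simp only [sub_mul, mul_sub, Matrix.trace_sub, Complex.sub_re]
    linarith
  have hE : hsNormSq (X + Y) = 2 + 2 * (X * Y).trace.re := by
    rw [← re_trace_conjTranspose_mul_self, (hXh.add hYh).eq]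
    simp only [add_mul, mul_add, Matrix.trace_add, Complex.add_re]
    linarith
  -- Parallelogram identity: `X` and `Y` are Hilbert–Schmidt unit vectors, so the squared norms of
  -- `X + Y` and `X - Y` add up to `4`.
  have hE4 : hsNormSq (X + Y) ≤ 4 := by
    have := hsNormSq_nonneg (X - Y)
    linarith
  -- the upper bound by the Hilbert-Schmidt distance of the square roots
  have upper : traceNorm (X * X - Y * Y) ^ 2 ≤ 4 * hsNormSq (X - Y) := by
    have hXXh : (X * X).IsHermitian := hXX ▸ unitaryConj_isHermitian _ _
    have hYYh : (Y * Y).IsHermitian := hYY ▸ unitaryConj_isHermitian _ _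
    obtain ⟨S, hS, hSt⟩ := exists_traceNorm_eq (hXXh.sub hYYh)
    -- For noncommuting matrices the difference of squares is the average of `(X - Y)(X + Y)` and
    -- `(X + Y)(X - Y)`. Cauchy–Schwarz bounds both traces, the unitary `S` leaving the
    -- Hilbert–Schmidt norms unchanged.
    have hsplit : traceNorm (X * X - Y * Y) =
        ((S * (X - Y)) * (X + Y)).trace.re / 2 + ((S * (X + Y)) * (X - Y)).trace.re / 2 := by
      rw [hSt, ← add_div, ← Complex.add_re, ← Matrix.trace_add]
      have : (S * (X - Y)) * (X + Y) + (S * (X + Y)) * (X - Y) =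
          (S * (X * X - Y * Y)) + (S * (X * X - Y * Y)) := by noncomm_ring
      rw [this, Matrix.trace_add, Complex.add_re]
      ring
    have c1 := sq_re_trace_mul_le (S * (X - Y)) (X + Y)
    have c2 := sq_re_trace_mul_le (S * (X + Y)) (X - Y)
    rw [hsNormSq_unitary_mul hS] at c1 c2
    have hD0 := hsNormSq_nonneg (X - Y)
    have c3 : hsNormSq (X - Y) * hsNormSq (X + Y) ≤ hsNormSq (X - Y) * 4 :=
      mul_le_mul_of_nonneg_left hE4 hD0
    rw [hsplit]
    nlinarith [sq_nonneg (((S * (X - Y)) * (X + Y)).trace.re - ((S * (X + Y)) * (X - Y)).trace.re)]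
  rw [hXX, hYY]
  refine upper.trans ?_
  have hDw : hsNormSq (X - Y) =
      ∑ i, ∑ j, w i j * (Real.exp (a i / 2) - Real.exp (b j / 2)) ^ 2 := by
    rw [← re_trace_conjTranspose_mul_self, (hXh.sub hYh).eq]
    simp only [sub_mul, mul_sub, Matrix.trace_sub, Complex.sub_re]
    rw [hcomm, ← hXX, ← hYY, trU, trV, hX, hY, trUV, ← Finset.sum_sub_distrib,
      ← Finset.sum_sub_distrib, ← Finset.sum_sub_distrib]
    refine Finset.sum_congr rfl fun i _ => ?_
    rw [← Finset.sum_sub_distrib, ← Finset.sum_sub_distrib, ← Finset.sum_sub_distrib]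
    refine Finset.sum_congr rfl fun j _ => ?_
    have ha : Real.exp (a i) = Real.exp (a i / 2) ^ 2 := by
      rw [← Real.exp_nat_mul]; congr 1; push_cast; ring
    have hb : Real.exp (b j) = Real.exp (b j / 2) ^ 2 := by
      rw [← Real.exp_nat_mul]; congr 1; push_cast; ring
    rw [ha, hb]; ring
  have hR : ((unitaryConj U a - unitaryConj V b) * (X * X - Y * Y)).trace.re =
      ∑ i, ∑ j, w i j * ((a i - b j) * (Real.exp (a i) - Real.exp (b j))) := by
    rw [← hXX, ← hYY]
    simp only [sub_mul, mul_sub, Matrix.trace_sub, Complex.sub_re]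
    rw [unitaryConj_mul hU, unitaryConj_mul hV, trU, trV, trUV, trVU, ← Finset.sum_sub_distrib,
      ← Finset.sum_sub_distrib, ← Finset.sum_sub_distrib]
    refine Finset.sum_congr rfl fun i _ => ?_
    rw [← Finset.sum_sub_distrib, ← Finset.sum_sub_distrib, ← Finset.sum_sub_distrib]
    exact Finset.sum_congr rfl fun j _ => by ring
  rw [hDw, hR, Finset.mul_sum]
  refine Finset.sum_le_sum fun i _ => ?_
  rw [Finset.mul_sum]
  refine Finset.sum_le_sum fun j _ => ?_
  have := mul_le_mul_of_nonneg_left (four_mul_sq_exp_half_sub_le (a i) (b j))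
    (sq_nonneg ‖(U.conjTranspose * V) i j‖)
  simp only [hw]
  linarith

/-! ### Gibbs states -/

/-- A Gibbs state is the exponential of a Hermitian matrix. -/
lemma exists_gibbs_eq_exp (β : ℝ) {H : QMatrix n} (hH : H.IsHermitian) :
    ∃ (c : ℝ) (U : QMatrix n) (f : (Fin n → Fin 2) → ℝ),
      U.conjTranspose * U = 1 ∧ U * U.conjTranspose = 1 ∧
      -(β : ℂ) • H - (c : ℂ) • (1 : QMatrix n) = unitaryConj U f ∧
      gibbs β H = NormedSpace.exp (unitaryConj U f) ∧
      (NormedSpace.exp (unitaryConj U f)).trace = 1 := by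
  have hK : (-(β : ℂ) • H).IsHermitian := by
    rw [Matrix.IsHermitian, Matrix.conjTranspose_smul, hH.eq]
    simp
  obtain ⟨U, f, hU, hU', hK⟩ := exists_unitaryConj hK
  set Z : ℝ := ∑ i, Real.exp (f i) with hZ
  have hZ0 : 0 < Z := Finset.sum_pos (fun i _ => Real.exp_pos _) Finset.univ_nonempty
  have hexp : ∀ i, Real.exp (f i - Real.log Z) = Z⁻¹ * Real.exp (f i) := fun i => by
    rw [Real.exp_sub, Real.exp_log hZ0]; ring
  -- The normalization by the partition function `Z` becomes a shift of the exponent by `log Z`.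
  refine ⟨Real.log Z, U, fun i => f i - Real.log Z, hU, hU', ?_, ?_, ?_⟩
  · rw [hK, ← hU', unitaryConj, unitaryConj]
    have : Matrix.diagonal (fun i => ((f i - Real.log Z : ℝ) : ℂ)) =
        Matrix.diagonal (fun i => (f i : ℂ)) -
          (Real.log Z : ℂ) • (1 : QMatrix n) := by
      rw [Matrix.smul_one_eq_diagonal, Matrix.diagonal_sub]
      simp
    rw [this]
    simp [mul_sub, sub_mul]
  · rw [gibbs, hK, exp_unitaryConj hU', exp_unitaryConj hU', trace_unitaryConj hU, ← hZ,
      unitaryConj, unitaryConj]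
    have : Matrix.diagonal (fun i => ((Real.exp (f i - Real.log Z) : ℝ) : ℂ)) =
        (Z : ℂ)⁻¹ • Matrix.diagonal (fun i => ((Real.exp (f i) : ℝ) : ℂ)) := by
      rw [← Matrix.diagonal_smul]
      congr 1
      ext i
      rw [hexp]
      simp
    rw [this]
    simp
  · rw [exp_unitaryConj hU', trace_unitaryConj hU]
    simp only [hexp]
    rw [← Finset.mul_sum, ← hZ, inv_mul_cancel₀ hZ0.ne', Complex.ofReal_one]

lemma gibbs_isHermitian (β : ℝ) {H : QMatrix n} (hH : H.IsHermitian) :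
    (gibbs β H).IsHermitian := by
  obtain ⟨c, U, f, hU, hU', -, h, -⟩ := exists_gibbs_eq_exp β hH
  rw [h, exp_unitaryConj hU']
  exact unitaryConj_isHermitian _ _

lemma trace_gibbs (β : ℝ) {H : QMatrix n} (hH : H.IsHermitian) : (gibbs β H).trace = 1 := by
  obtain ⟨c, U, f, hU, hU', -, h, h1⟩ := exists_gibbs_eq_exp β hH
  rw [h, h1]

lemma exists_gibbs_eq_conjTranspose_mul (β : ℝ) {H : QMatrix n} (hH : H.IsHermitian) :
    ∃ G : QMatrix n, gibbs β H = G.conjTranspose * G := by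
  obtain ⟨c, U, f, hU, hU', -, h, -⟩ := exists_gibbs_eq_exp β hH
  refine ⟨unitaryConj U (fun i => Real.exp (f i / 2)), ?_⟩
  rw [h, exp_unitaryConj hU', (unitaryConj_isHermitian _ _).eq, unitaryConj_mul hU]
  congr 1
  ext i
  rw [← Real.exp_add]
  congr 1
  ring

/-- The logarithm of a Gibbs state is `-βH` minus a multiple of the identity. That multiple pairs to
zero with the difference of two states of trace one, so the unknown partition functions drop out of
the Pinsker bound. -/
lemma sq_traceNorm_gibbs_sub_le (β : ℝ) {H H' : QMatrix n} (hH : H.IsHermitian)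
    (hH' : H'.IsHermitian) :
    traceNorm (gibbs β H - gibbs β H') ^ 2 ≤
      β * ((H' - H) * (gibbs β H - gibbs β H')).trace.re := by
  obtain ⟨c, U, f, -, -, hA, hg, ht⟩ := exists_gibbs_eq_exp β hH
  obtain ⟨c', U', f', -, -, hA', hg', ht'⟩ := exists_gibbs_eq_exp β hH'
  have key := sq_traceNorm_exp_sub_le (unitaryConj_isHermitian U f)
    (unitaryConj_isHermitian U' f') ht ht'
  rw [← hg, ← hg', ← hA, ← hA'] at key
  refine key.trans (le_of_eq ?_)
  have e : -(β : ℂ) • H - (c : ℂ) • (1 : QMatrix n) - (-(β : ℂ) • H' - (c' : ℂ) • 1) =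
      (β : ℂ) • (H' - H) + ((c' : ℂ) - c) • 1 := by module
  rw [e, add_mul, Matrix.trace_add, smul_mul_assoc, smul_mul_assoc, one_mul, Matrix.trace_smul,
    Matrix.trace_smul, Matrix.trace_sub, trace_gibbs β hH, trace_gibbs β hH', sub_self, smul_zero,
    add_zero, smul_eq_mul, Complex.re_ofReal_mul]

/-! ### Local Hamiltonians -/

/-- The non-identity Pauli strings of weight at most `k`. -/
def lowWeight (n k : ℕ) : Finset (PauliString n) :=
  Finset.univ.filter fun P => P ≠ 0 ∧ P.weight ≤ k

lemma mem_lowWeight {k : ℕ} {P : PauliString n} : P ∈ lowWeight n k ↔ P ≠ 0 ∧ P.weight ≤ k := by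
  simp [lowWeight]

lemma card_lowWeight_le (k : ℕ) (hn : 1 ≤ n) :
    ((lowWeight n k).card : ℝ) ≤ 21 * (n : ℝ) ^ k := by
  refine le_trans ?_ (card_weight_le k hn)
  exact_mod_cast Finset.card_le_card fun P h =>
    Finset.mem_filter.2 ⟨Finset.mem_univ P, (mem_lowWeight.1 h).2⟩

/-- The identity string must not contribute. The two alternatives in `h0` serve the two uses:
elements of the net have equal (zero) identity coefficients, while an arbitrary Hamiltonian is only
paired with a traceless difference of states. -/
lemma re_trace_sub_mul_eq_sum {k : ℕ} {H H' M : QMatrix n} (hH : IsLocalHamiltonian k H)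
    (hH' : IsLocalHamiltonian k H') (h0 : pauliCoeff H 0 = pauliCoeff H' 0 ∨ M.trace = 0) :
    ((H - H') * M).trace.re = ∑ P ∈ lowWeight n k,
      ((pauliCoeff H P).re - (pauliCoeff H' P).re) * (P.toMatrix * M).trace.re := by
  rw [trace_mul_eq_sum_pauliCoeff, Complex.re_sum]
  symm
  rw [lowWeight, Finset.sum_filter]
  refine Finset.sum_congr rfl fun P _ => ?_
  rw [pauliCoeff_sub]
  split_ifs with hP
  · rw [pauliCoeff_eq_ofReal hH.1, pauliCoeff_eq_ofReal hH'.1, ← Complex.ofReal_sub,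
      Complex.re_ofReal_mul]
    simp
  · by_cases hw : P.weight ≤ k
    · have hP0 : P = 0 := by by_contra h; exact hP ⟨h, hw⟩
      subst hP0
      rcases h0 with h0 | h0
      · rw [h0, sub_self, zero_mul, Complex.zero_re]
      · rw [PauliString.toMatrix_zero, one_mul, h0, mul_zero, Complex.zero_re]
    · rw [hH.2 P (not_le.1 hw), hH'.2 P (not_le.1 hw), sub_self, zero_mul, Complex.zero_re]

/-- The Pinsker bound in Pauli coordinates. Taking `c` to be the grid step gives the covering
property; `c = 2`, valid for any two elements of the net, gives the accuracy of the output. -/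
lemma sq_traceNorm_gibbs_sub_le_sum {β : ℝ} (hβ : 0 ≤ β) {k : ℕ} {H H' : QMatrix n}
    (hH : IsLocalHamiltonian k H) (hH' : IsLocalHamiltonian k H') {c : ℝ}
    (hc : ∀ P ∈ lowWeight n k, |(pauliCoeff H' P).re - (pauliCoeff H P).re| ≤ c) :
    traceNorm (gibbs β H - gibbs β H') ^ 2 ≤ β * ∑ P ∈ lowWeight n k,
      c * |(P.toMatrix * (gibbs β H - gibbs β H')).trace.re| := by
  refine (sq_traceNorm_gibbs_sub_le β hH.1 hH'.1).trans (mul_le_mul_of_nonneg_left ?_ hβ)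
  rw [re_trace_sub_mul_eq_sum hH' hH
    (Or.inr (by rw [Matrix.trace_sub, trace_gibbs β hH.1, trace_gibbs β hH'.1, sub_self]))]
  refine Finset.sum_le_sum fun P hP => ?_
  refine (le_abs_self _).trans ?_
  rw [abs_mul]
  exact mul_le_mul_of_nonneg_right (hc P hP) (abs_nonneg _)

lemma PauliString.conjTranspose_mul_self (P : PauliString n) :
    P.toMatrix.conjTranspose * P.toMatrix = 1 := by
  rw [P.toMatrix_isHermitian.eq, P.toMatrix_mul_self]

/-! ### The net -/

/-- The Hamiltonian with prescribed coefficients at the non-identity strings of low weight. -/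
def ofCoeffs (k : ℕ) (h : PauliString n → ℝ) : QMatrix n :=
  ∑ P : PauliString n, ((if P ∈ lowWeight n k then h P else 0 : ℝ) : ℂ) • P.toMatrix

lemma pauliCoeff_ofCoeffs (k : ℕ) (h : PauliString n → ℝ) (P : PauliString n) :
    pauliCoeff (ofCoeffs k h) P = ((if P ∈ lowWeight n k then h P else 0 : ℝ) : ℂ) :=
  pauliCoeff_sum_smul (fun P => ((if P ∈ lowWeight n k then h P else 0 : ℝ) : ℂ)) P

lemma ofCoeffs_isLocalHamiltonian (k : ℕ) (h : PauliString n → ℝ) :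
    IsLocalHamiltonian k (ofCoeffs k h) := by
  refine ⟨isHermitian_sum_smul _, fun P hP => ?_⟩
  rw [pauliCoeff_ofCoeffs, if_neg, Complex.ofReal_zero]
  rw [mem_lowWeight]
  exact fun h => absurd h.2 (not_le.2 hP)

lemma ofCoeffs_mem_hamiltonianNet {ε β : ℝ} {k : ℕ} {h : PauliString n → ℝ}
    (hh : ∀ P ∈ lowWeight n k, ∃ m : ℤ, |gridStep ε k n β * m| ≤ 1 ∧ h P = gridStep ε k n β * m) :
    ofCoeffs k h ∈ hamiltonianNet ε k n β := by
  refine ⟨ofCoeffs_isLocalHamiltonian k h, ?_, fun P => ?_⟩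
  · rw [pauliCoeff_ofCoeffs, if_neg, Complex.ofReal_zero]
    simp [mem_lowWeight]
  · rw [pauliCoeff_ofCoeffs]
    by_cases hP : P ∈ lowWeight n k
    · obtain ⟨m, hm, e⟩ := hh P hP
      exact ⟨m, hm, by rw [if_pos hP, e]⟩
    · exact ⟨0, by simp, by simp [hP]⟩

lemma eq_ofCoeffs_of_mem {ε β : ℝ} {k : ℕ} {H : QMatrix n} (hH : H ∈ hamiltonianNet ε k n β) :
    H = ofCoeffs k fun P => (pauliCoeff H P).re := by
  refine pauliCoeff_ext fun P => ?_
  rw [pauliCoeff_ofCoeffs]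
  split_ifs with hP
  · exact pauliCoeff_eq_ofReal hH.1.1 P
  · rw [Complex.ofReal_zero]
    by_cases hw : P.weight ≤ k
    · have hP0 : P = 0 := by by_contra h; exact hP (mem_lowWeight.2 ⟨h, hw⟩)
      rw [hP0]; exact hH.2.1
    · exact hH.1.2 P (not_le.1 hw)

lemma abs_re_pauliCoeff_le_one {ε β : ℝ} {k : ℕ} {H : QMatrix n}
    (hH : H ∈ hamiltonianNet ε k n β) (P : PauliString n) : |(pauliCoeff H P).re| ≤ 1 := by
  obtain ⟨m, hm, e⟩ := hH.2.2 P
  rw [e, Complex.ofReal_re]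
  exact hm

lemma hamiltonianNet_finite {ε β : ℝ} {k : ℕ} (hη : 0 < gridStep ε k n β) :
    (hamiltonianNet ε k n β).Finite := by
  set η := gridStep ε k n β
  have hfin : (Set.univ.pi fun _ : PauliString n => Set.Icc (-⌈η⁻¹⌉) ⌈η⁻¹⌉).Finite :=
    Set.Finite.pi fun _ => Set.finite_Icc _ _
  refine (hfin.image fun m => ofCoeffs k fun P => η * (m P : ℤ)).subset fun H hH => ?_
  choose m hm e using hH.2.2
  refine ⟨m, fun P _ => ?_, ?_⟩
  · have h1 : |(m P : ℝ)| ≤ η⁻¹ := by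
      have := hm P
      rw [abs_mul, abs_of_pos hη] at this
      rwa [← one_div, le_div_iff₀ hη, mul_comm]
    obtain ⟨h2, h3⟩ := abs_le.1 (h1.trans (Int.le_ceil η⁻¹))
    exact ⟨by exact_mod_cast h2, by exact_mod_cast h3⟩
  · conv_rhs => rw [eq_ofCoeffs_of_mem hH]
    simp only [e, Complex.ofReal_re]
    rfl

/-- Rounding is towards zero rather than to the nearest grid point, so that coefficients in `[-1,
1]` stay there. -/
lemma exists_int_abs_sub_mul_le {η : ℝ} (hη : 0 < η) (x : ℝ) :
    ∃ m : ℤ, |η * m| ≤ |x| ∧ |x - η * m| ≤ η := by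
  wlog hx : 0 ≤ x generalizing x
  · obtain ⟨m, h1, h2⟩ := this (-x) (by linarith)
    refine ⟨-m, ?_, ?_⟩
    · rw [abs_neg] at h1
      push_cast
      rwa [mul_neg, abs_neg]
    · push_cast
      rw [← abs_neg, mul_neg]
      convert h2 using 2
      ring
  refine ⟨⌊x / η⌋, ?_, ?_⟩
  · have h1 := Int.floor_le (x / η)
    rw [le_div_iff₀ hη] at h1
    have h0 : (0 : ℝ) ≤ ⌊x / η⌋ := by exact_mod_cast Int.floor_nonneg.2 (by positivity)
    rw [abs_of_nonneg (by positivity), abs_of_nonneg hx]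
    linarith
  · have h1 := Int.floor_le (x / η)
    have h2 := (Int.lt_floor_add_one (x / η)).le
    rw [le_div_iff₀ hη] at h1
    rw [div_le_iff₀ hη] at h2
    rw [abs_le]
    constructor <;> linarith

/-- The Gibbs states of the net cover those of all local Hamiltonians with bounded coefficients. -/
lemma exists_net_traceNorm_le {ε β : ℝ} {k : ℕ} (hn : 1 ≤ n) (hβ : 0 < β)
    (hη : 0 < gridStep ε k n β) {H : QMatrix n} (hH : IsLocalHamiltonian k H)
    (h1 : ∀ P, ‖pauliCoeff H P‖ ≤ 1) :
    ∃ H₀ ∈ hamiltonianNet ε k n β,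
      traceNorm (gibbs β H - gibbs β H₀) ≤ β * (21 * (n : ℝ) ^ k * gridStep ε k n β) := by
  set η := gridStep ε k n β
  choose m hm1 hm2 using fun P => exists_int_abs_sub_mul_le hη (pauliCoeff H P).re
  refine ⟨ofCoeffs k fun P => η * m P, ofCoeffs_mem_hamiltonianNet fun P _ => ⟨m P, ?_, rfl⟩, ?_⟩
  · exact (hm1 P).trans ((Complex.abs_re_le_norm _).trans (h1 P))
  set H₀ := ofCoeffs k fun P => η * m P with hH₀
  have hloc : IsLocalHamiltonian k H₀ := ofCoeffs_isLocalHamiltonian _ _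
  have key := sq_traceNorm_gibbs_sub_le_sum hβ.le hH hloc (c := η) (fun P hP => by
    rw [hH₀, pauliCoeff_ofCoeffs, if_pos hP, Complex.ofReal_re, abs_sub_comm]
    exact hm2 P)
  set T := traceNorm (gibbs β H - gibbs β H₀)
  have hT : 0 ≤ T := traceNorm_nonneg _
  have hsum : ∑ P ∈ lowWeight n k, η * |(P.toMatrix * (gibbs β H - gibbs β H₀)).trace.re| ≤
      21 * (n : ℝ) ^ k * (η * T) := by
    calc _ ≤ ∑ P ∈ lowWeight n k, η * T := Finset.sum_le_sum fun P _ =>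
          mul_le_mul_of_nonneg_left (abs_re_trace_mul_le_traceNorm
            ((gibbs_isHermitian β hH.1).sub (gibbs_isHermitian β hloc.1))
            P.conjTranspose_mul_self) hη.le
      _ ≤ _ := by
          rw [Finset.sum_const, nsmul_eq_mul]
          exact mul_le_mul_of_nonneg_right (card_lowWeight_le k hn) (by positivity)
  -- The Pauli expectations of the difference are themselves at most `T`, so the quadratic bound
  -- improves to a linear one in the grid step after division by `T`.
  have h2 : T * T ≤ (β * (21 * (n : ℝ) ^ k * η)) * T := by
    calc T * T = T ^ 2 := (sq T).symm
      _ ≤ β * (21 * (n : ℝ) ^ k * (η * T)) := key.trans (mul_le_mul_of_nonneg_left hsum hβ.le)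
      _ = _ := by ring
  rcases hT.eq_or_lt with h | h
  · rw [← h]; positivity
  · exact le_of_mul_le_mul_right h2 h

/-! ### A Bernstein bound for independent samples from a finite set -/

section Bernstein

variable {Ω : Type*} [Fintype Ω] {N : ℕ}

/-- The probability of `E` for `N` independent samples with distribution `p`. -/
def sampleProb (p : Ω → ℝ) (E : Set (Fin N → Ω)) : ℝ :=
  ∑ ω, E.indicator (fun ω => ∏ t, p (ω t)) ω

variable {p : Ω → ℝ}

lemma sampleProb_mono (hp : ∀ r, 0 ≤ p r) {E F : Set (Fin N → Ω)} (h : E ⊆ F) :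
    sampleProb p E ≤ sampleProb p F :=
  Finset.sum_le_sum fun _ _ =>
    Set.indicator_le_indicator_of_subset h (fun _ => Finset.prod_nonneg fun _ _ => hp _) _

lemma sampleProb_compl (h1 : ∑ r, p r = 1) (E : Set (Fin N → Ω)) :
    sampleProb p Eᶜ = 1 - sampleProb p E := by
  have h : ∑ ω : Fin N → Ω, ∏ t, p (ω t) = 1 := by
    rw [← Fintype.prod_sum fun (_ : Fin N) r => p r]
    simp [h1]
  rw [sampleProb, sampleProb, ← h, ← Finset.sum_sub_distrib]
  refine Finset.sum_congr rfl fun ω _ => ?_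
  by_cases hω : ω ∈ E <;> simp [hω]

lemma sampleProb_biUnion_le (hp : ∀ r, 0 ≤ p r) {ι : Type*} (s : Finset ι)
    (E : ι → Set (Fin N → Ω)) :
    sampleProb p (⋃ i ∈ s, E i) ≤ ∑ i ∈ s, sampleProb p (E i) := by
  unfold sampleProb
  rw [Finset.sum_comm]
  refine Finset.sum_le_sum fun ω _ => ?_
  have h0 : ∀ i, 0 ≤ (E i).indicator (fun ω => ∏ t, p (ω t)) ω := fun i =>
    Set.indicator_nonneg (fun _ _ => Finset.prod_nonneg fun _ _ => hp _) _
  by_cases h : ω ∈ ⋃ i ∈ s, E i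
  · obtain ⟨i, hi, hω⟩ := Set.mem_iUnion₂.1 h
    rw [Set.indicator_of_mem h]
    calc _ = (E i).indicator (fun ω => ∏ t, p (ω t)) ω := (Set.indicator_of_mem hω _).symm
      _ ≤ _ := Finset.single_le_sum (fun i _ => h0 i) hi
  · rw [Set.indicator_of_notMem h]
    exact Finset.sum_nonneg fun i _ => h0 i

/-- Exponential Markov inequality. Since `e^y ≤ 1 + y + y²` for `|y| ≤ 1`, the moment generating
function is controlled by the mean and the second moment. Either sign of `lam` is allowed, which
covers both tails. -/
lemma sampleProb_le_exp (hp : ∀ r, 0 ≤ p r) (h1 : ∑ r, p r = 1) (Y : Ω → ℝ) {v lam : ℝ}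
    (hv : ∑ r, p r * Y r ^ 2 ≤ v) (hlam : ∀ r, |lam * Y r| ≤ 1) (a : ℝ) :
    sampleProb p {ω : Fin N → Ω | a ≤ lam * ∑ t, Y (ω t) - N * (lam * ∑ r, p r * Y r)} ≤
      Real.exp (-a + N * (lam ^ 2 * v)) := by
  set μ := ∑ r, p r * Y r with hμ
  have hmgf : ∑ r, p r * Real.exp (lam * Y r) ≤ Real.exp (lam * μ + lam ^ 2 * v) := by
    calc ∑ r, p r * Real.exp (lam * Y r)
        ≤ ∑ r, p r * (1 + lam * Y r + (lam * Y r) ^ 2) := by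
          refine Finset.sum_le_sum fun r _ => mul_le_mul_of_nonneg_left ?_ (hp r)
          have := (abs_le.1 (Real.abs_exp_sub_one_sub_id_le (hlam r))).2
          linarith
      _ = 1 + lam * μ + lam ^ 2 * ∑ r, p r * Y r ^ 2 := by
          have e : ∑ r, p r * (1 + lam * Y r + (lam * Y r) ^ 2) =
              ∑ r, p r + lam * μ + lam ^ 2 * ∑ r, p r * Y r ^ 2 := by
            rw [hμ, Finset.mul_sum, Finset.mul_sum, ← Finset.sum_add_distrib,
              ← Finset.sum_add_distrib]
            exact Finset.sum_congr rfl fun r _ => by ring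
          rw [e, h1]
      _ ≤ lam * μ + lam ^ 2 * v + 1 := by
          have := mul_le_mul_of_nonneg_left hv (sq_nonneg lam)
          linarith
      _ ≤ _ := Real.add_one_le_exp _
  have hmgf0 : 0 ≤ ∑ r, p r * Real.exp (lam * Y r) :=
    Finset.sum_nonneg fun r _ => mul_nonneg (hp r) (Real.exp_pos _).le
  calc _ ≤ ∑ ω : Fin N → Ω, (∏ t, p (ω t) * Real.exp (lam * Y (ω t))) *
        Real.exp (-a - N * (lam * μ)) := by
        refine Finset.sum_le_sum fun ω _ => ?_
        have hprod : 0 ≤ ∏ t, p (ω t) := Finset.prod_nonneg fun _ _ => hp _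
        have e : (∏ t, p (ω t) * Real.exp (lam * Y (ω t))) * Real.exp (-a - N * (lam * μ)) =
            (∏ t, p (ω t)) * Real.exp (lam * ∑ t, Y (ω t) - N * (lam * μ) - a) := by
          rw [Finset.prod_mul_distrib, ← Real.exp_sum, mul_assoc, ← Real.exp_add, ← Finset.mul_sum]
          congr 2
          ring
        rw [e]
        refine Set.indicator_apply_le' (fun hω => ?_) fun _ => ?_
        · exact le_mul_of_one_le_right hprod (Real.one_le_exp (sub_nonneg.2 hω))
        · exact mul_nonneg hprod (Real.exp_pos _).le
    _ = (∑ r, p r * Real.exp (lam * Y r)) ^ N * Real.exp (-a - N * (lam * μ)) := by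
        rw [← Finset.sum_mul, ← Fintype.prod_sum fun (_ : Fin N) r => p r * Real.exp (lam * Y r)]
        simp
    _ ≤ Real.exp (lam * μ + lam ^ 2 * v) ^ N * Real.exp (-a - N * (lam * μ)) :=
        mul_le_mul_of_nonneg_right (pow_le_pow_left₀ hmgf0 hmgf N) (Real.exp_pos _).le
    _ = _ := by
        rw [← Real.exp_nat_mul, ← Real.exp_add]
        congr 1
        ring

/-- Bernstein's inequality for the empirical mean of a bounded variable. -/
lemma sampleProb_abs_mean_sub_le (hN : 0 < N) (hp : ∀ r, 0 ≤ p r) (h1 : ∑ r, p r = 1)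
    (Y : Ω → ℝ) {v γ : ℝ} (hv0 : 0 < v) (hv : ∑ r, p r * Y r ^ 2 ≤ v) (hY : ∀ r, |Y r| ≤ v)
    (hγ : 0 < γ) (hγ2 : γ ≤ 2) :
    sampleProb p {ω : Fin N → Ω | γ < |(∑ t, Y (ω t)) / N - ∑ r, p r * Y r|} ≤
      2 * Real.exp (-(N * γ ^ 2 / (4 * v))) := by
  have hN0 : (0 : ℝ) < N := by exact_mod_cast hN
  -- This value minimizes `-lam γ + lam² v`. The requirement `|lam Y| ≤ 1` then follows from `|Y| ≤
  -- v` and `γ ≤ 2`, so one number `v` can bound both the second moment and the absolute value.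
  set lam := γ / (2 * v) with hlam
  have hlam0 : 0 < lam := by positivity
  have hl1 : ∀ r, |lam * Y r| ≤ 1 := fun r => by
    rw [abs_mul, abs_of_pos hlam0]
    calc lam * |Y r| ≤ lam * v := mul_le_mul_of_nonneg_left (hY r) hlam0.le
      _ = γ / 2 := by rw [hlam]; field_simp
      _ ≤ 1 := by linarith
  have hl2 : ∀ r, |-lam * Y r| ≤ 1 := fun r => by rw [neg_mul, abs_neg]; exact hl1 r
  have b1 := sampleProb_le_exp (N := N) hp h1 Y hv hl1 (N * (lam * γ))
  have b2 := sampleProb_le_exp (N := N) hp h1 Y hv hl2 (N * (lam * γ))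
  have e : -(N * (lam * γ)) + N * (lam ^ 2 * v) = -(N * γ ^ 2 / (4 * v)) := by
    rw [hlam]; field_simp; ring
  rw [neg_sq] at b2
  rw [e] at b1 b2
  set μ := ∑ r, p r * Y r
  -- The upper and the lower tail, indexed by `Bool` so that the union bound over a finite set
  -- applies.
  set E : Bool → Set (Fin N → Ω) := fun b => bif b
    then {ω : Fin N → Ω | N * (lam * γ) ≤ lam * ∑ t, Y (ω t) - N * (lam * μ)}
    else {ω : Fin N → Ω | N * (lam * γ) ≤ -lam * ∑ t, Y (ω t) - N * (-lam * μ)}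
  have hsub : {ω : Fin N → Ω | γ < |(∑ t, Y (ω t)) / N - μ|} ⊆ ⋃ b ∈ Finset.univ, E b := by
    intro ω hω
    simp only [Finset.mem_univ, Set.iUnion_true, Set.mem_iUnion]
    have hmul : lam * ∑ t, Y (ω t) - N * (lam * μ) =
        N * (lam * ((∑ t, Y (ω t)) / N - μ)) := by
      field_simp
    change γ < |(∑ t, Y (ω t)) / N - μ| at hω
    rcases lt_abs.1 hω with h | h
    · refine ⟨true, ?_⟩
      change N * (lam * γ) ≤ lam * ∑ t, Y (ω t) - N * (lam * μ)
      rw [hmul]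
      gcongr
    · refine ⟨false, ?_⟩
      change N * (lam * γ) ≤ -lam * ∑ t, Y (ω t) - N * (-lam * μ)
      have : -lam * ∑ t, Y (ω t) - N * (-lam * μ) =
          N * (lam * -((∑ t, Y (ω t)) / N - μ)) := by
        linear_combination -hmul
      rw [this]
      gcongr
  calc _ ≤ sampleProb p (⋃ b ∈ Finset.univ, E b) := sampleProb_mono hp hsub
    _ ≤ ∑ b, sampleProb p (E b) := sampleProb_biUnion_le hp _ _
    _ ≤ _ := by
        rw [Fintype.sum_bool]
        have := add_le_add b1 b2
        rw [← two_mul] at this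
        exact this

end Bernstein

/-! ### Classical shadows -/

/-- The single-copy shadow estimate of `Tr[P ρ]`. -/
def shadowValue (P : PauliString n) (r : Record n) : ℝ :=
  ∏ i, if P i = 0 then (1 : ℝ) else if (r.1 i).succ = P i then 3 * (-1) ^ (r.2 i : ℕ) else 0

lemma shadowEstimate_eq {N : ℕ} (ω : Fin N → Record n) (P : PauliString n) :
    shadowEstimate ω P = (∑ t, shadowValue P (ω t)) / N := rfl

/-- The one-qubit projector for the outcome `s` of the measurement of the Pauli `b`. -/
def outcomeProj (b : Fin 3) (s : Fin 2) : Matrix (Fin 2) (Fin 2) ℂ :=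
  (1 / 2 : ℂ) • (1 + (-1 : ℂ) ^ (s : ℕ) • pauli b.succ)

lemma outcomeProj_isHermitian (b : Fin 3) (s : Fin 2) : (outcomeProj b s).IsHermitian := by
  rw [Matrix.IsHermitian, outcomeProj, Matrix.conjTranspose_smul, Matrix.conjTranspose_add,
    Matrix.conjTranspose_smul, (pauli_isHermitian _).eq]
  simp

lemma outcomeProj_mul_self (b : Fin 3) (s : Fin 2) :
    outcomeProj b s * outcomeProj b s = outcomeProj b s := by
  have hs : ((-1 : ℂ) ^ (s : ℕ)) * (-1) ^ (s : ℕ) = 1 := by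
    rw [← mul_pow]; simp
  rw [outcomeProj, smul_mul_smul_comm, add_mul, mul_add, mul_add, one_mul, mul_one, one_mul,
    smul_mul_smul_comm, hs, pauli_mul_self]
  module

lemma outcomeProj_add (b : Fin 3) : outcomeProj b 0 + outcomeProj b 1 = 1 := by
  simp only [outcomeProj, Fin.val_zero, Fin.val_one, pow_zero, pow_one]
  module

lemma outcomeProj_sub (b : Fin 3) : outcomeProj b 0 - outcomeProj b 1 = pauli b.succ := by
  simp only [outcomeProj, Fin.val_zero, Fin.val_one, pow_zero, pow_one]
  module

/-- The product of the one-qubit projectors is a Hermitian projection `Q`, so `Tr[ρQ]` is the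
squared Hilbert–Schmidt norm of `GQ`. -/
lemma recordProb_nonneg {ρ G : QMatrix n} (hρ : ρ = G.conjTranspose * G) (r : Record n) :
    0 ≤ recordProb ρ r := by
  refine mul_nonneg (by positivity) ?_
  change 0 ≤ (ρ * tensor fun i => outcomeProj (r.1 i) (r.2 i)).trace.re
  set Q : QMatrix n := tensor fun i => outcomeProj (r.1 i) (r.2 i) with hQ
  have hQQ : Q * Q = Q := by
    simp only [hQ, tensor_mul, outcomeProj_mul_self]
  have hQh : Q.conjTranspose = Q := by
    rw [hQ, conjTranspose_tensor]
    exact congrArg tensor (funext fun i => outcomeProj_isHermitian _ _)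
  have : (ρ * Q).trace = ((G * Q).conjTranspose * (G * Q)).trace := by
    rw [hρ, Matrix.conjTranspose_mul, hQh, mul_assoc Q, Matrix.trace_mul_comm Q]
    simp only [mul_assoc, hQQ]
  rw [this, re_trace_conjTranspose_mul_self]
  exact hsNormSq_nonneg _

/-- The expectation of a product over the qubits. -/
lemma sum_recordProb_mul_prod (ρ : QMatrix n) (y : Fin n → Fin 3 → Fin 2 → ℝ) :
    ∑ r : Record n, recordProb ρ r * ∏ i, y i (r.1 i) (r.2 i) =
      (1 / 3 : ℝ) ^ n * (ρ * tensor fun i =>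
        ∑ b, ∑ s, (y i b s : ℂ) • outcomeProj b s).trace.re := by
  have h1 : (tensor fun i => ∑ b, ∑ s, (y i b s : ℂ) • outcomeProj b s) =
      ∑ r : Record n, ((∏ i, y i (r.1 i) (r.2 i) : ℝ) : ℂ) •
        tensor fun i => outcomeProj (r.1 i) (r.2 i) := by
    rw [← sum_tensor, Fintype.sum_prod_type]
    refine Finset.sum_congr rfl fun b _ => ?_
    rw [← sum_tensor]
    refine Finset.sum_congr rfl fun s _ => ?_
    rw [tensor_smul (fun i => (y i (b i) (s i) : ℂ))]
    push_cast
    rfl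
  rw [h1, Finset.mul_sum, Matrix.trace_sum, Complex.re_sum, Finset.mul_sum]
  refine Finset.sum_congr rfl fun r _ => ?_
  rw [mul_smul_comm, Matrix.trace_smul, smul_eq_mul, Complex.re_ofReal_mul]
  change (1 / 3 : ℝ) ^ n * (ρ * tensor fun i => outcomeProj (r.1 i) (r.2 i)).trace.re * _ = _
  ring

lemma one_third_pow_mul_re_trace (ρ A : QMatrix n) :
    (1 / 3 : ℝ) ^ n * (ρ * ((3 : ℂ) ^ n • A)).trace.re = (ρ * A).trace.re := by
  have h3 : (3 : ℂ) ^ n = ((3 ^ n : ℝ) : ℂ) := by push_cast; rfl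
  rw [mul_smul_comm, Matrix.trace_smul, smul_eq_mul, h3, Complex.re_ofReal_mul, ← mul_assoc,
    ← mul_pow]
  norm_num

lemma sum_recordProb {ρ : QMatrix n} (hρ : ρ.trace = 1) : ∑ r, recordProb ρ r = 1 := by
  have h := sum_recordProb_mul_prod ρ fun _ _ _ => 1
  simp only [Finset.prod_const_one, mul_one, Fin.sum_univ_two, Complex.ofReal_one, one_smul,
    outcomeProj_add, Finset.sum_const, Finset.card_univ, Fintype.card_fin] at h
  have h2 : (tensor fun _ : Fin n => 3 • (1 : Matrix (Fin 2) (Fin 2) ℂ)) =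
      (3 : ℂ) ^ n • (1 : QMatrix n) := by
    have := tensor_smul (fun _ : Fin n => (3 : ℂ)) (fun _ => 1)
    rw [tensor_one] at this
    simp only [Finset.prod_const, Finset.card_univ, Fintype.card_fin] at this
    rw [← this]
    congr 1
    ext i : 1
    module
  rw [h, h2, one_third_pow_mul_re_trace, mul_one, hρ, Complex.one_re]

/-- The shadow estimate is unbiased. -/
lemma sum_recordProb_mul_shadowValue (ρ : QMatrix n) (P : PauliString n) :
    ∑ r, recordProb ρ r * shadowValue P r = (P.toMatrix * ρ).trace.re := by
  have h := sum_recordProb_mul_prod ρ fun i b s =>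
    if P i = 0 then (1 : ℝ) else if b.succ = P i then 3 * (-1) ^ (s : ℕ) else 0
  -- Off the support each of the three bases contributes the identity; on it only the matching basis
  -- survives and contributes three times the Pauli matrix. Both give a factor `3`, which cancels
  -- the probability `1/3` of a basis.
  have hq : ∀ q : Fin 4, ∑ b : Fin 3, ∑ s : Fin 2, (((if q = 0 then (1 : ℝ)
      else if b.succ = q then 3 * (-1) ^ (s : ℕ) else 0) : ℝ) : ℂ) • outcomeProj b s =
      (3 : ℂ) • pauli q := by
    intro q
    induction q using Fin.cases with
    | zero =>
      simp only [if_true, Complex.ofReal_one, one_smul, Fin.sum_univ_two, outcomeProj_add,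
        Finset.sum_const, Finset.card_univ, Fintype.card_fin, pauli_zero]
      module
    | succ q =>
      rw [Finset.sum_eq_single q]
      · rw [← outcomeProj_sub]
        simp only [Fin.succ_ne_zero, if_false, if_true, Fin.sum_univ_two, Fin.val_zero,
          Fin.val_one, pow_zero, pow_one]
        push_cast
        module
      · intro b _ hb
        simp [Fin.succ_inj, hb]
      · simp
  simp only [hq] at h
  rw [tensor_smul (fun _ => (3 : ℂ))] at h
  simp only [Finset.prod_const, Finset.card_univ, Fintype.card_fin] at h
  rw [one_third_pow_mul_re_trace, Matrix.trace_mul_comm] at h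
  exact h

/-- Squaring removes the outcome signs, so the projectors sum to the identity and the state enters
only through its trace. Each qubit of the support contributes `9` with probability `1/3`. This makes
the sample size proportional to `3^k` instead of `9^k`. -/
lemma sum_recordProb_mul_shadowValue_sq {ρ : QMatrix n} (hρ : ρ.trace = 1) (P : PauliString n) :
    ∑ r, recordProb ρ r * shadowValue P r ^ 2 = 3 ^ P.weight := by
  have h := sum_recordProb_mul_prod ρ fun i b s =>
    (if P i = 0 then (1 : ℝ) else if b.succ = P i then 3 * (-1) ^ (s : ℕ) else 0) ^ 2
  have hq : ∀ q : Fin 4, ∑ b : Fin 3, ∑ s : Fin 2, ((((if q = 0 then (1 : ℝ)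
      else if b.succ = q then 3 * (-1) ^ (s : ℕ) else 0) ^ 2 : ℝ)) : ℂ) • outcomeProj b s =
      (3 : ℂ) • ((if q = 0 then 1 else 3 : ℂ) • (1 : Matrix (Fin 2) (Fin 2) ℂ)) := by
    intro q
    induction q using Fin.cases with
    | zero =>
      simp only [if_true, one_pow, Complex.ofReal_one, one_smul, Fin.sum_univ_two, outcomeProj_add,
        Finset.sum_const, Finset.card_univ, Fintype.card_fin]
      module
    | succ q =>
      rw [Finset.sum_eq_single q]
      · rw [← outcomeProj_add q]
        simp only [Fin.succ_ne_zero, if_false, if_true, Fin.sum_univ_two, Fin.val_zero,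
          Fin.val_one, pow_zero, pow_one]
        push_cast
        module
      · intro b _ hb
        simp [Fin.succ_inj, hb]
      · simp
  simp only [hq] at h
  rw [tensor_smul (fun _ => (3 : ℂ)), tensor_smul (fun i => if P i = 0 then 1 else (3 : ℂ)),
    tensor_one] at h
  simp only [Finset.prod_const, Finset.card_univ, Fintype.card_fin] at h
  rw [one_third_pow_mul_re_trace] at h
  simp only [shadowValue, ← Finset.prod_pow]
  rw [h]
  have e : (∏ i, if P i = 0 then 1 else (3 : ℂ)) = ((3 ^ P.weight : ℝ) : ℂ) := by
    rw [Finset.prod_ite, PauliString.weight]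
    simp
  rw [e, mul_smul_comm, mul_one, Matrix.trace_smul, hρ, smul_eq_mul, mul_one, Complex.ofReal_re]

lemma abs_shadowValue_le (P : PauliString n) (r : Record n) :
    |shadowValue P r| ≤ 3 ^ P.weight := by
  have e : (3 : ℝ) ^ P.weight = ∏ i, if P i = 0 then 1 else (3 : ℝ) := by
    rw [Finset.prod_ite, PauliString.weight]
    simp
  rw [shadowValue, Finset.abs_prod, e]
  refine Finset.prod_le_prod (fun _ _ => abs_nonneg _) fun i _ => ?_
  split_ifs <;> simp [abs_mul]

/-- With high probability all the shadow estimates of low weight are accurate. -/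
lemma one_sub_le_dataProb {N k : ℕ} (hN : 0 < N) (hn : 1 ≤ n) {ρ G : QMatrix n}
    (hρ : ρ = G.conjTranspose * G) (hρ1 : ρ.trace = 1) {γ : ℝ} (hγ : 0 < γ) (hγ2 : γ ≤ 2) :
    1 - 42 * (n : ℝ) ^ k * Real.exp (-(N * γ ^ 2 / (4 * 3 ^ k))) ≤
      dataProb ρ {ω : Fin N → Record n | ∀ P ∈ lowWeight n k,
        |shadowEstimate ω P - (P.toMatrix * ρ).trace.re| ≤ γ} := by
  classical
  have hp := recordProb_nonneg hρ
  have h1 := sum_recordProb hρ1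
  set E : Set (Fin N → Record n) := {ω | ∀ P ∈ lowWeight n k,
    |shadowEstimate ω P - (P.toMatrix * ρ).trace.re| ≤ γ}
  set F : PauliString n → Set (Fin N → Record n) := fun P =>
    {ω | γ < |(∑ t, shadowValue P (ω t)) / N - ∑ r, recordProb ρ r * shadowValue P r|}
  have hEF : Eᶜ ⊆ ⋃ P ∈ lowWeight n k, F P := by
    intro ω hω
    simp only [E, Set.mem_compl_iff, Set.mem_ofPred_eq, not_forall, not_le] at hω
    obtain ⟨P, hP, h⟩ := hω
    refine Set.mem_iUnion₂.2 ⟨P, hP, ?_⟩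
    rw [shadowEstimate_eq, ← sum_recordProb_mul_shadowValue] at h
    exact h
  have hF : ∀ P ∈ lowWeight n k, sampleProb (recordProb ρ) (F P) ≤
      2 * Real.exp (-(N * γ ^ 2 / (4 * 3 ^ k))) := fun P hP => by
    have hw : (3 : ℝ) ^ P.weight ≤ 3 ^ k :=
      pow_le_pow_right₀ (by norm_num) (mem_lowWeight.1 hP).2
    exact sampleProb_abs_mean_sub_le hN hp h1 (shadowValue P) (by positivity)
      ((sum_recordProb_mul_shadowValue_sq hρ1 P).trans_le hw)
      (fun r => (abs_shadowValue_le P r).trans hw) hγ hγ2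
  have key : sampleProb (recordProb ρ) Eᶜ ≤
      42 * (n : ℝ) ^ k * Real.exp (-(N * γ ^ 2 / (4 * 3 ^ k))) := by
    calc _ ≤ sampleProb (recordProb ρ) (⋃ P ∈ lowWeight n k, F P) := sampleProb_mono hp hEF
      _ ≤ ∑ P ∈ lowWeight n k, sampleProb (recordProb ρ) (F P) := sampleProb_biUnion_le hp _ _
      _ ≤ ∑ P ∈ lowWeight n k, 2 * Real.exp (-(N * γ ^ 2 / (4 * 3 ^ k))) := Finset.sum_le_sum hF
      _ = (lowWeight n k).card * (2 * Real.exp (-(N * γ ^ 2 / (4 * 3 ^ k)))) := by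
          rw [Finset.sum_const, nsmul_eq_mul]
      _ ≤ 21 * (n : ℝ) ^ k * (2 * Real.exp (-(N * γ ^ 2 / (4 * 3 ^ k)))) :=
          mul_le_mul_of_nonneg_right (card_lowWeight_le k hn) (by positivity)
      _ = _ := by ring
  rw [sampleProb_compl h1] at key
  change _ ≤ sampleProb (recordProb ρ) E
  linarith

/-! ### A polynomial bound on the running time of programs -/

/-- In the run of the program on the input, every natural number operated on and every number of
rounds is at most `V`, except that iterations of up to `T` rounds may occur, but not nested. -/
def Code.Fits (x : Input) (V : ℕ) : {s : Kind} → Code s → ℕ → List ℕ → Prop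
  | _, .var _, _, _ => True
  | _, .lit a, _, _ => a ≤ V
  | _, .natOp o a b, T, e => a.Fits x V T e ∧ b.Fits x V T e ∧ a.natVal x e ≤ V ∧
      b.natVal x e ≤ V ∧ o.apply (a.natVal x e) (b.natVal x e) ≤ V
  | _, .natSum b f, T, e => b.Fits x V T e ∧ b.natVal x e ≤ V ∧
      (∀ j < b.natVal x e, f.Fits x V T (j :: e)) ∧
      ∑ j ∈ Finset.range (b.natVal x e), f.natVal x (j :: e) ≤ V
  | _, .argmin b f, T, e => b.Fits x V T e ∧ b.natVal x e ≤ V ∧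
      ∀ j < b.natVal x e, f.Fits x V T (j :: e)
  | _, .scalarLe a b, T, e => a.Fits x V T e ∧ b.Fits x V T e
  | _, .floor a, T, e => a.Fits x V T e ∧ ⌊(a.scalarVal x e).re⌋₊ ≤ V
  | _, .basis t i, T, e => t.Fits x V T e ∧ i.Fits x V T e
  | _, .outcome t i, T, e => t.Fits x V T e ∧ i.Fits x V T e
  | _, .beta, _, _ => True
  | _, .eps, _, _ => True
  | _, .imag, _, _ => True
  | _, .cast a, T, e => a.Fits x V T e ∧ a.natVal x e ≤ T * V
  | _, .scalarOp _ a b, T, e => a.Fits x V T e ∧ b.Fits x V T e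
  | _, .scalarSum b f, T, e => b.Fits x V T e ∧
      ((b.natVal x e ≤ V ∧ ∀ j < b.natVal x e, f.Fits x V T (j :: e)) ∨
        (b.natVal x e ≤ T ∧ ∀ j < b.natVal x e, f.Fits x V 1 (j :: e)))
  | _, .scalarProd b f, T, e => b.Fits x V T e ∧ b.natVal x e ≤ V ∧
      ∀ j < b.natVal x e, f.Fits x V T (j :: e)
  | _, .expEntry d f i j, T, e => d.Fits x V T e ∧ i.Fits x V T e ∧ j.Fits x V T e ∧
      d.natVal x e ≤ V ∧
      ∀ r < d.natVal x e, ∀ c < d.natVal x e, f.Fits x V T (r :: c :: e)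
  | _, .cond c a b, T, e => c.Fits x V T e ∧ (c.natVal x e = 0 → b.Fits x V T e) ∧
      (c.natVal x e ≠ 0 → a.Fits x V T e)
  | _, .bind a b, T, e => a.Fits x V T e ∧ b.Fits x V T (a.natVal x e :: e)

lemma natSize_le_self (a : ℕ) : a.size ≤ a := Nat.size_le.2 Nat.lt_two_pow_self

section Bounds

variable {V T : ℕ}

lemma le_mul_pow_of_le {a d d' : ℕ} (hV : 4 ≤ V) (h : a ≤ T * V ^ d) (hd : d ≤ d') :
    a ≤ T * V ^ d' :=
  h.trans (Nat.mul_le_mul_left _ (Nat.pow_le_pow_right (by omega) hd))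

/-- Bounds of the form `T * V ^ d` are closed under sums of four terms because `V ≥ 4` absorbs the
factor. `T` stays to the first power. -/
lemma add_le_mul_pow {a b c d₁ d₂ d₃ : ℕ} (hV : 4 ≤ V) (hT : 1 ≤ T) (ha : a ≤ T * V ^ d₁)
    (hb : b ≤ T * V ^ d₂) (hc : c ≤ T * V ^ d₃) :
    1 + a + b + c ≤ T * V ^ (d₁ + d₂ + d₃ + 1) := by
  have h1 := le_mul_pow_of_le hV ha (show d₁ ≤ d₁ + d₂ + d₃ by omega)
  have h2 := le_mul_pow_of_le hV hb (show d₂ ≤ d₁ + d₂ + d₃ by omega)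
  have h3 := le_mul_pow_of_le hV hc (show d₃ ≤ d₁ + d₂ + d₃ by omega)
  have h4 : 1 ≤ T * V ^ (d₁ + d₂ + d₃) := Nat.mul_pos hT (Nat.pow_pos (by omega))
  calc 1 + a + b + c ≤ T * V ^ (d₁ + d₂ + d₃) * 4 := by omega
    _ ≤ T * V ^ (d₁ + d₂ + d₃) * V := Nat.mul_le_mul_left _ hV
    _ = _ := by rw [pow_succ, mul_assoc]

lemma sum_range_le_mul_pow {b d : ℕ} (hb : b ≤ V) {f : ℕ → ℕ}
    (hf : ∀ j < b, f j ≤ T * V ^ d) : ∑ j ∈ Finset.range b, f j ≤ T * V ^ (d + 1) := by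
  calc ∑ j ∈ Finset.range b, f j ≤ ∑ j ∈ Finset.range b, T * V ^ d :=
        Finset.sum_le_sum fun j hj => hf j (Finset.mem_range.1 hj)
    _ = b * (T * V ^ d) := by simp
    _ ≤ V * (T * V ^ d) := Nat.mul_le_mul_right _ hb
    _ = _ := by rw [pow_succ]; ring

lemma NatOp.cost_le (hV : 4 ≤ V) (hT : 1 ≤ T) (o : NatOp) {a b : ℕ} (ha : a ≤ V) (hb : b ≤ V)
    (hab : o.apply a b ≤ V) : o.cost a b ≤ T * V ^ 4 := by
  have h : 1 + a.size + b.size + (o.apply a b).size ≤ V * V := by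
    have h1 := natSize_le_self a
    have h2 := natSize_le_self b
    have h3 := natSize_le_self (o.apply a b)
    have h4 : 4 * V ≤ V * V := Nat.mul_le_mul_right _ hV
    omega
  calc o.cost a b ≤ (V * V) ^ 2 := Nat.pow_le_pow_left h 2
    _ = 1 * V ^ 4 := by ring
    _ ≤ T * V ^ 4 := Nat.mul_le_mul_right _ hT

end Bounds

/-- The running time is polynomial in the size of the natural numbers that occur, and linear in
the number of rounds of the exempted iterations. -/
lemma Code.exists_cost_le {s : Kind} (c : Code s) : ∃ d : ℕ, ∀ (x : Input) (V T : ℕ) (e : List ℕ),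
    4 ≤ V → 1 ≤ T → c.Fits x V T e → c.cost x e ≤ T * V ^ d := by
  -- A filler for absent summands, so that every constructor is handled by the same bound for three
  -- terms; hence the zeros in the exponents below.
  have zero_le' : ∀ V T : ℕ, 0 ≤ T * V ^ 0 := fun _ _ => Nat.zero_le _
  induction c with
  | var i =>
    refine ⟨0, fun x V T e _ hT _ => ?_⟩
    simpa [Code.cost] using hT
  | lit a =>
    refine ⟨0 + 0 + 1 + 1, fun x V T e hV hT h => ?_⟩
    have h1 : a.size ≤ T * V ^ 1 := by
      have : a ≤ V := h
      have := Nat.mul_le_mul_right V hT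
      have := natSize_le_self a
      rw [pow_one]; omega
    have := add_le_mul_pow hV hT (zero_le' V T) (zero_le' V T) h1
    simpa [Code.cost] using this
  | natOp o a b iha ihb =>
    obtain ⟨d₁, h₁⟩ := iha
    obtain ⟨d₂, h₂⟩ := ihb
    refine ⟨d₁ + d₂ + 4 + 1, fun x V T e hV hT h => ?_⟩
    obtain ⟨ha, hb, h3, h4, h5⟩ := h
    have := add_le_mul_pow hV hT (h₁ x V T e hV hT ha) (h₂ x V T e hV hT hb)
      (o.cost_le hV hT h3 h4 h5)
    simp only [Code.cost]
    omega
  | natSum b f ihb ihf =>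
    obtain ⟨d₁, h₁⟩ := ihb
    obtain ⟨d₂, h₂⟩ := ihf
    refine ⟨d₁ + (d₂ + 4 + 0 + 1 + 1) + 0 + 1, fun x V T e hV hT h => ?_⟩
    obtain ⟨hb, hbV, hf, hsum⟩ := h
    have hpart : ∀ j < b.natVal x e, (∑ l ∈ Finset.range j, f.natVal x (l :: e)) +
        f.natVal x (j :: e) ≤ V := fun j hj => by
      rw [← Finset.sum_range_succ]
      exact (Finset.sum_le_sum_of_subset (Finset.range_mono hj)).trans hsum
    have := add_le_mul_pow hV hT (h₁ x V T e hV hT hb)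
      (sum_range_le_mul_pow hbV fun j hj => add_le_mul_pow hV hT
        (h₂ x V T (j :: e) hV hT (hf j hj))
        (NatOp.add.cost_le hV hT ((Nat.le_add_right _ _).trans (hpart j hj))
          ((Nat.le_add_left _ _).trans (hpart j hj)) (hpart j hj)) (zero_le' V T)) (zero_le' V T)
    simpa [Code.cost] using this
  | argmin b f ihb ihf =>
    obtain ⟨d₁, h₁⟩ := ihb
    obtain ⟨d₂, h₂⟩ := ihf
    refine ⟨d₁ + (d₂ + 0 + 0 + 1 + 1) + 0 + 1, fun x V T e hV hT h => ?_⟩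
    obtain ⟨hb, hbV, hf⟩ := h
    have := add_le_mul_pow hV hT (h₁ x V T e hV hT hb)
      (sum_range_le_mul_pow hbV fun j hj => add_le_mul_pow hV hT
        (h₂ x V T (j :: e) hV hT (hf j hj)) (zero_le' V T) (zero_le' V T)) (zero_le' V T)
    simpa [Code.cost] using this
  | scalarLe a b iha ihb =>
    obtain ⟨d₁, h₁⟩ := iha
    obtain ⟨d₂, h₂⟩ := ihb
    refine ⟨d₁ + d₂ + 0 + 1, fun x V T e hV hT h => ?_⟩
    have := add_le_mul_pow hV hT (h₁ x V T e hV hT h.1) (h₂ x V T e hV hT h.2) (zero_le' V T)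
    simpa [Code.cost] using this
  | floor a iha =>
    obtain ⟨d₁, h₁⟩ := iha
    refine ⟨d₁ + 1 + 0 + 1, fun x V T e hV hT h => ?_⟩
    have h2 : (⌊(a.scalarVal x e).re⌋₊).size ≤ T * V ^ 1 := by
      have := Nat.mul_le_mul_right V hT
      have := natSize_le_self ⌊(a.scalarVal x e).re⌋₊
      have := h.2
      rw [pow_one]; omega
    have := add_le_mul_pow hV hT (h₁ x V T e hV hT h.1) h2 (zero_le' V T)
    simpa [Code.cost] using this
  | basis a b iha ihb =>
    obtain ⟨d₁, h₁⟩ := iha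
    obtain ⟨d₂, h₂⟩ := ihb
    refine ⟨d₁ + d₂ + 0 + 1, fun x V T e hV hT h => ?_⟩
    have := add_le_mul_pow hV hT (h₁ x V T e hV hT h.1) (h₂ x V T e hV hT h.2) (zero_le' V T)
    simpa [Code.cost] using this
  | outcome a b iha ihb =>
    obtain ⟨d₁, h₁⟩ := iha
    obtain ⟨d₂, h₂⟩ := ihb
    refine ⟨d₁ + d₂ + 0 + 1, fun x V T e hV hT h => ?_⟩
    have := add_le_mul_pow hV hT (h₁ x V T e hV hT h.1) (h₂ x V T e hV hT h.2) (zero_le' V T)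
    simpa [Code.cost] using this
  | beta | eps | imag =>
    refine ⟨0, fun x V T e _ hT _ => ?_⟩
    simpa [Code.cost] using hT
  | cast a iha =>
    obtain ⟨d₁, h₁⟩ := iha
    refine ⟨d₁ + 1 + 0 + 1, fun x V T e hV hT h => ?_⟩
    have h2 : (a.natVal x e).size ≤ T * V ^ 1 := by
      rw [pow_one]
      exact (natSize_le_self _).trans h.2
    have := add_le_mul_pow hV hT (h₁ x V T e hV hT h.1) h2 (zero_le' V T)
    simpa [Code.cost] using this
  | scalarOp o a b iha ihb =>
    obtain ⟨d₁, h₁⟩ := iha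
    obtain ⟨d₂, h₂⟩ := ihb
    refine ⟨d₁ + d₂ + 0 + 1, fun x V T e hV hT h => ?_⟩
    have := add_le_mul_pow hV hT (h₁ x V T e hV hT h.1) (h₂ x V T e hV hT h.2) (zero_le' V T)
    simpa [Code.cost] using this
  | scalarSum b f ihb ihf =>
    obtain ⟨d₁, h₁⟩ := ihb
    obtain ⟨d₂, h₂⟩ := ihf
    refine ⟨d₁ + (d₂ + 0 + 0 + 1 + 1) + 0 + 1, fun x V T e hV hT h => ?_⟩
    obtain ⟨hb, hf⟩ := h
    have hsum : ∑ j ∈ Finset.range (b.natVal x e), (1 + f.cost x (j :: e) + 0 + 0) ≤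
        T * V ^ (d₂ + 0 + 0 + 1 + 1) := by
      rcases hf with ⟨hbV, hf⟩ | ⟨hbT, hf⟩
      · exact sum_range_le_mul_pow hbV fun j hj => add_le_mul_pow hV hT
          (h₂ x V T (j :: e) hV hT (hf j hj)) (zero_le' V T) (zero_le' V T)
      -- In an exempted iteration the body is bounded with `1` in place of `T`, so the `T` rounds
      -- contribute a single factor `T`.
      · calc _ ≤ ∑ j ∈ Finset.range (b.natVal x e), 1 * V ^ (d₂ + 0 + 0 + 1) :=
              Finset.sum_le_sum fun j hj => add_le_mul_pow hV le_rfl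
                (h₂ x V 1 (j :: e) hV le_rfl (hf j (Finset.mem_range.1 hj)))
                (zero_le' V 1) (zero_le' V 1)
          _ = b.natVal x e * V ^ (d₂ + 0 + 0 + 1) := by simp
          _ ≤ T * V ^ (d₂ + 0 + 0 + 1) := Nat.mul_le_mul_right _ hbT
          _ ≤ _ := le_mul_pow_of_le hV le_rfl (Nat.le_succ _)
    have := add_le_mul_pow hV hT (h₁ x V T e hV hT hb) hsum (zero_le' V T)
    simpa [Code.cost] using this
  | scalarProd b f ihb ihf =>
    obtain ⟨d₁, h₁⟩ := ihb
    obtain ⟨d₂, h₂⟩ := ihf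
    refine ⟨d₁ + (d₂ + 0 + 0 + 1 + 1) + 0 + 1, fun x V T e hV hT h => ?_⟩
    obtain ⟨hb, hbV, hf⟩ := h
    have := add_le_mul_pow hV hT (h₁ x V T e hV hT hb)
      (sum_range_le_mul_pow hbV fun j hj => add_le_mul_pow hV hT
        (h₂ x V T (j :: e) hV hT (hf j hj)) (zero_le' V T) (zero_le' V T)) (zero_le' V T)
    simpa [Code.cost] using this
  | expEntry d f i j ihd ihf ihi ihj =>
    obtain ⟨d₁, h₁⟩ := ihd
    obtain ⟨d₂, h₂⟩ := ihf
    obtain ⟨d₃, h₃⟩ := ihi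
    obtain ⟨d₄, h₄⟩ := ihj
    refine ⟨(d₁ + d₃ + d₄ + 1) + 3 + (d₂ + 0 + 0 + 1 + 1 + 1) + 1, fun x V T e hV hT h => ?_⟩
    obtain ⟨hd, hi, hj, hdV, hf⟩ := h
    have hd3 : d.natVal x e ^ 3 ≤ T * V ^ 3 :=
      (Nat.pow_le_pow_left hdV 3).trans (Nat.le_mul_of_pos_left _ hT)
    have := add_le_mul_pow hV hT (add_le_mul_pow hV hT (h₁ x V T e hV hT hd)
      (h₃ x V T e hV hT hi) (h₄ x V T e hV hT hj)) hd3
      (sum_range_le_mul_pow hdV fun r hr => sum_range_le_mul_pow hdV fun c hc =>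
        add_le_mul_pow hV hT (h₂ x V T (r :: c :: e) hV hT (hf r hr c hc))
          (zero_le' V T) (zero_le' V T))
    refine le_trans ?_ this
    simp only [Code.cost, add_zero]
    omega
  | cond c a b ihc iha ihb =>
    obtain ⟨d₁, h₁⟩ := ihc
    obtain ⟨d₂, h₂⟩ := iha
    obtain ⟨d₃, h₃⟩ := ihb
    refine ⟨d₁ + (d₂ + d₃) + 0 + 1, fun x V T e hV hT h => ?_⟩
    obtain ⟨hc, hb, ha⟩ := h
    have hbr : (if c.natVal x e = 0 then b.cost x e else a.cost x e) ≤ T * V ^ (d₂ + d₃) := by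
      split_ifs with h0
      · exact le_mul_pow_of_le hV (h₃ x V T e hV hT (hb h0)) (Nat.le_add_left _ _)
      · exact le_mul_pow_of_le hV (h₂ x V T e hV hT (ha h0)) (Nat.le_add_right _ _)
    have := add_le_mul_pow hV hT (h₁ x V T e hV hT hc) hbr (zero_le' V T)
    simpa [Code.cost] using this
  | bind a b iha ihb =>
    obtain ⟨d₁, h₁⟩ := iha
    obtain ⟨d₂, h₂⟩ := ihb
    refine ⟨d₁ + d₂ + 0 + 1, fun x V T e hV hT h => ?_⟩
    have := add_le_mul_pow hV hT (h₁ x V T e hV hT h.1) (h₂ x V T _ hV hT h.2) (zero_le' V T)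
    simpa [Code.cost] using this

/-! ### The program

Arguments named `n`, `k`, `N`, `m`, `p`, `j`, `r`, `c` of the program fragments are indices of
variables. -/

/-- The `i`-th digit of `a` in base `b`. -/
def digitCode (b a i : Code .nat) : Code .nat := .natOp .mod (.natOp .div a (.natOp .pow b i)) b

/-- The weight of the string with label `p`. -/
def weightCode (n p : ℕ) : Code .nat :=
  .natSum (.var n) (.cond (digitCode (.lit 4) (.var (p + 1)) (.var 0)) (.lit 1) (.lit 0))

/-- Whether the string with label `p` is a non-identity string of weight at most `k`. -/
def lowCode (n k p : ℕ) : Code .nat :=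
  .cond (.var p) (.natOp .le (weightCode n p) (.var k)) (.lit 0)

/-- The number of low-weight strings with label below `b`. -/
def rankCode (n k : ℕ) (b : Code .nat) : Code .nat := .natSum b (lowCode (n + 1) (k + 1) 0)

/-- The inverse of the grid step. -/
def invStepCode (n k : ℕ) : Code .scalar :=
  .scalarOp .div
    (.scalarOp .mul
      (.scalarOp .mul (.scalarOp .mul (.cast (.lit 20000)) .beta)
        (.cond (.scalarLe .beta (.cast (.lit 1))) (.cast (.lit 1)) .beta))
      (.scalarOp .mul (.cast (.natOp .pow (.var n) (.var k)))
        (.cast (.natOp .pow (.var n) (.var k)))))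
    (.scalarOp .mul .eps .eps)

/-- The base `2 m + 1` in which the elements of the net are numbered. -/
def baseCode (m : ℕ) : Code .nat := .natOp .add (.natOp .mul (.lit 2) (.var m)) (.lit 1)

/-- The coefficient of the string `p` in the `j`-th Hamiltonian of the net. -/
def coeffCode (n k m j p : ℕ) : Code .scalar :=
  .cond (lowCode n k p)
    (.scalarOp .div
      (.scalarOp .sub (.cast (digitCode (baseCode m) (.var j) (rankCode n k (.var p))))
        (.cast (.var m)))
      (invStepCode n k))
    (.cast (.lit 0))

/-- The entry `(r, c)` of the Pauli matrix `q`. -/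
def pauliEntryCode (q r c : Code .nat) : Code .scalar :=
  .cond (.natOp .mod (.natOp .add r c) (.lit 2))
    (.cond (.natOp .le q (.lit 0)) (.cast (.lit 0))
      (.cond (.natOp .le q (.lit 1)) (.cast (.lit 1))
        (.cond (.natOp .le q (.lit 2))
          (.cond r .imag (.scalarOp .sub (.cast (.lit 0)) .imag)) (.cast (.lit 0)))))
    (.cond (.natOp .le q (.lit 0)) (.cast (.lit 1))
      (.cond (.natOp .le q (.lit 2)) (.cast (.lit 0))
        (.cond r (.scalarOp .sub (.cast (.lit 0)) (.cast (.lit 1))) (.cast (.lit 1)))))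

/-- The entry `(r, c)` of the Pauli string `p`. -/
def stringEntryCode (n p r c : ℕ) : Code .scalar :=
  .scalarProd (.var n) (pauliEntryCode (digitCode (.lit 4) (.var (p + 1)) (.var 0))
    (digitCode (.lit 2) (.var (r + 1)) (.var 0)) (digitCode (.lit 2) (.var (c + 1)) (.var 0)))

/-- The entry `(r, c)` of `-β H`, for the `j`-th Hamiltonian `H` of the net. -/
def exponentCode (n k m j r c : ℕ) : Code .scalar :=
  .scalarOp .mul (.scalarOp .sub (.cast (.lit 0)) .beta)
    (.scalarSum (.natOp .pow (.lit 4) (.var n))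
      (.scalarOp .mul (coeffCode (n + 1) (k + 1) (m + 1) (j + 1) 0)
        (stringEntryCode (n + 1) 0 (r + 1) (c + 1))))

/-- The entry `(r, c)` of `e^{-βH}`, for the `j`-th Hamiltonian `H` of the net. -/
def expCode (n k m j r c : ℕ) : Code .scalar :=
  .expEntry (.natOp .pow (.lit 2) (.var n)) (exponentCode (n + 2) (k + 2) (m + 2) (j + 2) 0 1)
    (.var r) (.var c)

/-- The expectation of the string `p` in the `j`-th Gibbs state of the net. -/
def expectationCode (n k m j p : ℕ) : Code .scalar :=
  .scalarOp .div
    (.scalarSum (.natOp .pow (.lit 2) (.var n)) (.scalarSum (.natOp .pow (.lit 2) (.var (n + 1)))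
      (.scalarOp .mul (stringEntryCode (n + 2) (p + 2) 1 0)
        (expCode (n + 2) (k + 2) (m + 2) (j + 2) 0 1))))
    (.scalarSum (.natOp .pow (.lit 2) (.var n))
      (expCode (n + 1) (k + 1) (m + 1) (j + 1) 0 0))

/-- The factor of the qubit `i` in the shadow estimate from copy `t`, for the Pauli `q`. -/
def shadowFactorCode (q : Code .nat) (t i : ℕ) : Code .scalar :=
  .cond q
    (.cond (.natOp .sub q (.basis (.var t) (.var i))) (.cast (.lit 0))
      (.cond (.natOp .sub (.basis (.var t) (.var i)) q) (.cast (.lit 0))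
        (.cond (.outcome (.var t) (.var i)) (.scalarOp .sub (.cast (.lit 0)) (.cast (.lit 3)))
          (.cast (.lit 3)))))
    (.cast (.lit 1))

/-- The shadow estimate of the string `p`. -/
def shadowCode (n N p : ℕ) : Code .scalar :=
  .scalarOp .div
    (.scalarSum (.var N) (.scalarProd (.var (n + 1))
      (shadowFactorCode (digitCode (.lit 4) (.var (p + 2)) (.var 0)) 1 0)))
    (.cast (.var N))

/-- The deviation of the `j`-th Gibbs state of the net from the data at the string `p`. -/
def deviationCode (n k N m j p : ℕ) : Code .scalar :=
  .scalarOp .sub (shadowCode n N p) (expectationCode n k m j p)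

/-- The sum of the absolute deviations of the `j`-th Gibbs state of the net from the data. -/
def objectiveCode (n k N m j : ℕ) : Code .scalar :=
  .scalarSum (.natOp .pow (.lit 4) (.var n))
    (.cond (lowCode (n + 1) (k + 1) 0)
      (.cond (.scalarLe (.cast (.lit 0))
          (deviationCode (n + 1) (k + 1) (N + 1) (m + 1) (j + 1) 0))
        (deviationCode (n + 1) (k + 1) (N + 1) (m + 1) (j + 1) 0)
        (.scalarOp .sub (.cast (.lit 0))
          (deviationCode (n + 1) (k + 1) (N + 1) (m + 1) (j + 1) 0)))
      (.cast (.lit 0)))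

/-- The index of the best Hamiltonian of the net. -/
def bestCode (n k N m : ℕ) : Code .nat :=
  .argmin (.natOp .pow (baseCode m) (rankCode n k (.natOp .pow (.lit 4) (.var n))))
    (objectiveCode (n + 1) (k + 1) (N + 1) (m + 1) 0)

/-- The classical post-processing. -/
def mainCode : Code .scalar :=
  .bind (.floor (invStepCode 1 2)) (.bind (bestCode 2 3 4 0) (coeffCode 3 4 1 0 2))

/-! ### The values of the program fragments -/

/-- The `i`-th digit of `a` in base `b`. -/
def digit (b a i : ℕ) : ℕ := a / b ^ i % b

/-- The weight of the string with label `p`. -/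
def weightVal (n p : ℕ) : ℕ := ∑ i ∈ Finset.range n, if digit 4 p i = 0 then 0 else 1

/-- Whether the string with label `p` is a non-identity string of weight at most `k`. -/
def IsLow (n k p : ℕ) : Prop := p ≠ 0 ∧ weightVal n p ≤ k

instance (n k p : ℕ) : Decidable (IsLow n k p) := inferInstanceAs (Decidable (_ ∧ _))

/-- The number of low-weight strings with label below `b`. -/
def rankVal (n k b : ℕ) : ℕ := ∑ p ∈ Finset.range b, if IsLow n k p then 1 else 0

/-- The inverse of the grid step. -/
def invStep (β ε : ℝ) (n k : ℕ) : ℝ :=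
  20000 * β * max β 1 * ((n : ℝ) ^ k * (n : ℝ) ^ k) / (ε * ε)

/-- The coefficient of the string `p` in the `j`-th Hamiltonian of the net. -/
def coeffVal (β ε : ℝ) (n k m j p : ℕ) : ℝ :=
  if IsLow n k p then ((digit (2 * m + 1) j (rankVal n k p) : ℝ) - m) / invStep β ε n k else 0

/-- The entry `(r, c)` of the Pauli matrix `q`. -/
def pauliEntry (q r c : ℕ) : ℂ :=
  if (r + c) % 2 = 0 then (if q ≤ 0 then 1 else if q ≤ 2 then 0 else if r = 0 then 1 else 0 - 1)
  else (if q ≤ 0 then 0 else if q ≤ 1 then 1 else if q ≤ 2 then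
    (if r = 0 then 0 - Complex.I else Complex.I) else 0)

/-- The entry `(r, c)` of the Pauli string `p`. -/
def stringEntry (n p r c : ℕ) : ℂ :=
  ∏ i ∈ Finset.range n, pauliEntry (digit 4 p i) (digit 2 r i) (digit 2 c i)

/-- The entry `(r, c)` of `-β H`, for the `j`-th Hamiltonian `H` of the net. -/
def exponentVal (β ε : ℝ) (n k m j r c : ℕ) : ℂ :=
  (0 - β) * ∑ p ∈ Finset.range (4 ^ n), (coeffVal β ε n k m j p : ℂ) * stringEntry n p r c

/-- The entry `(r, c)` of `e^{-βH}`, for the `j`-th Hamiltonian `H` of the net. -/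
def expVal (β ε : ℝ) (n k m j r c : ℕ) : ℂ :=
  expEntryValue (2 ^ n) (fun r c => exponentVal β ε n k m j r c) r c

/-- The expectation of the string `p` in the `j`-th Gibbs state of the net. -/
def expectationVal (β ε : ℝ) (n k m j p : ℕ) : ℂ :=
  (∑ c ∈ Finset.range (2 ^ n), ∑ r ∈ Finset.range (2 ^ n),
      stringEntry n p c r * expVal β ε n k m j r c) /
    ∑ r ∈ Finset.range (2 ^ n), expVal β ε n k m j r r

/-- The factor of the qubit `i` in the shadow estimate from copy `t`, for the Pauli `q`. -/
def shadowFactor (x : Input) (q t i : ℕ) : ℂ :=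
  if q = 0 then 1 else if q - x.basis t i = 0 then
    (if x.basis t i - q = 0 then (if x.outcome t i = 0 then 3 else 0 - 3) else 0) else 0

/-- The shadow estimate of the string `p`. -/
def shadowVal (x : Input) (n N p : ℕ) : ℂ :=
  (∑ t ∈ Finset.range N, ∏ i ∈ Finset.range n, shadowFactor x (digit 4 p i) t i) / N

/-- The sum of the absolute deviations of the `j`-th Gibbs state of the net from the data. -/
def objectiveVal (x : Input) (n k N m j : ℕ) : ℂ :=
  ∑ p ∈ Finset.range (4 ^ n), if IsLow n k p then
    (if 0 ≤ (shadowVal x n N p - expectationVal x.beta x.eps n k m j p).re then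
      shadowVal x n N p - expectationVal x.beta x.eps n k m j p
      else 0 - (shadowVal x n N p - expectationVal x.beta x.eps n k m j p)) else 0

section Eval

variable (x : Input) (e : List ℕ)

/-- `Code.eval` unfolds definitionally, so the evaluation lemmas are mostly `rfl`, or a `change`
that exposes the values of the fragments. Each binder pushes one value onto the environment, which
is why variable indices grow by one under it. -/
lemma eval_digitCode (b a i : Code .nat) : (digitCode b a i).natVal x e =
    digit (b.natVal x e) (a.natVal x e) (i.natVal x e) := rfl

lemma eval_weightCode (n p : ℕ) :
    (weightCode n p).natVal x e = weightVal (e.getD n 0) (e.getD p 0) := rfl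

lemma eval_lowCode (n k p : ℕ) : (lowCode n k p).natVal x e =
    if IsLow (e.getD n 0) (e.getD k 0) (e.getD p 0) then 1 else 0 := by
  change (if e.getD p 0 = 0 then 0
    else if (weightCode n p).natVal x e ≤ e.getD k 0 then 1 else 0) = _
  rw [eval_weightCode]
  by_cases h1 : e.getD p 0 = 0
  · rw [if_pos h1, if_neg fun h => h.1 h1]
  · rw [if_neg h1]
    exact if_congr ⟨fun h => ⟨h1, h⟩, fun h => h.2⟩ rfl rfl

lemma eval_rankCode (n k : ℕ) (b : Code .nat) : (rankCode n k b).natVal x e =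
    rankVal (e.getD n 0) (e.getD k 0) (b.natVal x e) := by
  change ∑ j ∈ Finset.range (b.natVal x e), (lowCode (n + 1) (k + 1) 0).natVal x (j :: e) = _
  simp only [eval_lowCode, List.getD_cons_succ, List.getD_cons_zero]
  rfl

lemma eval_invStepCode (n k : ℕ) : (invStepCode n k).scalarVal x e =
    (invStep x.beta x.eps (e.getD n 0) (e.getD k 0) : ℂ) := by
  have h : (if (if x.beta ≤ 1 then (1 : ℕ) else 0) = 0 then (x.beta : ℂ) else ((1 : ℕ) : ℂ)) =
      ((max x.beta 1 : ℝ) : ℂ) := by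
    by_cases h1 : x.beta ≤ 1
    · simp [h1]
    · simp [h1, max_eq_left (not_le.1 h1).le]
  have h2 : (invStepCode n k).scalarVal x e = ((20000 : ℕ) : ℂ) * x.beta *
      (if (if (x.beta : ℂ).re ≤ (((1 : ℕ) : ℂ)).re then (1 : ℕ) else 0) = 0 then (x.beta : ℂ)
        else ((1 : ℕ) : ℂ)) *
      (((e.getD n 0 ^ e.getD k 0 : ℕ) : ℂ) * ((e.getD n 0 ^ e.getD k 0 : ℕ) : ℂ)) /
      (x.eps * x.eps) := rfl
  rw [h2, Complex.ofReal_re, Complex.natCast_re, Nat.cast_one (R := ℝ)]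
  rw [h, invStep]
  push_cast
  rfl

lemma eval_baseCode (m : ℕ) : (baseCode m).natVal x e = 2 * e.getD m 0 + 1 := rfl

lemma eval_coeffCode (n k m j p : ℕ) : (coeffCode n k m j p).scalarVal x e =
    (coeffVal x.beta x.eps (e.getD n 0) (e.getD k 0) (e.getD m 0) (e.getD j 0) (e.getD p 0) : ℂ) := by
  change (if (lowCode n k p).natVal x e = 0 then ((0 : ℕ) : ℂ) else
    (((digit ((baseCode m).natVal x e) (e.getD j 0) ((rankCode n k (.var p)).natVal x e) : ℕ) : ℂ) -
      ((e.getD m 0 : ℕ) : ℂ)) / (invStepCode n k).scalarVal x e) = _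
  rw [eval_lowCode, eval_baseCode, eval_rankCode, eval_invStepCode, coeffVal]
  change _ = (((if _ then ((digit _ _ (rankVal _ _ (e.getD p 0)) : ℝ) - _) / _ else 0 : ℝ)) : ℂ)
  change (if _ then _ else (((digit _ _ (rankVal _ _ (e.getD p 0)) : ℕ) : ℂ) - _) / _) = _
  split_ifs <;> simp_all

lemma eval_pauliEntryCode (q r c : Code .nat) : (pauliEntryCode q r c).scalarVal x e =
    pauliEntry (q.natVal x e) (r.natVal x e) (c.natVal x e) := by
  -- Comparisons in the program return `0` or `1` and are then tested against `0`, and its constants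
  -- are casts of naturals. Rewriting the target in this shape makes the two sides definitionally
  -- equal.
  have hle : ∀ (a b : ℕ) (y z : ℂ), (if (if a ≤ b then (1 : ℕ) else 0) = 0 then y else z) =
      if a ≤ b then z else y := fun a b y z => by split_ifs <;> simp_all
  rw [pauliEntry]
  simp only [← hle]
  have h0 : (0 : ℂ) = ((0 : ℕ) : ℂ) := Nat.cast_zero.symm
  have h1 : (1 : ℂ) = ((1 : ℕ) : ℂ) := Nat.cast_one.symm
  rw [h0, h1]
  rfl

lemma eval_stringEntryCode (n p r c : ℕ) : (stringEntryCode n p r c).scalarVal x e =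
    stringEntry (e.getD n 0) (e.getD p 0) (e.getD r 0) (e.getD c 0) := by
  refine Finset.prod_congr rfl fun i _ => ?_
  exact eval_pauliEntryCode x (i :: e) _ _ _

lemma eval_exponentCode (n k m j r c : ℕ) : (exponentCode n k m j r c).scalarVal x e =
    exponentVal x.beta x.eps (e.getD n 0) (e.getD k 0) (e.getD m 0) (e.getD j 0) (e.getD r 0)
      (e.getD c 0) := by
  change (((0 : ℕ) : ℂ) - x.beta) * ∑ p ∈ Finset.range (4 ^ e.getD n 0),
    (coeffCode (n + 1) (k + 1) (m + 1) (j + 1) 0).scalarVal x (p :: e) *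
      (stringEntryCode (n + 1) 0 (r + 1) (c + 1)).scalarVal x (p :: e) = _
  simp only [eval_coeffCode, eval_stringEntryCode, List.getD_cons_succ, List.getD_cons_zero,
    Nat.cast_zero]
  rfl

lemma eval_expCode (n k m j r c : ℕ) : (expCode n k m j r c).scalarVal x e =
    expVal x.beta x.eps (e.getD n 0) (e.getD k 0) (e.getD m 0) (e.getD j 0) (e.getD r 0)
      (e.getD c 0) := by
  change expEntryValue (2 ^ e.getD n 0) (fun r c =>
    (exponentCode (n + 2) (k + 2) (m + 2) (j + 2) 0 1).scalarVal x (r :: c :: e)) _ _ = _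
  simp only [eval_exponentCode]
  rfl

lemma eval_expectationCode (n k m j p : ℕ) : (expectationCode n k m j p).scalarVal x e =
    expectationVal x.beta x.eps (e.getD n 0) (e.getD k 0) (e.getD m 0) (e.getD j 0)
      (e.getD p 0) := by
  change (∑ c ∈ Finset.range (2 ^ e.getD n 0), ∑ r ∈ Finset.range (2 ^ e.getD n 0),
      (stringEntryCode (n + 2) (p + 2) 1 0).scalarVal x (r :: c :: e) *
        (expCode (n + 2) (k + 2) (m + 2) (j + 2) 0 1).scalarVal x (r :: c :: e)) /
    (∑ r ∈ Finset.range (2 ^ e.getD n 0),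
      (expCode (n + 1) (k + 1) (m + 1) (j + 1) 0 0).scalarVal x (r :: e)) = _
  simp only [eval_stringEntryCode, eval_expCode]
  rfl

lemma eval_shadowFactorCode (q : Code .nat) (t i : ℕ) :
    (shadowFactorCode q t i).scalarVal x e =
      shadowFactor x (q.natVal x e) (e.getD t 0) (e.getD i 0) := by
  have h0 : (0 : ℂ) = ((0 : ℕ) : ℂ) := Nat.cast_zero.symm
  have h1 : (1 : ℂ) = ((1 : ℕ) : ℂ) := Nat.cast_one.symm
  have h3 : (3 : ℂ) = ((3 : ℕ) : ℂ) := by norm_num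
  rw [shadowFactor, h0, h1, h3]
  rfl

lemma eval_shadowCode (n N p : ℕ) : (shadowCode n N p).scalarVal x e =
    shadowVal x (e.getD n 0) (e.getD N 0) (e.getD p 0) := by
  change (∑ t ∈ Finset.range (e.getD N 0), ∏ i ∈ Finset.range (e.getD n 0),
    (shadowFactorCode (digitCode (.lit 4) (.var (p + 2)) (.var 0)) 1 0).scalarVal x
      (i :: t :: e)) / _ = _
  simp only [eval_shadowFactorCode]
  rfl

lemma eval_objectiveCode (n k N m j : ℕ) : (objectiveCode n k N m j).scalarVal x e =
    objectiveVal x (e.getD n 0) (e.getD k 0) (e.getD N 0) (e.getD m 0) (e.getD j 0) := by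
  have hdev : ∀ (e : List ℕ) (n k N m j p : ℕ), (deviationCode n k N m j p).scalarVal x e =
      shadowVal x (e.getD n 0) (e.getD N 0) (e.getD p 0) -
        expectationVal x.beta x.eps (e.getD n 0) (e.getD k 0) (e.getD m 0) (e.getD j 0)
          (e.getD p 0) := fun e n k N m j p => by
    rw [← eval_shadowCode, ← eval_expectationCode]
    rfl
  refine Finset.sum_congr rfl fun p _ => ?_
  change (if (lowCode (n + 1) (k + 1) 0).natVal x (p :: e) = 0 then ((0 : ℕ) : ℂ) else
    if (if ((0 : ℕ) : ℂ).re ≤ ((deviationCode (n + 1) (k + 1) (N + 1) (m + 1) (j + 1) 0).scalarVal x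
      (p :: e)).re then (1 : ℕ) else 0) = 0 then ((0 : ℕ) : ℂ) - (deviationCode (n + 1) (k + 1) (N + 1)
        (m + 1) (j + 1) 0).scalarVal x (p :: e)
    else (deviationCode (n + 1) (k + 1) (N + 1) (m + 1) (j + 1) 0).scalarVal x (p :: e)) = _
  rw [eval_lowCode, hdev]
  simp only [List.getD_cons_succ, List.getD_cons_zero, Nat.cast_zero, Complex.zero_re]
  split_ifs <;> simp_all

/-- The index of the best Hamiltonian of the net. -/
def bestVal (x : Input) (n k N m : ℕ) : ℕ :=
  argminBelow (fun j => (objectiveVal x n k N m j).re) ((2 * m + 1) ^ rankVal n k (4 ^ n))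

lemma eval_bestCode (n k N m : ℕ) : (bestCode n k N m).natVal x e =
    bestVal x (e.getD n 0) (e.getD k 0) (e.getD N 0) (e.getD m 0) := by
  change argminBelow (fun j => ((objectiveCode (n + 1) (k + 1) (N + 1) (m + 1) 0).scalarVal x
    (j :: e)).re) ((baseCode m).natVal x e ^
      (rankCode n k (.natOp .pow (.lit 4) (.var n))).natVal x e) = _
  simp only [eval_objectiveCode, eval_baseCode, eval_rankCode]
  rfl

lemma eval_mainCode (n k N p : ℕ) : mainCode.scalarVal x [p, n, k, N] =
    (coeffVal x.beta x.eps n k ⌊invStep x.beta x.eps n k⌋₊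
      (bestVal x n k N ⌊invStep x.beta x.eps n k⌋₊) p : ℂ) := by
  have hm : (Code.floor (invStepCode 1 2)).natVal x [p, n, k, N] =
      ⌊invStep x.beta x.eps n k⌋₊ := by
    change ⌊((invStepCode 1 2).scalarVal x [p, n, k, N]).re⌋₊ = _
    rw [eval_invStepCode, Complex.ofReal_re]
    rfl
  change (coeffCode 3 4 1 0 2).scalarVal x ((bestCode 2 3 4 0).natVal x
    ((Code.floor (invStepCode 1 2)).natVal x [p, n, k, N] :: [p, n, k, N]) ::
    (Code.floor (invStepCode 1 2)).natVal x [p, n, k, N] :: [p, n, k, N]) = _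
  rw [eval_coeffCode, eval_bestCode, hm]
  rfl

end Eval

/-! ### The size of the numbers that occur in the run of the program -/

/-- `V` bounds the natural numbers that occur in the run of the program, except for the number of
copies. -/
structure Roomy (V n k m : ℕ) : Prop where
  const_le : 20000 ≤ V
  four_pow_le : 4 ^ n ≤ V
  pow_le : n ^ k ≤ V
  locality_le : k ≤ V
  base_le : 2 * m + 1 ≤ V
  net_le : (2 * m + 1) ^ rankVal n k (4 ^ n) ≤ V

namespace Code

variable {x : Input} {V T : ℕ} {e : List ℕ}

lemma fits_var {i : ℕ} : (var i).Fits x V T e := trivial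

lemma fits_beta : beta.Fits x V T e := trivial

lemma fits_eps : eps.Fits x V T e := trivial

lemma fits_imag : imag.Fits x V T e := trivial

lemma fits_lit {a : ℕ} (h : a ≤ V) : (lit a).Fits x V T e := h

lemma fits_cast_lit {a : ℕ} (hT : 1 ≤ T) (h : a ≤ V) : (cast (lit a)).Fits x V T e :=
  And.intro h (h.trans (Nat.le_mul_of_pos_left _ hT))

lemma fits_natOp {o : NatOp} {a b : Code .nat} (ha : a.Fits x V T e) (hb : b.Fits x V T e)
    (h1 : a.natVal x e ≤ V) (h2 : b.natVal x e ≤ V)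
    (h3 : o.apply (a.natVal x e) (b.natVal x e) ≤ V) : (natOp o a b).Fits x V T e :=
  And.intro ha (And.intro hb (And.intro h1 (And.intro h2 h3)))

lemma fits_natOp_le {a b : Code .nat} (hV : 1 ≤ V) (ha : a.Fits x V T e) (hb : b.Fits x V T e)
    (h1 : a.natVal x e ≤ V) (h2 : b.natVal x e ≤ V) : (natOp .le a b).Fits x V T e := by
  refine fits_natOp ha hb h1 h2 ?_
  simp only [NatOp.apply]
  split_ifs <;> omega

lemma fits_scalarOp {o : ScalarOp} {a b : Code .scalar} (ha : a.Fits x V T e)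
    (hb : b.Fits x V T e) : (scalarOp o a b).Fits x V T e := And.intro ha hb

lemma fits_scalarSum {b : Code .nat} {f : Code .scalar} (hb : b.Fits x V T e)
    (hbV : b.natVal x e ≤ V) (hf : ∀ j < b.natVal x e, f.Fits x V T (j :: e)) :
    (scalarSum b f).Fits x V T e := And.intro hb (Or.inl (And.intro hbV hf))

lemma fits_scalarProd {b : Code .nat} {f : Code .scalar} (hb : b.Fits x V T e)
    (hbV : b.natVal x e ≤ V) (hf : ∀ j < b.natVal x e, f.Fits x V T (j :: e)) :
    (scalarProd b f).Fits x V T e := And.intro hb (And.intro hbV hf)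

lemma fits_cond {s : Kind} {c : Code .nat} {a b : Code s} (hc : c.Fits x V T e)
    (ha : c.natVal x e ≠ 0 → a.Fits x V T e) (hb : c.natVal x e = 0 → b.Fits x V T e) :
    (cond c a b).Fits x V T e := And.intro hc (And.intro hb ha)

end Code

open Code

section Fits

variable {x : Input} {V T : ℕ} {e : List ℕ}

lemma digit_le (b a i : ℕ) : digit b a i ≤ a := (Nat.mod_le _ _).trans (Nat.div_le_self _ _)

lemma weightVal_le (n p : ℕ) : weightVal n p ≤ n := by
  calc weightVal n p ≤ ∑ i ∈ Finset.range n, 1 :=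
        Finset.sum_le_sum fun i _ => by split_ifs <;> omega
    _ = n := by simp

lemma rankVal_le (n k b : ℕ) : rankVal n k b ≤ b := by
  calc rankVal n k b ≤ ∑ i ∈ Finset.range b, 1 :=
        Finset.sum_le_sum fun i _ => by split_ifs <;> omega
    _ = b := by simp

lemma rankVal_mono (n k : ℕ) {b b' : ℕ} (h : b ≤ b') : rankVal n k b ≤ rankVal n k b' :=
  Finset.sum_le_sum_of_subset (Finset.range_mono h)

lemma Roomy.qubits_le {n k m : ℕ} (h : Roomy V n k m) : n ≤ V :=
  (Nat.lt_pow_self (by norm_num : 1 < 4)).le.trans h.four_pow_le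

lemma Roomy.two_pow_le {n k m : ℕ} (h : Roomy V n k m) : 2 ^ n ≤ V :=
  (Nat.pow_le_pow_left (by norm_num) n).trans h.four_pow_le

lemma fits_digitCode {b a i : Code .nat} (hb : b.Fits x V T e) (ha : a.Fits x V T e)
    (hi : i.Fits x V T e) (hbV : b.natVal x e ≤ V) (haV : a.natVal x e ≤ V)
    (hiV : i.natVal x e ≤ V) (hpow : b.natVal x e ^ i.natVal x e ≤ V) :
    (digitCode b a i).Fits x V T e := by
  have hdiv : a.natVal x e / b.natVal x e ^ i.natVal x e ≤ V := (Nat.div_le_self _ _).trans haV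
  exact fits_natOp (fits_natOp ha (fits_natOp hb hi hbV hiV hpow) haV hpow hdiv) hb hdiv hbV
    ((Nat.mod_le _ _).trans hdiv)

/-- The code of a digit in base `4` or `2` of a label. -/
lemma fits_digitCode_lit {b n i : ℕ} {a : ℕ} (hb : b ≤ V) (hpow : b ^ n ≤ V) (hb0 : 1 ≤ b)
    (hn : n ≤ V) (ha : e.getD a 0 ≤ V) (hi : e.getD i 0 < n) :
    (digitCode (.lit b) (.var a) (.var i)).Fits x V T e :=
  fits_digitCode (fits_lit hb) fits_var fits_var hb ha (hi.le.trans hn)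
    ((Nat.pow_le_pow_right hb0 hi.le).trans hpow)

lemma fits_weightCode {n p k m : ℕ} (h : Roomy V (e.getD n 0) k m) (hp : e.getD p 0 ≤ V) :
    (weightCode n p).Fits x V T e := by
  have h0 := h.const_le
  have hn := h.qubits_le
  refine And.intro fits_var (And.intro hn (And.intro (fun i hi => ?_) ?_))
  · refine fits_cond (fits_digitCode_lit (by omega) h.four_pow_le (by omega) hn ?_ ?_)
      (fun _ => fits_lit (by omega)) (fun _ => fits_lit (by omega))
    · exact hp
    · exact hi
  · change weightVal (e.getD n 0) (e.getD p 0) ≤ V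
    exact (weightVal_le _ _).trans hn

lemma fits_lowCode {n k p m : ℕ} (h : Roomy V (e.getD n 0) (e.getD k 0) m)
    (hp : e.getD p 0 ≤ V) : (lowCode n k p).Fits x V T e := by
  have h0 := h.const_le
  refine fits_cond fits_var (fun _ => ?_) (fun _ => fits_lit (by omega))
  refine fits_natOp_le (by omega) (fits_weightCode h hp) fits_var ?_ h.locality_le
  rw [eval_weightCode]
  exact (weightVal_le _ _).trans h.qubits_le

lemma fits_rankCode {n k m : ℕ} {b : Code .nat} (h : Roomy V (e.getD n 0) (e.getD k 0) m)
    (hb : b.Fits x V T e) (hbV : b.natVal x e ≤ V) : (rankCode n k b).Fits x V T e := by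
  refine And.intro hb (And.intro hbV (And.intro (fun p hp => ?_) ?_))
  · exact fits_lowCode (e := p :: e) h (hp.le.trans hbV)
  · have := eval_rankCode x e n k b
    change ∑ p ∈ Finset.range (b.natVal x e), (lowCode (n + 1) (k + 1) 0).natVal x (p :: e) = _
      at this
    rw [this]
    exact (rankVal_le _ _ _).trans hbV

lemma fits_invStepCode {n k m : ℕ} (hT : 1 ≤ T) (h : Roomy V (e.getD n 0) (e.getD k 0) m) :
    (invStepCode n k).Fits x V T e := by
  have h0 := h.const_le
  have hlit : ∀ a ≤ 20000, (Code.cast (.lit a)).Fits x V T e := fun a ha =>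
    fits_cast_lit hT (ha.trans h0)
  have hpow : (Code.cast (.natOp .pow (.var n) (.var k))).Fits x V T e :=
    And.intro (fits_natOp fits_var fits_var h.qubits_le h.locality_le h.pow_le)
      (h.pow_le.trans (Nat.le_mul_of_pos_left _ hT))
  refine fits_scalarOp (fits_scalarOp (fits_scalarOp (fits_scalarOp (hlit _ le_rfl) fits_beta)
    (fits_cond ?_ (fun _ => hlit _ (by norm_num)) (fun _ => fits_beta)))
    (fits_scalarOp hpow hpow)) (fits_scalarOp fits_eps fits_eps)
  exact And.intro fits_beta (hlit _ (by norm_num))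

lemma fits_baseCode {m n k : ℕ} (h : Roomy V n k (e.getD m 0)) :
    (baseCode m).Fits x V T e := by
  have h0 := h.const_le
  have h1 := h.base_le
  refine fits_natOp (fits_natOp (fits_lit (by omega)) fits_var ?_ ?_ ?_) (fits_lit (by omega))
    ?_ ?_ ?_
  · change 2 ≤ V; omega
  · change e.getD m 0 ≤ V; omega
  · change 2 * e.getD m 0 ≤ V; omega
  · change 2 * e.getD m 0 ≤ V; omega
  · change 1 ≤ V; omega
  · exact h1

lemma fits_coeffCode {n k m j p : ℕ} (hT : 1 ≤ T)
    (h : Roomy V (e.getD n 0) (e.getD k 0) (e.getD m 0))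
    (hp : e.getD p 0 < 4 ^ e.getD n 0) (hj : e.getD j 0 ≤ V) :
    (coeffCode n k m j p).Fits x V T e := by
  have h0 := h.const_le
  have hpV : e.getD p 0 ≤ V := hp.le.trans h.four_pow_le
  have hmV : e.getD m 0 ≤ V := by have := h.base_le; omega
  -- The digit position is at most the number of low-weight strings, so the power of the base that
  -- is formed to extract the digit does not exceed the size of the net.
  have hr : (rankCode n k (.var p)).natVal x e ≤ rankVal (e.getD n 0) (e.getD k 0)
      (4 ^ e.getD n 0) := by
    rw [eval_rankCode]
    exact rankVal_mono _ _ hp.le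
  refine fits_cond (fits_lowCode h hpV) (fun _ => ?_) (fun _ => fits_cast_lit hT (by omega))
  refine fits_scalarOp (fits_scalarOp (And.intro ?_ ?_) (And.intro fits_var ?_))
    (fits_invStepCode hT h)
  · refine fits_digitCode (fits_baseCode h) fits_var (fits_rankCode h fits_var hpV) h.base_le hj
      ?_ ?_
    · exact hr.trans ((rankVal_le _ _ _).trans h.four_pow_le)
    · rw [eval_baseCode]
      exact (Nat.pow_le_pow_right (by omega) hr).trans h.net_le
  · rw [eval_digitCode]
    exact ((digit_le _ _ _).trans hj).trans (Nat.le_mul_of_pos_left _ hT)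
  · exact hmV.trans (Nat.le_mul_of_pos_left _ hT)

lemma fits_pauliEntryCode {q r c : Code .nat} (hT : 1 ≤ T) (hV : 20000 ≤ V)
    (hq : q.Fits x V T e) (hr : r.Fits x V T e) (hc : c.Fits x V T e) (hqV : q.natVal x e ≤ V)
    (hr2 : r.natVal x e < 2) (hc2 : c.natVal x e < 2) :
    (pauliEntryCode q r c).Fits x V T e := by
  have hlit : ∀ a ≤ 20000, (Code.cast (.lit a)).Fits x V T e := fun a ha =>
    fits_cast_lit hT (ha.trans hV)
  have hle : ∀ a ≤ 20000, (Code.natOp .le q (.lit a)).Fits x V T e := fun a ha =>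
    fits_natOp_le (by omega) hq (fits_lit (ha.trans hV)) hqV (ha.trans hV)
  have h0 := hlit 0 (by norm_num)
  have h1 := hlit 1 (by norm_num)
  have hsum : r.natVal x e + c.natVal x e ≤ V := by omega
  refine fits_cond (fits_natOp (fits_natOp hr hc (by omega) (by omega) hsum)
    (fits_lit (by omega)) hsum ?_ ((Nat.mod_le _ _).trans hsum)) (fun _ => ?_) (fun _ => ?_)
  · change 2 ≤ V; omega
  · exact fits_cond (hle 0 (by norm_num)) (fun _ => h0) fun _ =>
      fits_cond (hle 1 (by norm_num)) (fun _ => h1) fun _ =>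
      fits_cond (hle 2 (by norm_num)) (fun _ => fits_cond hr (fun _ => fits_imag)
        fun _ => fits_scalarOp h0 fits_imag) fun _ => h0
  · exact fits_cond (hle 0 (by norm_num)) (fun _ => h1) fun _ =>
      fits_cond (hle 2 (by norm_num)) (fun _ => h0) fun _ =>
      fits_cond hr (fun _ => fits_scalarOp h0 h1) fun _ => h1

lemma fits_stringEntryCode {n p r c k m : ℕ} (hT : 1 ≤ T) (h : Roomy V (e.getD n 0) k m)
    (hp : e.getD p 0 ≤ V) (hr : e.getD r 0 ≤ V) (hc : e.getD c 0 ≤ V) :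
    (stringEntryCode n p r c).Fits x V T e := by
  have h0 := h.const_le
  refine fits_scalarProd fits_var h.qubits_le fun i hi => ?_
  refine fits_pauliEntryCode hT h0
    (fits_digitCode_lit (by omega) h.four_pow_le (by omega) h.qubits_le hp hi)
    (fits_digitCode_lit (by omega) h.two_pow_le (by omega) h.qubits_le hr hi)
    (fits_digitCode_lit (by omega) h.two_pow_le (by omega) h.qubits_le hc hi) ?_ ?_ ?_
  · rw [eval_digitCode]
    exact (digit_le _ _ _).trans hp
  · rw [eval_digitCode]
    exact Nat.mod_lt _ Nat.two_pos
  · rw [eval_digitCode]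
    exact Nat.mod_lt _ Nat.two_pos

lemma fits_pow_var {b n k m : ℕ} (h : Roomy V (e.getD n 0) k m) (hb : b = 2 ∨ b = 4) :
    (Code.natOp .pow (.lit b) (.var n)).Fits x V T e := by
  have h0 := h.const_le
  have hbV : b ≤ V := by omega
  refine fits_natOp (fits_lit hbV) fits_var hbV h.qubits_le ?_
  rcases hb with rfl | rfl
  · exact h.two_pow_le
  · exact h.four_pow_le

lemma fits_expCode {n k m j r c : ℕ} (hT : 1 ≤ T)
    (h : Roomy V (e.getD n 0) (e.getD k 0) (e.getD m 0)) (hj : e.getD j 0 ≤ V) :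
    (expCode n k m j r c).Fits x V T e := by
  have h0 := h.const_le
  refine And.intro (fits_pow_var h (Or.inl rfl)) (And.intro fits_var (And.intro fits_var
    (And.intro h.two_pow_le fun r hr c hc => ?_)))
  refine fits_scalarOp (fits_scalarOp (fits_cast_lit hT (by omega)) fits_beta)
    (fits_scalarSum (fits_pow_var (e := r :: c :: e) h (Or.inr rfl)) h.four_pow_le
      fun p hp => fits_scalarOp ?_ ?_)
  · exact fits_coeffCode (e := p :: r :: c :: e) hT h hp hj
  · exact fits_stringEntryCode (e := p :: r :: c :: e) hT h (hp.le.trans h.four_pow_le)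
      (hr.le.trans h.two_pow_le) (hc.le.trans h.two_pow_le)

lemma fits_expectationCode {n k m j p : ℕ} (hT : 1 ≤ T)
    (h : Roomy V (e.getD n 0) (e.getD k 0) (e.getD m 0)) (hj : e.getD j 0 ≤ V)
    (hp : e.getD p 0 ≤ V) : (expectationCode n k m j p).Fits x V T e := by
  refine fits_scalarOp
    (fits_scalarSum (fits_pow_var h (Or.inl rfl)) h.two_pow_le fun c hc =>
      fits_scalarSum (fits_pow_var (e := c :: e) h (Or.inl rfl)) h.two_pow_le fun r hr =>
        fits_scalarOp ?_ ?_)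
    (fits_scalarSum (fits_pow_var h (Or.inl rfl)) h.two_pow_le fun r hr => ?_)
  · exact fits_stringEntryCode (e := r :: c :: e) hT h hp (hc.le.trans h.two_pow_le)
      (hr.le.trans h.two_pow_le)
  · exact fits_expCode (e := r :: c :: e) hT h hj
  · exact fits_expCode (e := r :: e) hT h hj

lemma fits_shadowFactorCode {q : Code .nat} {t i : ℕ} (hT : 1 ≤ T) (hV : 20000 ≤ V)
    (hx : ∀ t i, x.basis t i ≤ V) (hq : q.Fits x V T e) (hqV : q.natVal x e ≤ V) :
    (shadowFactorCode q t i).Fits x V T e := by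
  have hlit : ∀ a ≤ 20000, (Code.cast (.lit a)).Fits x V T e := fun a ha =>
    fits_cast_lit hT (ha.trans hV)
  have h0 := hlit 0 (by norm_num)
  have h3 := hlit 3 (by norm_num)
  have hb : (Code.basis (.var t) (.var i)).Fits x V T e := And.intro fits_var fits_var
  exact fits_cond hq (fun _ =>
    fits_cond (fits_natOp hq hb hqV (hx _ _) ((Nat.sub_le _ _).trans hqV)) (fun _ => h0) fun _ =>
      fits_cond (fits_natOp hb hq (hx _ _) hqV ((Nat.sub_le _ _).trans (hx _ _)))
        (fun _ => h0) fun _ => fits_cond (And.intro fits_var fits_var)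
          (fun _ => fits_scalarOp h0 h3) fun _ => h3) fun _ => hlit 1 (by norm_num)

lemma fits_shadowCode {n N p k m : ℕ} (h : Roomy V (e.getD n 0) k m)
    (hx : ∀ t i, x.basis t i ≤ V) (hp : e.getD p 0 ≤ V) (hN : e.getD N 0 ≤ T) :
    (shadowCode n N p).Fits x V T e := by
  have h0 := h.const_le
  -- The sum over the copies takes the exempted alternative, since the number of copies need not be
  -- bounded by `V`. Its body contains no further loop over copies and fits with `T = 1`.
  refine fits_scalarOp (And.intro fits_var (Or.inr (And.intro hN fun t ht => ?_)))
    (And.intro fits_var (hN.trans (Nat.le_mul_of_pos_right _ (by omega))))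
  refine fits_scalarProd fits_var h.qubits_le fun i hi => ?_
  refine fits_shadowFactorCode le_rfl h0 hx
    (fits_digitCode_lit (by omega) h.four_pow_le (by omega) h.qubits_le hp hi) ?_
  rw [eval_digitCode]
  exact (digit_le _ _ _).trans hp

lemma fits_objectiveCode {n k N m j : ℕ} (hT : 1 ≤ T)
    (h : Roomy V (e.getD n 0) (e.getD k 0) (e.getD m 0)) (hx : ∀ t i, x.basis t i ≤ V)
    (hj : e.getD j 0 ≤ V) (hN : e.getD N 0 ≤ T) : (objectiveCode n k N m j).Fits x V T e := by
  have h0 := h.const_le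
  refine fits_scalarSum (fits_pow_var h (Or.inr rfl)) h.four_pow_le fun p hp => ?_
  have hpV : p ≤ V := hp.le.trans h.four_pow_le
  have hlit : (Code.cast (.lit 0)).Fits x V T (p :: e) := fits_cast_lit hT (Nat.zero_le _)
  have hdev : (deviationCode (n + 1) (k + 1) (N + 1) (m + 1) (j + 1) 0).Fits x V T (p :: e) :=
    fits_scalarOp (fits_shadowCode (e := p :: e) h hx hpV hN)
      (fits_expectationCode (e := p :: e) hT h hj hpV)
  exact fits_cond (fits_lowCode (e := p :: e) h hpV) (fun _ =>
    fits_cond (And.intro hlit hdev) (fun _ => hdev) fun _ => fits_scalarOp hlit hdev) fun _ => hlit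

lemma fits_bestCode {n k N m : ℕ} (hT : 1 ≤ T)
    (h : Roomy V (e.getD n 0) (e.getD k 0) (e.getD m 0)) (hx : ∀ t i, x.basis t i ≤ V)
    (hN : e.getD N 0 ≤ T) : (bestCode n k N m).Fits x V T e := by
  have h4 : (Code.natOp .pow (.lit 4) (.var n)).natVal x e = 4 ^ e.getD n 0 := rfl
  have hnet : (Code.natOp .pow (baseCode m) (rankCode n k (.natOp .pow (.lit 4) (.var n)))).natVal
      x e ≤ V := by
    change (baseCode m).natVal x e ^ (rankCode n k _).natVal x e ≤ V
    rw [eval_baseCode, eval_rankCode, h4]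
    exact h.net_le
  refine And.intro (fits_natOp (fits_baseCode h) (fits_rankCode h (fits_pow_var h (Or.inr rfl))
    h.four_pow_le) h.base_le ?_ hnet) (And.intro hnet fun j hj => ?_)
  · rw [eval_rankCode, h4]
    exact (rankVal_le _ _ _).trans h.four_pow_le
  · exact fits_objectiveCode (e := j :: e) hT h hx (hj.le.trans hnet) hN

lemma argminBelow_le (f : ℕ → ℝ) (b : ℕ) : argminBelow f b ≤ b := by
  induction b with
  | zero => exact le_rfl
  | succ b ih =>
    rw [argminBelow]
    split_ifs <;> omega

lemma fits_mainCode {n k N p : ℕ} (hT : 1 ≤ T)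
    (h : Roomy V n k ⌊invStep x.beta x.eps n k⌋₊) (hx : ∀ t i, x.basis t i ≤ V)
    (hN : N ≤ T) (hp : p < 4 ^ n) : mainCode.Fits x V T [p, n, k, N] := by
  have hm : (Code.floor (invStepCode 1 2)).natVal x [p, n, k, N] =
      ⌊invStep x.beta x.eps n k⌋₊ := by
    change ⌊((invStepCode 1 2).scalarVal x [p, n, k, N]).re⌋₊ = _
    rw [eval_invStepCode, Complex.ofReal_re]
    rfl
  have hmV : ⌊invStep x.beta x.eps n k⌋₊ ≤ V := by have := h.base_le; omega
  refine And.intro (And.intro (fits_invStepCode (e := [p, n, k, N]) hT h) ?_)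
    (And.intro ?_ ?_)
  · exact hm.trans_le hmV
  · rw [hm]
    exact fits_bestCode (e := [_, p, n, k, N]) hT h hx hN
  · rw [eval_bestCode, hm]
    refine fits_coeffCode (e := [_, _, p, n, k, N]) hT h hp ?_
    exact (argminBelow_le _ _).trans h.net_le

end Fits

/-! ### Labels of strings -/

section Labels

lemma digit_finFunctionFinEquiv {b : ℕ} (f : Fin n → Fin b) (i : Fin n) :
    digit b (finFunctionFinEquiv f : ℕ) i = f i := by
  rw [digit, ← finFunctionFinEquiv_symm_apply_val, Equiv.symm_apply_apply]

/-- Turns loops of the program over labels into sums over Pauli strings (`b = 4`) or computational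
basis states (`b = 2`). -/
lemma sum_range_pow {M : Type*} [AddCommMonoid M] (b : ℕ) (f : ℕ → M) :
    ∑ p ∈ Finset.range (b ^ n), f p = ∑ P : Fin n → Fin b, f (finFunctionFinEquiv P : ℕ) := by
  rw [Finset.sum_range]
  exact (Equiv.sum_comp finFunctionFinEquiv fun p : Fin (b ^ n) => f p).symm

lemma weightVal_finFunctionFinEquiv (P : PauliString n) :
    weightVal n (finFunctionFinEquiv P : ℕ) = P.weight := by
  rw [weightVal, Finset.sum_range, PauliString.weight, Finset.card_filter]
  refine Finset.sum_congr rfl fun i _ => ?_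
  rw [digit_finFunctionFinEquiv]
  simp only [Fin.val_eq_zero_iff, ne_eq, ite_not]

lemma isLow_finFunctionFinEquiv {k : ℕ} {P : PauliString n} :
    IsLow n k (finFunctionFinEquiv P : ℕ) ↔ P ∈ lowWeight n k := by
  rw [IsLow, weightVal_finFunctionFinEquiv, mem_lowWeight]
  have h0 : (finFunctionFinEquiv (0 : PauliString n) : ℕ) = 0 := by
    simp
  have : (finFunctionFinEquiv P : ℕ) = 0 ↔ P = 0 := by
    rw [← h0, ← Fin.ext_iff, EmbeddingLike.apply_eq_iff_eq]
  rw [ne_eq, this]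

/-- The rank numbers the low-weight strings consecutively. Using it instead of the label as digit
position keeps the index range at `2m + 1` to the number of low-weight strings rather than to the
power `4 ^ n`. -/
lemma rankVal_lt {k p b : ℕ} (hp : IsLow n k p) (hpb : p < b) :
    rankVal n k p < rankVal n k b := by
  calc rankVal n k p < rankVal n k (p + 1) := by
        rw [rankVal, rankVal, Finset.sum_range_succ, if_pos hp]
        exact Nat.lt_succ_self _
    _ ≤ rankVal n k b := rankVal_mono n k hpb

lemma rankVal_injOn {k p q : ℕ} (hp : IsLow n k p) (hq : IsLow n k q)
    (h : rankVal n k p = rankVal n k q) : p = q := by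
  rcases lt_trichotomy p q with hpq | hpq | hpq
  · exact absurd h (rankVal_lt hp hpq).ne
  · exact hpq
  · exact absurd h (rankVal_lt hq hpq).ne'

/-- The number of low-weight strings. -/
lemma rankVal_four_pow (k : ℕ) : rankVal n k (4 ^ n) = (lowWeight n k).card := by
  rw [rankVal, sum_range_pow, lowWeight, Finset.card_filter]
  refine Finset.sum_congr rfl fun P _ => ?_
  simp only [isLow_finFunctionFinEquiv, mem_lowWeight]

/-- Every assignment of digits to the low-weight strings is that of an index of the net. -/
lemma exists_index {k m : ℕ} (g : PauliString n → ℕ) (hg : ∀ P, g P < 2 * m + 1) :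
    ∃ j < (2 * m + 1) ^ rankVal n k (4 ^ n), ∀ P ∈ lowWeight n k,
      digit (2 * m + 1) j (rankVal n k (finFunctionFinEquiv P : ℕ)) = g P := by
  classical
  set M := rankVal n k (4 ^ n)
  -- The string at a given position is recovered by choice and is unique by injectivity of the rank;
  -- the default digit `0` is never read.
  let f : Fin M → Fin (2 * m + 1) := fun i =>
    if h : ∃ P ∈ lowWeight n k, rankVal n k (finFunctionFinEquiv P : ℕ) = i
    then ⟨g h.choose, hg _⟩ else 0
  refine ⟨(finFunctionFinEquiv f : ℕ), (finFunctionFinEquiv f).2, fun P hP => ?_⟩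
  have hlt : rankVal n k (finFunctionFinEquiv P : ℕ) < M :=
    rankVal_lt (isLow_finFunctionFinEquiv.2 hP) (finFunctionFinEquiv P).2
  have h1 := digit_finFunctionFinEquiv f ⟨_, hlt⟩
  rw [h1]
  have h : ∃ Q ∈ lowWeight n k, rankVal n k (finFunctionFinEquiv Q : ℕ) =
      rankVal n k (finFunctionFinEquiv P : ℕ) := ⟨P, hP, rfl⟩
  have h2 : f ⟨_, hlt⟩ = ⟨g h.choose, hg _⟩ := dif_pos h
  rw [h2]
  have h3 := rankVal_injOn (isLow_finFunctionFinEquiv.2 h.choose_spec.1)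
    (isLow_finFunctionFinEquiv.2 hP) h.choose_spec.2
  have h4 : h.choose = P := finFunctionFinEquiv.injective (Fin.ext h3)
  simp only [h4]

end Labels

/-! ### The net in the program -/

section Net

/-- The `j`-th Hamiltonian of the net. -/
def netHamiltonian (β ε : ℝ) (n k m j : ℕ) : QMatrix n :=
  ofCoeffs k fun P => ((digit (2 * m + 1) j (rankVal n k (finFunctionFinEquiv P : ℕ)) : ℝ) - m) /
    invStep β ε n k

lemma netHamiltonian_eq (β ε : ℝ) (n k m j : ℕ) : netHamiltonian β ε n k m j =
    ∑ P : PauliString n,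
      (coeffVal β ε n k m j (finFunctionFinEquiv P : ℕ) : ℂ) • P.toMatrix := by
  refine Finset.sum_congr rfl fun P _ => ?_
  rw [coeffVal]
  simp only [isLow_finFunctionFinEquiv]

lemma pauliEntry_eq (q : Fin 4) (r c : Fin 2) : pauliEntry q r c = pauli q r c := by
  fin_cases q <;> fin_cases r <;> fin_cases c <;> simp [pauliEntry, pauli]

lemma stringEntry_eq (P : PauliString n) (r c : Fin n → Fin 2) :
    stringEntry n (finFunctionFinEquiv P : ℕ) (finFunctionFinEquiv r : ℕ)
      (finFunctionFinEquiv c : ℕ) = P.toMatrix r c := by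
  rw [stringEntry, Finset.prod_range]
  simp only [digit_finFunctionFinEquiv, pauliEntry_eq]
  rfl

lemma exponentVal_eq (β ε : ℝ) (k m j : ℕ) (r c : Fin n → Fin 2) :
    exponentVal β ε n k m j (finFunctionFinEquiv r : ℕ) (finFunctionFinEquiv c : ℕ) =
      (-(β : ℂ) • netHamiltonian β ε n k m j) r c := by
  rw [exponentVal, sum_range_pow, netHamiltonian_eq]
  simp only [stringEntry_eq, Matrix.smul_apply, Matrix.sum_apply, smul_eq_mul, zero_sub]

/-- The program exponentiates a matrix indexed by numbers below `2 ^ n`, the theorem one indexed by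
bit strings. Reindexing carries a diagonalization to a diagonalization, and the exponential is read
off from it. -/
lemma exp_submatrix {ι κ : Type*} [Fintype ι] [DecidableEq ι] [Fintype κ] [DecidableEq κ]
    {A : Matrix ι ι ℂ} (hA : A.IsHermitian) (e : κ ≃ ι) :
    NormedSpace.exp (A.submatrix e e) = (NormedSpace.exp A).submatrix e e := by
  obtain ⟨U, f, hU, hU', rfl⟩ := exists_unitaryConj hA
  have hsub : ∀ g : ι → ℝ, (unitaryConj U g).submatrix e e =
      unitaryConj (U.submatrix e e) fun i => g (e i) := fun g => by
    rw [unitaryConj, unitaryConj, ← Matrix.submatrix_mul_equiv _ _ e e e,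
      ← Matrix.submatrix_mul_equiv _ _ e e e, Matrix.submatrix_diagonal_equiv]
    rfl
  have hV : U.submatrix e e * (U.submatrix e e).conjTranspose = 1 := by
    rw [Matrix.conjTranspose_submatrix, Matrix.submatrix_mul_equiv, hU', Matrix.submatrix_one_equiv]
  rw [exp_unitaryConj hU', hsub, hsub, exp_unitaryConj hV]

lemma expVal_eq (β ε : ℝ) (k m j : ℕ) (r c : Fin n → Fin 2) :
    expVal β ε n k m j (finFunctionFinEquiv r : ℕ) (finFunctionFinEquiv c : ℕ) =
      NormedSpace.exp (-(β : ℂ) • netHamiltonian β ε n k m j) r c := by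
  have hh : (-(β : ℂ) • netHamiltonian β ε n k m j).IsHermitian := by
    have h : (netHamiltonian β ε n k m j).IsHermitian := (ofCoeffs_isLocalHamiltonian k _).1
    rw [Matrix.IsHermitian, Matrix.conjTranspose_smul, h.eq]
    simp
  have hsub : Matrix.of (fun x y : Fin (2 ^ n) => exponentVal β ε n k m j x y) =
      (-(β : ℂ) • netHamiltonian β ε n k m j).submatrix finFunctionFinEquiv.symm
        finFunctionFinEquiv.symm := by
    ext x y
    rw [Matrix.submatrix_apply, ← exponentVal_eq]
    simp
  rw [expVal, expEntryValue, dif_pos ⟨(finFunctionFinEquiv r).2, (finFunctionFinEquiv c).2⟩, hsub,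
    exp_submatrix hh, Matrix.submatrix_apply, Fin.eta, Fin.eta, Equiv.symm_apply_apply,
    Equiv.symm_apply_apply]

lemma expectationVal_eq (β ε : ℝ) (k m j : ℕ) (P : PauliString n) :
    expectationVal β ε n k m j (finFunctionFinEquiv P : ℕ) =
      (P.toMatrix * gibbs β (netHamiltonian β ε n k m j)).trace := by
  rw [expectationVal, sum_range_pow, sum_range_pow]
  simp only [sum_range_pow (n := n) 2, stringEntry_eq, expVal_eq]
  rw [gibbs, mul_smul_comm, Matrix.trace_smul, smul_eq_mul, div_eq_inv_mul]
  rfl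

/-! ### The data in the program -/

lemma shadowVal_eq (β ε : ℝ) {N : ℕ} (ω : Fin N → Record n) (P : PauliString n) :
    shadowVal (inputOf β ε ω) n N (finFunctionFinEquiv P : ℕ) = (shadowEstimate ω P : ℂ) := by
  have hfac : ∀ (q : Fin 4) (t : Fin N) (i : Fin n),
      shadowFactor (inputOf β ε ω) q t i = (((if q = 0 then (1 : ℝ)
        else if ((ω t).1 i).succ = q then 3 * (-1) ^ ((ω t).2 i : ℕ) else 0) : ℝ) : ℂ) := by
    intro q t i
    have hb : (inputOf β ε ω).basis t i = ((ω t).1 i).succ := by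
      simp [inputOf]
    have ho : (inputOf β ε ω).outcome t i = (ω t).2 i := by
      simp [inputOf]
    rw [shadowFactor, hb, ho]
    generalize ((ω t).1 i).succ = b
    generalize (ω t).2 i = s
    have e1 : ((q : ℕ) = 0) ↔ q = 0 := Fin.val_eq_zero_iff
    by_cases hq : q = 0
    · rw [if_pos (e1.2 hq), if_pos hq, Complex.ofReal_one]
    rw [if_neg (mt e1.1 hq), if_neg hq]
    -- The program tests equality of naturals through the two truncated differences, which vanish
    -- together exactly when the numbers agree.
    by_cases hbq : b = q
    · rw [if_pos hbq, hbq, Nat.sub_self, if_pos rfl, if_pos rfl]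
      fin_cases s <;> simp
    · rw [if_neg hbq, Complex.ofReal_zero]
      have hne : (b : ℕ) ≠ q := fun h => hbq (Fin.ext h)
      split_ifs <;> first | rfl | omega
  rw [shadowVal, shadowEstimate, Finset.sum_range]
  push_cast
  congr 1
  refine Finset.sum_congr rfl fun t _ => ?_
  rw [Finset.prod_range]
  refine Finset.prod_congr rfl fun i _ => ?_
  rw [digit_finFunctionFinEquiv, hfac]

/-- The sum of the absolute deviations of a state from the data. -/
def dataDeviation {N : ℕ} (k : ℕ) (ω : Fin N → Record n) (τ : QMatrix n) : ℝ :=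
  ∑ P ∈ lowWeight n k, |shadowEstimate ω P - (P.toMatrix * τ).trace.re|

lemma re_objectiveVal (β ε : ℝ) {N : ℕ} (k m j : ℕ) (ω : Fin N → Record n) :
    (objectiveVal (inputOf β ε ω) n k N m j).re =
      dataDeviation k ω (gibbs β (netHamiltonian β ε n k m j)) := by
  rw [objectiveVal, sum_range_pow, Complex.re_sum, dataDeviation, lowWeight, Finset.sum_filter]
  refine Finset.sum_congr rfl fun P _ => ?_
  rw [shadowVal_eq]
  change (if _ then if 0 ≤ ((shadowEstimate ω P : ℂ) - expectationVal β ε n k m j _).re then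
    (shadowEstimate ω P : ℂ) - expectationVal β ε n k m j _ else
    0 - ((shadowEstimate ω P : ℂ) - expectationVal β ε n k m j _) else 0).re = _
  rw [expectationVal_eq]
  simp only [isLow_finFunctionFinEquiv, mem_lowWeight]
  split_ifs with h1 h2
  · rw [Complex.sub_re, Complex.ofReal_re] at h2 ⊢
    exact (abs_of_nonneg h2).symm
  · rw [Complex.sub_re, Complex.ofReal_re] at h2
    rw [abs_of_neg (not_le.1 h2), zero_sub, Complex.neg_re, Complex.sub_re, Complex.ofReal_re]
  · rfl

lemma outputHamiltonian_mainCode (β ε : ℝ) {N : ℕ} (k : ℕ) (ω : Fin N → Record n) :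
    outputHamiltonian mainCode k β ε ω = netHamiltonian β ε n k ⌊invStep β ε n k⌋₊
      (bestVal (inputOf β ε ω) n k N ⌊invStep β ε n k⌋₊) := by
  rw [netHamiltonian_eq]
  refine Finset.sum_congr rfl fun P _ => ?_
  rw [eval_mainCode]
  rfl

lemma argminBelow_min (f : ℕ → ℝ) {b j : ℕ} (hj : j < b) : f (argminBelow f b) ≤ f j := by
  induction b with
  | zero => omega
  | succ b ih =>
    rw [argminBelow]
    split_ifs with h
    · rcases Nat.lt_succ_iff_lt_or_eq.1 hj with h1 | rfl
      · exact h.le.trans (ih h1)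
      · exact le_rfl
    · rcases Nat.lt_succ_iff_lt_or_eq.1 hj with h1 | rfl
      · exact ih h1
      · exact not_lt.1 h

variable {β ε : ℝ} {k : ℕ}

lemma netHamiltonian_mem {ε' : ℝ} (hstep : gridStep ε' k n β = (invStep β ε n k)⁻¹)
    (hpos : 0 < invStep β ε n k) (j : ℕ) :
    netHamiltonian β ε n k ⌊invStep β ε n k⌋₊ j ∈ hamiltonianNet ε' k n β := by
  refine ofCoeffs_mem_hamiltonianNet fun P _ => ?_
  set m := ⌊invStep β ε n k⌋₊
  set a := digit (2 * m + 1) j (rankVal n k (finFunctionFinEquiv P : ℕ))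
  have ha : a < 2 * m + 1 := Nat.mod_lt _ (by omega)
  -- Digits run from `0` to `2m`; subtracting `m` centres them, and `m` is the floor of the inverse
  -- step, so the coefficient stays in `[-1, 1]`.
  refine ⟨(a : ℤ) - m, ?_, ?_⟩
  · rw [hstep, inv_mul_eq_div, abs_div, abs_of_pos hpos, div_le_one hpos]
    have h1 : |(((a : ℤ) - m : ℤ) : ℝ)| ≤ m := by
      rw [← Int.cast_abs]
      have : |(a : ℤ) - m| ≤ (m : ℤ) := by rw [abs_le]; constructor <;> omega
      exact_mod_cast this
    exact h1.trans (Nat.floor_le hpos.le)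
  · rw [hstep]
    push_cast
    rw [inv_mul_eq_div]

lemma exists_netHamiltonian_eq {ε' : ℝ} (hstep : gridStep ε' k n β = (invStep β ε n k)⁻¹)
    (hpos : 0 < invStep β ε n k) {H : QMatrix n} (hH : H ∈ hamiltonianNet ε' k n β) :
    ∃ j < (2 * ⌊invStep β ε n k⌋₊ + 1) ^ rankVal n k (4 ^ n),
      netHamiltonian β ε n k ⌊invStep β ε n k⌋₊ j = H := by
  set m := ⌊invStep β ε n k⌋₊
  choose a ha1 ha2 using hH.2.2
  have ham : ∀ P, |a P| ≤ (m : ℤ) := fun P => by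
    have h1 := ha1 P
    rw [hstep, inv_mul_eq_div, abs_div, abs_of_pos hpos, div_le_one hpos, ← Int.cast_abs] at h1
    have h2 : (((|a P|).toNat : ℕ) : ℝ) ≤ invStep β ε n k := by
      have : (((|a P|).toNat : ℕ) : ℝ) = ((|a P| : ℤ) : ℝ) := by
        exact_mod_cast congrArg (Int.cast (R := ℝ)) (Int.toNat_of_nonneg (abs_nonneg (a P)))
      rwa [this]
    have h3 : (|a P|).toNat ≤ m := Nat.le_floor h2
    omega
  obtain ⟨j, hj, hd⟩ := exists_index (k := k) (m := m) (fun P => (a P + m).toNat) (fun P => by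
    have := abs_le.1 (ham P); omega)
  refine ⟨j, hj, ?_⟩
  rw [eq_ofCoeffs_of_mem hH, netHamiltonian, ofCoeffs, ofCoeffs]
  refine Finset.sum_congr rfl fun P _ => ?_
  congr 2
  split_ifs with hP
  · rw [hd P hP, ha2, Complex.ofReal_re, hstep, inv_mul_eq_div]
    congr 1
    have h1 : (((a P + m).toNat : ℕ) : ℤ) = a P + m :=
      Int.toNat_of_nonneg (by have := abs_le.1 (ham P); omega)
    have h2 := congrArg (Int.cast (R := ℝ)) h1
    push_cast at h2
    rw [h2]
    ring
  · rfl

/-- The program outputs an element of the net that deviates least from the data. -/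
lemma outputHamiltonian_spec {ε' : ℝ} (hstep : gridStep ε' k n β = (invStep β ε n k)⁻¹)
    (hpos : 0 < invStep β ε n k) {N : ℕ} (ω : Fin N → Record n) :
    outputHamiltonian mainCode k β ε ω ∈ hamiltonianNet ε' k n β ∧
      ∀ H ∈ hamiltonianNet ε' k n β,
        dataDeviation k ω (gibbs β (outputHamiltonian mainCode k β ε ω)) ≤
          dataDeviation k ω (gibbs β H) := by
  rw [outputHamiltonian_mainCode]
  refine ⟨netHamiltonian_mem hstep hpos _, fun H hH => ?_⟩
  obtain ⟨j, hj, rfl⟩ := exists_netHamiltonian_eq hstep hpos hH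
  rw [← re_objectiveVal, ← re_objectiveVal]
  exact argminBelow_min
    (fun j => (objectiveVal (inputOf β ε ω) n k N ⌊invStep β ε n k⌋₊ j).re) hj

/-! ### The distance to the data -/

/-- The distance to the data is proportional to the sum of the absolute deviations. -/
lemma shadowDistance_eq {ε' : ℝ} (hη : 0 < gridStep ε' k n β) {N : ℕ} (ω : Fin N → Record n)
    (τ : QMatrix n) : shadowDistance ε' k β ω τ =
      2 * (gridStep ε' k n β * ⌊(gridStep ε' k n β)⁻¹⌋₊) * dataDeviation k ω τ := by
  set η := gridStep ε' k n β with hηdef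
  set m := ⌊η⁻¹⌋₊ with hm
  have hmη : η * m ≤ 1 := by
    have := Nat.floor_le (inv_pos.2 hη).le
    calc η * m ≤ η * η⁻¹ := mul_le_mul_of_nonneg_left this hη.le
      _ = 1 := mul_inv_cancel₀ hη.ne'
  set D : PauliString n → ℝ := fun P => shadowEstimate ω P - (P.toMatrix * τ).trace.re with hD
  have hval : ∀ H ∈ hamiltonianNet ε' k n β, ∀ H' ∈ hamiltonianNet ε' k n β,
      shadowDifference k ω H H' - ((H - H') * τ).trace.re =
        ∑ P ∈ lowWeight n k, ((pauliCoeff H P).re - (pauliCoeff H' P).re) * D P := by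
    intro H hH H' hH'
    rw [re_trace_sub_mul_eq_sum hH.1 hH'.1 (Or.inl (hH.2.1.trans hH'.2.1.symm)), shadowDifference]
    have : ∑ P : PauliString n with P.weight ≤ k,
        (pauliCoeff H P - pauliCoeff H' P).re * shadowEstimate ω P =
        ∑ P ∈ lowWeight n k,
          ((pauliCoeff H P).re - (pauliCoeff H' P).re) * shadowEstimate ω P := by
      symm
      -- The estimator also runs over the identity string, where both coefficients vanish because
      -- the net is traceless.
      refine Finset.sum_subset_zero_on_sdiff (fun P hP => ?_) (fun P hP => ?_) fun P _ => ?_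
      · exact Finset.mem_filter.2 ⟨Finset.mem_univ _, (mem_lowWeight.1 hP).2⟩
      · have hP0 : P = 0 := by
          by_contra h
          exact (Finset.mem_sdiff.1 hP).2
            (mem_lowWeight.2 ⟨h, (Finset.mem_filter.1 (Finset.mem_sdiff.1 hP).1).2⟩)
        rw [hP0, hH.2.1, hH'.2.1, sub_self, Complex.zero_re, zero_mul]
      · rw [Complex.sub_re]
    rw [this, ← Finset.sum_sub_distrib]
    exact Finset.sum_congr rfl fun P _ => by rw [hD]; ring
  -- The extreme grid points are `±η m`, which may lie strictly inside `[-1, 1]`; for `η > 1` the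
  -- only one is `0`.
  have hcoef : ∀ H ∈ hamiltonianNet ε' k n β, ∀ P, |(pauliCoeff H P).re| ≤ η * m := by
    intro H hH P
    obtain ⟨a, ha, e⟩ := hH.2.2 P
    rw [e, Complex.ofReal_re, abs_mul, abs_of_pos hη]
    refine mul_le_mul_of_nonneg_left ?_ hη.le
    rw [abs_mul, abs_of_pos hη, ← le_div_iff₀' hη, one_div, ← Int.cast_abs, Int.abs_eq_natAbs,
      Int.cast_natCast] at ha
    rw [← Int.cast_abs, Int.abs_eq_natAbs, Int.cast_natCast]
    exact_mod_cast Nat.le_floor ha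
  have hmem : ∀ s : PauliString n → ℤ, (∀ P, |s P| ≤ 1) →
      ofCoeffs k (fun P => η * (s P * m : ℤ)) ∈ hamiltonianNet ε' k n β := fun s hs =>
    ofCoeffs_mem_hamiltonianNet fun P _ => ⟨s P * m, by
      rw [abs_mul, abs_of_pos hη]
      push_cast
      rw [abs_mul, Nat.abs_cast]
      have h1 : |(s P : ℝ)| ≤ 1 := by exact_mod_cast hs P
      calc η * (|(s P : ℝ)| * m) ≤ η * (1 * m) := by gcongr
        _ ≤ 1 := by rwa [one_mul], rfl⟩
  -- The maximizing pair: the corner of the grid whose signs are those of the deviations, and the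
  -- opposite corner. Both lie in the net because the grid is a full symmetric box.
  set s : PauliString n → ℤ := fun P => if 0 ≤ D P then 1 else -1 with hs
  have hs1 : ∀ P, |s P| ≤ 1 := fun P => by rw [hs]; dsimp only; split_ifs <;> simp
  have hs2 : ∀ P, |-s P| ≤ 1 := fun P => by rw [abs_neg]; exact hs1 P
  have hbound : ∀ q : hamiltonianNet ε' k n β × hamiltonianNet ε' k n β,
      |shadowDifference k ω q.1.1 q.2.1 - (((q.1.1 : QMatrix n) - q.2.1) * τ).trace.re| ≤
        2 * (η * m) * dataDeviation k ω τ := fun q => by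
    rw [hval _ q.1.2 _ q.2.2, dataDeviation, Finset.mul_sum]
    refine (Finset.abs_sum_le_sum_abs _ _).trans (Finset.sum_le_sum fun P _ => ?_)
    rw [abs_mul]
    refine mul_le_mul_of_nonneg_right ((abs_sub _ _).trans ?_) (abs_nonneg _)
    have h1 := hcoef _ q.1.2 P
    have h2 := hcoef _ q.2.2 P
    linarith
  have : Nonempty (hamiltonianNet ε' k n β × hamiltonianNet ε' k n β) :=
    ⟨(⟨_, hmem s hs1⟩, ⟨_, hmem s hs1⟩)⟩
  refine le_antisymm (ciSup_le hbound) ?_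
  refine le_trans (le_of_eq ?_) (le_ciSup (f := fun q : hamiltonianNet ε' k n β ×
    hamiltonianNet ε' k n β => |shadowDifference k ω q.1.1 q.2.1 -
      (((q.1.1 : QMatrix n) - q.2.1) * τ).trace.re|)
    ⟨_, Set.forall_mem_range.2 hbound⟩ (⟨_, hmem s hs1⟩, ⟨_, hmem (fun P => -s P) hs2⟩))
  rw [hval _ (hmem s hs1) _ (hmem _ hs2)]
  have : ∑ P ∈ lowWeight n k, ((pauliCoeff (ofCoeffs k fun P => η * (s P * m : ℤ)) P).re -
      (pauliCoeff (ofCoeffs k fun P => η * (-s P * m : ℤ)) P).re) * D P =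
      2 * (η * m) * dataDeviation k ω τ := by
    rw [dataDeviation, Finset.mul_sum]
    refine Finset.sum_congr rfl fun P hP => ?_
    rw [pauliCoeff_ofCoeffs, pauliCoeff_ofCoeffs, if_pos hP, if_pos hP, Complex.ofReal_re,
      Complex.ofReal_re]
    have h1 : (s P : ℝ) * D P = |D P| := by
      rw [hs]
      dsimp only
      split_ifs with h
      · rw [abs_of_nonneg h]; simp
      · rw [abs_of_neg (not_le.1 h)]; simp
    push_cast
    change _ = 2 * (η * m) * |D P|
    rw [← h1]
    ring
  rw [this, abs_of_nonneg]
  have : 0 ≤ dataDeviation k ω τ := Finset.sum_nonneg fun _ _ => abs_nonneg _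
  positivity

end Net

/-! ### Numerical bounds -/

section Numerics

variable {k : ℕ} {β ε δ : ℝ}

lemma gridStep_eq (hβ : 0 < β) (hε : 0 < ε) (hn : 2 ≤ n) :
    gridStep (ε ^ 2 / (100 * max β 1 * (n : ℝ) ^ k)) k n β = (invStep β ε n k)⁻¹ := by
  have hA : (0 : ℝ) < max β 1 := lt_max_of_lt_right one_pos
  have hQ : (0 : ℝ) < (n : ℝ) ^ k := by positivity
  rw [gridStep, invStep]
  field_simp
  norm_num

lemma invStep_pos (hβ : 0 < β) (hε : 0 < ε) (hn : 2 ≤ n) : 0 < invStep β ε n k := by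
  have hA : (0 : ℝ) < max β 1 := lt_max_of_lt_right one_pos
  rw [invStep]
  positivity

/-- A lower bound on the logarithm is needed to absorb the rounding up in the number of copies into
a multiple of it. -/
lemma half_le_log_div (hn : 2 ≤ n) (hδ : 0 < δ) (hδ1 : δ < 1) : 1 / 2 ≤ Real.log (n / δ) := by
  have h2 : (2 : ℝ) ≤ n := by exact_mod_cast hn
  have h3 : (2 : ℝ) ≤ n / δ := by
    rw [le_div_iff₀ hδ]
    nlinarith
  have h4 := Real.log_le_log (by norm_num) h3
  have h5 := Real.log_two_gt_d9
  linarith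

/-- The quantity in whose powers all resources are bounded. -/
def resourceBase (n k : ℕ) (β ε : ℝ) : ℝ := (n : ℝ) ^ k * max β 1 / ε

lemma pow_le_resourceBase (hn : 2 ≤ n) (hε : 0 < ε) (hε1 : ε < 1) :
    (n : ℝ) ^ k ≤ resourceBase n k β ε := by
  have hQ : (0 : ℝ) < (n : ℝ) ^ k := by positivity
  have hA : (1 : ℝ) ≤ max β 1 := le_max_right _ _
  rw [resourceBase, le_div_iff₀ hε]
  nlinarith

lemma le_pow_locality (hk : 1 ≤ k) : n ≤ n ^ k := Nat.le_self_pow (by omega) n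

lemma locality_lt_pow (hn : 2 ≤ n) : k < n ^ k :=
  Nat.lt_pow_self (by omega)

/-- Being at least `2`, the base turns every numerical constant into a fixed power of itself. -/
lemma two_le_resourceBase (hn : 2 ≤ n) (hk : 1 ≤ k) (hε : 0 < ε)
    (hε1 : ε < 1) : 2 ≤ resourceBase n k β ε := by
  refine le_trans ?_ (pow_le_resourceBase hn hε hε1)
  exact_mod_cast hn.trans (le_pow_locality hk)

lemma resourceBase_le_pow (hn : 2 ≤ n) (hk : 1 ≤ k) (hε : 0 < ε)
    (hε1 : ε < 1) : resourceBase n k β ε ≤ resourceBase n k β ε ^ n ^ k := by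
  have h2 := two_le_resourceBase (β := β) hn hk hε hε1
  exact le_self_pow₀ (by linarith) (by positivity)

lemma two_pow_le_resourceBase_pow (hn : 2 ≤ n) (hk : 1 ≤ k) (hε : 0 < ε)
    (hε1 : ε < 1) (a : ℕ) :
    (2 : ℝ) ^ a ≤ (resourceBase n k β ε ^ n ^ k) ^ a := by
  have h2 := two_le_resourceBase (β := β) hn hk hε hε1
  exact pow_le_pow_left₀ (by norm_num)
    (h2.trans (resourceBase_le_pow hn hk hε hε1)) a

lemma four_pow_le_resourceBase_pow (hn : 2 ≤ n) (hk : 1 ≤ k) (hε : 0 < ε)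
    (hε1 : ε < 1) : (4 : ℝ) ^ n ≤ (resourceBase n k β ε ^ n ^ k) ^ 2 := by
  have h2 := two_le_resourceBase (β := β) hn hk hε hε1
  calc (4 : ℝ) ^ n = (2 ^ n) ^ 2 := by rw [← pow_mul, mul_comm, pow_mul]; norm_num
    _ ≤ (resourceBase n k β ε ^ n ^ k) ^ 2 := by
        refine pow_le_pow_left₀ (by positivity) ?_ 2
        calc (2 : ℝ) ^ n ≤ 2 ^ n ^ k :=
              pow_le_pow_right₀ (by norm_num) (le_pow_locality hk)
          _ ≤ _ := pow_le_pow_left₀ (by norm_num) h2 _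

lemma locality_le_resourceBase_pow (hn : 2 ≤ n) (hk : 1 ≤ k) (hε : 0 < ε)
    (hε1 : ε < 1) : (k : ℝ) ≤ resourceBase n k β ε ^ n ^ k := by
  refine le_trans ?_ ((pow_le_resourceBase (β := β) hn hε hε1).trans
    (resourceBase_le_pow hn hk hε hε1))
  exact_mod_cast (locality_lt_pow hn).le

/-- The inverse grid step is at most `20000 L²`, so the base is at most `40001 L²`, and `40001 ≤
2^16 ≤ L^16`. -/
lemma base_le_resourceBase_pow (hn : 2 ≤ n) (hk : 1 ≤ k) (hε : 0 < ε)
    (hε1 : ε < 1) (hβ : 0 < β) :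
    ((2 * ⌊invStep β ε n k⌋₊ + 1 : ℕ) : ℝ) ≤ resourceBase n k β ε ^ 18 := by
  have h2 := two_le_resourceBase (β := β) hn hk hε hε1
  have hA : β ≤ max β 1 := le_max_left _ _
  have hA1 : (1 : ℝ) ≤ max β 1 := le_max_right _ _
  have hinv : invStep β ε n k ≤ 20000 * resourceBase n k β ε ^ 2 := by
    have e : 20000 * resourceBase n k β ε ^ 2 =
        20000 * max β 1 * max β 1 * ((n : ℝ) ^ k * (n : ℝ) ^ k) / (ε * ε) := by
      rw [resourceBase]; field_simp
    rw [e, invStep]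
    gcongr
  have hm : (⌊invStep β ε n k⌋₊ : ℝ) ≤ 20000 * resourceBase n k β ε ^ 2 :=
    (Nat.floor_le (invStep_pos hβ hε hn).le).trans hinv
  set L := resourceBase n k β ε
  have hL2 : (1 : ℝ) ≤ L ^ 2 := one_le_pow₀ (by linarith)
  push_cast
  calc 2 * (⌊invStep β ε n k⌋₊ : ℝ) + 1 ≤ 40001 * L ^ 2 := by linarith
    _ ≤ 2 ^ 16 * L ^ 2 := by
        refine mul_le_mul_of_nonneg_right (by norm_num) (by positivity)
    _ ≤ L ^ 16 * L ^ 2 := by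
        refine mul_le_mul_of_nonneg_right ?_ (by positivity)
        exact pow_le_pow_left₀ (by norm_num) h2 16
    _ = L ^ 18 := by ring

/-- The exponent comes from the size of the net: its base is at most `L^18` and it has at most `21
n^k` digits, and `378 = 18 * 21`. The other numbers need far smaller powers. -/
lemma exists_roomy (hn : 2 ≤ n) (hk : 1 ≤ k) (hε : 0 < ε)
    (hε1 : ε < 1) (hβ : 0 < β) : ∃ V : ℕ, Roomy V n k ⌊invStep β ε n k⌋₊ ∧
    (V : ℝ) ≤ (resourceBase n k β ε ^ n ^ k) ^ 378 := by
  have h2 := two_le_resourceBase (β := β) hn hk hε hε1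
  have hLB := resourceBase_le_pow (β := β) hn hk hε hε1
  have hbase := base_le_resourceBase_pow hn hk hε hε1 hβ
  have hpow := pow_le_resourceBase (k := k) (β := β) hn hε hε1
  have hloc := locality_le_resourceBase_pow (β := β) hn hk hε hε1
  have hfour := four_pow_le_resourceBase_pow (β := β) hn hk hε hε1
  have h20000 := two_pow_le_resourceBase_pow (β := β) hn hk hε hε1 15
  set L := resourceBase n k β ε
  set B := L ^ n ^ k with hB
  have hB1 : 1 ≤ B := by linarith
  have hmono : ∀ {a : ℕ}, a ≤ 378 → B ^ a ≤ B ^ 378 := fun h => pow_le_pow_right₀ hB1 h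
  have hmono1 : B ≤ B ^ 378 := le_self_pow₀ hB1 (by norm_num)
  refine ⟨⌊B ^ 378⌋₊, ⟨?_, ?_, ?_, ?_, ?_, ?_⟩, Nat.floor_le (by positivity)⟩ <;>
    apply Nat.le_floor
  · refine le_trans ?_ (hmono (show 15 ≤ 378 by norm_num))
    refine le_trans ?_ h20000
    norm_num
  · push_cast
    exact hfour.trans (hmono (by norm_num))
  · push_cast
    exact (hpow.trans hLB).trans hmono1
  · exact hloc.trans hmono1
  · refine hbase.trans (le_trans ?_ (hmono (show 18 ≤ 378 by norm_num)))
    exact pow_le_pow_left₀ (by linarith) hLB 18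
  · have hM : rankVal n k (4 ^ n) ≤ 21 * n ^ k := by
      rw [rankVal_four_pow]
      exact_mod_cast card_lowWeight_le (n := n) k (by omega)
    have hL1 : 1 ≤ L ^ 18 := one_le_pow₀ (by linarith)
    rw [Nat.cast_pow]
    calc _ ≤ (L ^ 18) ^ rankVal n k (4 ^ n) := pow_le_pow_left₀ (Nat.cast_nonneg _) hbase _
      _ ≤ (L ^ 18) ^ (21 * n ^ k) := pow_le_pow_right₀ hL1 hM
      _ = B ^ 378 := by
          rw [hB, ← pow_mul, ← pow_mul]
          congr 1
          ring

/-- The number of copies. -/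
lemma copies_bounds (hn : 2 ≤ n) (hk : 1 ≤ k) (hε : 0 < ε)
    (hε1 : ε < 1) (hδ : 0 < δ) (hδ1 : δ < 1) :
    let X := 4480000 * (3 ^ k * (n : ℝ) ^ (2 * k) * k * Real.log (n / δ) * max β 1 ^ 2 / ε ^ 4)
    0 < X ∧ (⌈X⌉₊ : ℝ) ≤ (resourceBase n k β ε ^ n ^ k) ^ 31 * Real.log (n / δ) := by
  intro X
  have hlog := half_le_log_div hn hδ hδ1
  have h2 := two_le_resourceBase (β := β) hn hk hε hε1
  have hLB := resourceBase_le_pow (β := β) hn hk hε hε1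
  have hpow := pow_le_resourceBase (k := k) (β := β) hn hε hε1
  have hloc := locality_le_resourceBase_pow (β := β) hn hk hε hε1
  have h23 := two_pow_le_resourceBase_pow (β := β) hn hk hε hε1 23
  have hA1 : (1 : ℝ) ≤ max β 1 := le_max_right _ _
  have hk1 : (1 : ℝ) ≤ k := by exact_mod_cast hk
  have hn2 : (2 : ℝ) ≤ n := by exact_mod_cast hn
  have hX : 0 < X := by positivity
  refine ⟨hX, ?_⟩
  have hL4 : (n : ℝ) ^ (2 * k) * max β 1 ^ 2 / ε ^ 4 ≤ resourceBase n k β ε ^ 4 := by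
    have e : resourceBase n k β ε ^ 4 =
        ((n : ℝ) ^ (2 * k) * max β 1 ^ 2 / ε ^ 4) * ((n : ℝ) ^ (2 * k) * max β 1 ^ 2) := by
      rw [resourceBase, mul_comm 2 k, pow_mul]
      field_simp
    rw [e]
    refine le_mul_of_one_le_right (by positivity) ?_
    exact one_le_mul_of_one_le_of_one_le (one_le_pow₀ (by linarith)) (one_le_pow₀ hA1)
  have h3 : (3 : ℝ) ^ k ≤ ((n : ℝ) ^ k) ^ 2 := by
    rw [← pow_mul, mul_comm k 2, pow_mul]
    refine pow_le_pow_left₀ (by norm_num) ?_ k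
    nlinarith
  set L := resourceBase n k β ε
  set B := L ^ n ^ k
  set l := Real.log (n / δ)
  have hB2 : 2 ≤ B := h2.trans hLB
  have h3B : (3 : ℝ) ^ k ≤ B ^ 2 :=
    h3.trans (pow_le_pow_left₀ (by positivity) (hpow.trans hLB) 2)
  have hXB : X ≤ B ^ 30 * l := by
    calc X = 4480000 * 3 ^ k * k * ((n : ℝ) ^ (2 * k) * max β 1 ^ 2 / ε ^ 4) * l := by
          simp only [X]; ring
      -- The factors bound, in order, the constant (below `2^23`), `3^k ≤ n^{2k}`, the locality `k`,
      -- and the polynomial in `n^k`, `max β 1` and `1/ε`.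
      _ ≤ B ^ 23 * B ^ 2 * B * B ^ 4 * l := by
          have h4480000 : (4480000 : ℝ) ≤ B ^ 23 := le_trans (by norm_num) h23
          have hL4B := hL4.trans (pow_le_pow_left₀ (by linarith) hLB 4)
          gcongr
      _ = B ^ 30 * l := by ring
  have h1 : 1 ≤ B ^ 30 * l := by
    have hBB : B ≤ B ^ 30 := le_self_pow₀ (by linarith) (by norm_num)
    nlinarith
  calc (⌈X⌉₊ : ℝ) ≤ X + 1 := (Nat.ceil_lt_add_one hX.le).le
    _ ≤ 2 * (B ^ 30 * l) := by linarith
    _ ≤ B * (B ^ 30 * l) := mul_le_mul_of_nonneg_right hB2 (by positivity)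
    _ = B ^ 31 * l := by ring

/-- The failure probability with exponent `7 k log (n/δ)`. -/
lemma failure_le (hn : 2 ≤ n) (hk : 1 ≤ k) (hδ : 0 < δ) (hδ1 : δ < 1) {y : ℝ}
    (hy : 7 * k * Real.log (n / δ) ≤ y) :
    42 * (n : ℝ) ^ k * Real.exp (-y) ≤ δ := by
  have hn2 : (2 : ℝ) ≤ n := by exact_mod_cast hn
  have hn0 : (0 : ℝ) < n := by linarith
  have h1 : Real.exp (-y) ≤ (δ / n) ^ (7 * k) := by
    calc Real.exp (-y) ≤ Real.exp (-(7 * k * Real.log (n / δ))) :=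
          Real.exp_le_exp.2 (by linarith)
      _ = (δ / n) ^ (7 * k) := by
          rw [← Real.exp_log (show 0 < δ / n by positivity), ← Real.exp_nat_mul,
            ← inv_div (n : ℝ) δ, Real.log_inv]
          push_cast
          congr 1
          ring
  have h2 : δ ^ (7 * k) ≤ δ := pow_le_of_le_one hδ.le hδ1.le (by omega)
  -- Of the `7k` powers of `1/n`, `k` pay for the number of strings in the union bound and the
  -- remaining `6k` for the constant `42`; one power of `δ` suffices.
  have h3 : 42 ≤ (n : ℝ) ^ (6 * k) := by
    calc (42 : ℝ) ≤ 2 ^ 6 := by norm_num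
      _ ≤ 2 ^ (6 * k) := pow_le_pow_right₀ (by norm_num) (by omega)
      _ ≤ (n : ℝ) ^ (6 * k) := pow_le_pow_left₀ (by norm_num) hn2 _
  calc 42 * (n : ℝ) ^ k * Real.exp (-y) ≤ 42 * (n : ℝ) ^ k * (δ / n) ^ (7 * k) := by gcongr
    _ = 42 * δ ^ (7 * k) / (n : ℝ) ^ (6 * k) := by
        rw [div_pow, show 7 * k = k + 6 * k by ring, pow_add (n : ℝ)]
        field_simp
    _ ≤ 42 * δ / (n : ℝ) ^ (6 * k) := by gcongr
    _ ≤ δ := by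
        rw [div_le_iff₀ (by positivity)]
        nlinarith

/-- The running time of the program. -/
lemma runningTime_le (hn : 2 ≤ n) (hk : 1 ≤ k) (hε : 0 < ε)
    (hε1 : ε < 1) (hβ : 0 < β) (hδ : 0 < δ) (hδ1 : δ < 1) {N d : ℕ} (hN : 1 ≤ N)
    (hNB : (N : ℝ) ≤ (resourceBase n k β ε ^ n ^ k) ^ 31 * Real.log (n / δ))
    (hd : ∀ (x : Input) (V T : ℕ) (e : List ℕ), 4 ≤ V → 1 ≤ T → mainCode.Fits x V T e →
      mainCode.cost x e ≤ T * V ^ d) (ω : Fin N → Record n) :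
    (runningTime mainCode k β ε ω : ℝ) ≤
      ((n : ℝ) ^ k * max β 1 / ε) ^ (((34 + 378 * d : ℕ) : ℝ) * (n : ℝ) ^ k) *
        Real.log (n / δ) := by
  obtain ⟨V, hV, hVB⟩ := exists_roomy hn hk hε hε1 hβ
  have h0 := hV.const_le
  have hbasis : ∀ t i, (inputOf β ε ω).basis t i ≤ V := fun t i => by
    simp only [inputOf]
    split_ifs <;> omega
  -- The whole search is rerun for each of the `4 ^ n` output coefficients, which is affordable.
  have hcost : ∀ p ∈ Finset.range (4 ^ n),
      1 + mainCode.cost (inputOf β ε ω) [p, n, k, N] ≤ 2 * (N * V ^ d) := fun p hp => by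
    have h1 := hd _ V N _ (by omega) hN
      (fits_mainCode (x := inputOf β ε ω) hN hV hbasis le_rfl (Finset.mem_range.1 hp))
    have h2 : 1 ≤ N * V ^ d := Nat.mul_pos hN (Nat.pow_pos (by omega))
    omega
  have hrun : runningTime mainCode k β ε ω ≤ 4 ^ n * (2 * (N * V ^ d)) := by
    calc runningTime mainCode k β ε ω ≤ ∑ p ∈ Finset.range (4 ^ n), 2 * (N * V ^ d) :=
          Finset.sum_le_sum hcost
      _ = _ := by simp
  have hrunR : (runningTime mainCode k β ε ω : ℝ) ≤ 4 ^ n * (2 * (N * (V : ℝ) ^ d)) := by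
    exact_mod_cast hrun
  have hfour := four_pow_le_resourceBase_pow (β := β) hn hk hε hε1
  have h2L := two_le_resourceBase (β := β) hn hk hε hε1
  have h2B := h2L.trans (resourceBase_le_pow (β := β) hn hk hε hε1)
  have hlog := half_le_log_div hn hδ hδ1
  have hrw : ((n : ℝ) ^ k * max β 1 / ε) ^ (((34 + 378 * d : ℕ) : ℝ) * (n : ℝ) ^ k) =
      (resourceBase n k β ε ^ n ^ k) ^ (34 + 378 * d) := by
    change resourceBase n k β ε ^ _ = _
    have e : ((34 + 378 * d : ℕ) : ℝ) * (n : ℝ) ^ k = ((n ^ k * (34 + 378 * d) : ℕ) : ℝ) := by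
      push_cast
      ring
    rw [← pow_mul, e, Real.rpow_natCast]
  rw [hrw]
  set B := resourceBase n k β ε ^ n ^ k
  refine hrunR.trans ?_
  -- The exponent is `2` for `4 ^ n`, `1` for the factor `2`, `31` for the number of copies, and
  -- `378 d` for `V ^ d`.
  calc (4 : ℝ) ^ n * (2 * (N * (V : ℝ) ^ d))
      ≤ B ^ 2 * (B * ((B ^ 31 * Real.log (n / δ)) * (B ^ 378) ^ d)) := by gcongr
    _ = B ^ (34 + 378 * d) * Real.log (n / δ) := by
        rw [← pow_mul, pow_add]
        ring

end Numerics

/-! ### Accuracy of the output -/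

section Accuracy

variable {k : ℕ} {β ε ε' : ℝ}

/-- A state of the net that fits accurate data best is close to the measured state. -/
lemma traceNorm_sub_le_of_minimizer (hn : 1 ≤ n) (hβ : 0 < β) {H H₀ H₁ : QMatrix n}
    (hH : IsLocalHamiltonian k H) (hH₀ : H₀ ∈ hamiltonianNet ε' k n β)
    (hH₁ : H₁ ∈ hamiltonianNet ε' k n β) {N : ℕ} {ω : Fin N → Record n} {γ t : ℝ}
    (hγ : ∀ P ∈ lowWeight n k,
      |shadowEstimate ω P - (P.toMatrix * gibbs β H).trace.re| ≤ γ) (hγ0 : 0 ≤ γ)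
    (ht : traceNorm (gibbs β H - gibbs β H₀) ≤ t)
    (hmin : dataDeviation k ω (gibbs β H₁) ≤ dataDeviation k ω (gibbs β H₀)) :
    traceNorm (gibbs β H₁ - gibbs β H₀) ^ 2 ≤ 84 * β * (n : ℝ) ^ k * (γ + t) := by
  have hF : dataDeviation k ω (gibbs β H₀) ≤ 21 * (n : ℝ) ^ k * (γ + t) := by
    calc dataDeviation k ω (gibbs β H₀) ≤ ∑ P ∈ lowWeight n k, (γ + t) := by
          refine Finset.sum_le_sum fun P hP => ?_
          have h1 := abs_re_trace_mul_le_traceNorm ((gibbs_isHermitian β hH.1).sub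
            (gibbs_isHermitian β hH₀.1.1)) P.conjTranspose_mul_self
          have e : shadowEstimate ω P - (P.toMatrix * gibbs β H₀).trace.re =
              (shadowEstimate ω P - (P.toMatrix * gibbs β H).trace.re) +
                (P.toMatrix * (gibbs β H - gibbs β H₀)).trace.re := by
            rw [mul_sub, Matrix.trace_sub, Complex.sub_re]
            ring
          rw [e]
          exact (abs_add_le _ _).trans (add_le_add (hγ P hP) (h1.trans ht))
      _ ≤ _ := by
          rw [Finset.sum_const, nsmul_eq_mul]
          exact mul_le_mul_of_nonneg_right (card_lowWeight_le k hn)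
            (add_nonneg hγ0 ((traceNorm_nonneg _).trans ht))
  -- Nothing is known about how close the coefficients of the minimizer are; only that both lie in
  -- `[-1, 1]`. Closeness of the states comes entirely from the expectations.
  have hkey := sq_traceNorm_gibbs_sub_le_sum hβ.le hH₁.1 hH₀.1 (c := 2) fun P _ => by
    have h1 := abs_re_pauliCoeff_le_one hH₀ P
    have h2 := abs_re_pauliCoeff_le_one hH₁ P
    exact (abs_sub _ _).trans (by linarith)
  have hsum : ∑ P ∈ lowWeight n k,
      2 * |(P.toMatrix * (gibbs β H₁ - gibbs β H₀)).trace.re| ≤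
      2 * (dataDeviation k ω (gibbs β H₁) + dataDeviation k ω (gibbs β H₀)) := by
    rw [dataDeviation, dataDeviation, ← Finset.sum_add_distrib, Finset.mul_sum]
    refine Finset.sum_le_sum fun P _ => mul_le_mul_of_nonneg_left ?_ (by norm_num)
    have e : (P.toMatrix * (gibbs β H₁ - gibbs β H₀)).trace.re =
        (shadowEstimate ω P - (P.toMatrix * gibbs β H₀).trace.re) -
          (shadowEstimate ω P - (P.toMatrix * gibbs β H₁).trace.re) := by
      rw [mul_sub, Matrix.trace_sub, Complex.sub_re]
      ring
    rw [e, add_comm]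
    exact abs_sub _ _
  calc _ ≤ β * (2 * (dataDeviation k ω (gibbs β H₁) + dataDeviation k ω (gibbs β H₀))) :=
        hkey.trans (mul_le_mul_of_nonneg_left hsum hβ.le)
    _ ≤ β * (2 * (21 * (n : ℝ) ^ k * (γ + t) + 21 * (n : ℝ) ^ k * (γ + t))) := by
        gcongr
        exact hmin.trans hF
    _ = _ := by ring

end Accuracy

/-! ### The error budget and the probability of success. -/

section Main

variable {k : ℕ} {β ε δ : ℝ}

/-- With high probability the output of the program is close to the measured Gibbs state. -/
lemma one_sub_le_dataProb_traceNorm_le (hn : 2 ≤ n) (hk : 1 ≤ k) (hβ : 0 < β) (hε : 0 < ε)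
    (hε1 : ε < 1) (hδ : 0 < δ) (hδ1 : δ < 1) {N : ℕ} (hN : 0 < N)
    (hNX : 4480000 * (3 ^ k * (n : ℝ) ^ (2 * k) * k * Real.log (n / δ) * max β 1 ^ 2 / ε ^ 4) ≤ N)
    {H : QMatrix n} (hH : IsLocalHamiltonian k H) (hH1 : ∀ P, ‖pauliCoeff H P‖ ≤ 1) :
    1 - δ ≤ dataProb (gibbs β H) {ω : Fin N → Record n |
      traceNorm (gibbs β (outputHamiltonian mainCode k β ε ω) - gibbs β H) ≤ ε} := by
  set A := max β 1 with hA
  have hA1 : 1 ≤ A := le_max_right _ _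
  have hβA : β ≤ A := le_max_left _ _
  set Q : ℝ := (n : ℝ) ^ k with hQ
  have hQ1 : 1 ≤ Q := one_le_pow₀ (by exact_mod_cast (by omega : 1 ≤ n))
  have hk0 : (1 : ℝ) ≤ k := by exact_mod_cast hk
  set ε' := ε ^ 2 / (100 * A * Q) with hε'
  have hpos := invStep_pos (k := k) hβ hε hn
  have hstep : gridStep ε' k n β = (invStep β ε n k)⁻¹ := gridStep_eq hβ hε hn
  have hη : 0 < gridStep ε' k n β := by rw [hstep]; exact inv_pos.2 hpos
  obtain ⟨H₀, hH₀, hcov⟩ := exists_net_traceNorm_le (by omega) hβ hη hH hH1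
  -- A slightly weakened covering radius: the true one is `21/20000` of `ε² / (A Q)`, just below
  -- `1/900`.
  set t := ε ^ 2 / (900 * A * Q) with ht
  have hcov : traceNorm (gibbs β H - gibbs β H₀) ≤ t := by
    refine hcov.trans ?_
    have e : β * (21 * (n : ℝ) ^ k * gridStep ε' k n β) = 21 * ε ^ 2 / (20000 * A * Q) := by
      rw [gridStep, hε', ← hQ]
      field_simp
      norm_num
    rw [e, ht, div_le_div_iff₀ (by positivity) (by positivity)]
    have : 0 ≤ ε ^ 2 * A * Q := by positivity
    linarith
  -- The accuracy required of each estimate. With it the sample constant `4480000 = 7 * 4 * 400²`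
  -- gives the Bernstein exponent `7 k log (n/δ)`.
  set γ := ε ^ 2 / (400 * Q * A) with hγ
  have hγ0 : 0 < γ := by positivity
  have hε2 : ε ^ 2 ≤ ε := by nlinarith
  have hγ2 : γ ≤ 2 := by
    rw [hγ, div_le_iff₀ (by positivity)]
    have : 1 ≤ Q * A := one_le_mul_of_one_le_of_one_le hQ1 hA1
    nlinarith
  obtain ⟨G, hG⟩ := exists_gibbs_eq_conjTranspose_mul β hH.1
  have hprob := one_sub_le_dataProb (k := k) hN (by omega : 1 ≤ n) hG (trace_gibbs β hH.1) hγ0 hγ2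
  have hy : 7 * k * Real.log (n / δ) ≤ N * γ ^ 2 / (4 * 3 ^ k) := by
    have hγsq : 0 ≤ γ ^ 2 / (4 * 3 ^ k) := by positivity
    have h1 := mul_le_mul_of_nonneg_right hNX hγsq
    rw [mul_div_assoc]
    refine le_trans (le_of_eq ?_) h1
    rw [hγ, mul_comm 2 k, pow_mul, ← hQ]
    field_simp
    ring
  have hfail := failure_le hn hk hδ hδ1 hy
  refine le_trans ?_ (hprob.trans (sampleProb_mono (recordProb_nonneg hG) fun ω hω => ?_))
  · linarith
  · change traceNorm _ ≤ ε
    obtain ⟨hH₁, hmin⟩ := outputHamiltonian_spec hstep hpos ω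
    have hsq := traceNorm_sub_le_of_minimizer (by omega) hβ hH hH₀ hH₁ hω hγ0.le hcov
      (hmin H₀ hH₀)
    have hh := gibbs_isHermitian β hH.1
    have hh₀ := gibbs_isHermitian β hH₀.1.1
    have hh₁ := gibbs_isHermitian β hH₁.1.1
    set ρ₁ := gibbs β (outputHamiltonian mainCode k β ε ω)
    -- The distance to the net point near the true state uses nine tenths of `ε`, as `84/400 +
    -- 84/900 < (9/10)²`; the covering radius uses the rest.
    have hT : traceNorm (ρ₁ - gibbs β H₀) ≤ 9 / 10 * ε := by
      refine abs_le_of_sq_le_sq' ?_ (by positivity) |>.2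
      refine hsq.trans ?_
      calc 84 * β * (n : ℝ) ^ k * (γ + t) ≤ 84 * A * Q * (γ + t) := by
            have : 0 ≤ γ + t := by positivity
            gcongr
        _ = (84 / 400 + 84 / 900) * ε ^ 2 := by
            rw [hγ, ht]
            field_simp
        _ ≤ (9 / 10 * ε) ^ 2 := by nlinarith
    have hneg : traceNorm (gibbs β H₀ - gibbs β H) ≤ t := by
      obtain ⟨S, hS, e⟩ := exists_traceNorm_eq (hh₀.sub hh)
      have h1 := abs_re_trace_mul_le_traceNorm (hh.sub hh₀) hS
      have e2 : (S * (gibbs β H₀ - gibbs β H)).trace.re =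
          -(S * (gibbs β H - gibbs β H₀)).trace.re := by
        rw [← neg_sub (gibbs β H), mul_neg, Matrix.trace_neg, Complex.neg_re]
      rw [e, e2]
      exact ((neg_le_abs _).trans h1).trans hcov
    have ht10 : t ≤ ε / 10 := by
      rw [ht, div_le_iff₀ (by positivity)]
      have : 1 ≤ A * Q := one_le_mul_of_one_le_of_one_le hA1 hQ1
      nlinarith
    have htri := traceNorm_add_le (hh₁.sub hh₀) (hh₀.sub hh)
    rw [sub_add_sub_cancel] at htri
    linarith

end Main

end GibbsLearning

end

/-! ### Assembly of the theorem. -/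

open GibbsLearning
theorem mainTheorem2 :
    ∃ C₁ C₂ : ℝ, 0 < C₁ ∧ 0 < C₂ ∧ ∃ c : Code .scalar,
      ∀ (n k : ℕ) (β ε δ : ℝ), 2 ≤ n → 1 ≤ k → 0 < β → 0 < ε → ε < 1 → 0 < δ → δ < 1 →
        let N : ℕ := ⌈C₁ * (3 ^ k * (n : ℝ) ^ (2 * k) * k * Real.log (n / δ) *
          max β 1 ^ 2 / ε ^ 4)⌉₊
        let ε' : ℝ := ε ^ 2 / (100 * max β 1 * (n : ℝ) ^ k)
        -- the net is finite and covers the Gibbs states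
        (gibbsNet ε' k n β).Finite ∧
        (∀ H : QMatrix n, IsLocalHamiltonian k H → (∀ P, ‖pauliCoeff H P‖ ≤ 1) →
          ∃ τ ∈ gibbsNet ε' k n β, traceNorm (gibbs β H - τ) ≤ ε') ∧
        -- on all data, the program outputs a minimum-distance element of the net, in bounded time
        (∀ ω : Fin N → Record n,
          outputHamiltonian c k β ε ω ∈ hamiltonianNet ε' k n β ∧
          (∀ τ ∈ gibbsNet ε' k n β,
            shadowDistance ε' k β ω (gibbs β (outputHamiltonian c k β ε ω)) ≤
              shadowDistance ε' k β ω τ) ∧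
          (runningTime c k β ε ω : ℝ) ≤
            ((n : ℝ) ^ k * max β 1 / ε) ^ (C₂ * (n : ℝ) ^ k) * Real.log (n / δ)) ∧
        -- with high probability the output is close to the measured Gibbs state
        (∀ H : QMatrix n, IsLocalHamiltonian k H → (∀ P, ‖pauliCoeff H P‖ ≤ 1) →
          1 - δ ≤ dataProb (gibbs β H)
            {ω : Fin N → Record n |
              traceNorm (gibbs β (outputHamiltonian c k β ε ω) - gibbs β H) ≤ ε}) := by
  obtain ⟨d, hd⟩ := Code.exists_cost_le mainCode
  -- `d` depends on the fixed program alone, so the exponent constant is universal.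
  refine ⟨4480000, ((34 + 378 * d : ℕ) : ℝ), by norm_num, by positivity, mainCode, ?_⟩
  intro n k β ε δ hn hk hβ hε hε1 hδ hδ1 N ε'
  have hA1 : (1 : ℝ) ≤ max β 1 := le_max_right _ _
  have hpos := invStep_pos (k := k) hβ hε hn
  have hstep : gridStep ε' k n β = (invStep β ε n k)⁻¹ := gridStep_eq hβ hε hn
  have hη : 0 < gridStep ε' k n β := by rw [hstep]; exact inv_pos.2 hpos
  obtain ⟨hX, hNB⟩ := copies_bounds (β := β) hn hk hε hε1 hδ hδ1
  have hN : 0 < N := Nat.ceil_pos.2 hX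
  refine ⟨(hamiltonianNet_finite hη).image _, fun H hH hH1 => ?_, fun ω => ?_, fun H hH hH1 => ?_⟩
  · obtain ⟨H₀, hH₀, hcov⟩ := exists_net_traceNorm_le (by omega) hβ hη hH hH1
    refine ⟨_, Set.mem_image_of_mem _ hH₀, hcov.trans ?_⟩
    have hε'0 : 0 < ε' := by positivity
    have e : β * (21 * (n : ℝ) ^ k * gridStep ε' k n β) = 21 / 200 * ε' := by
      rw [gridStep]
      field_simp
    rw [e]
    linarith
  · obtain ⟨hmem, hmin⟩ := outputHamiltonian_spec hstep hpos ω
    refine ⟨hmem, ?_, runningTime_le hn hk hε hε1 hβ hδ hδ1 hN hNB hd ω⟩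
    rintro τ ⟨H, hH, rfl⟩
    -- Both distances carry the same factor. It vanishes when the grid step exceeds `1`, but only
    -- its nonnegativity is needed here, and the accuracy argument uses the deviations directly.
    rw [shadowDistance_eq hη, shadowDistance_eq hη]
    exact mul_le_mul_of_nonneg_left (hmin H hH) (by positivity)
  · exact one_sub_le_dataProb_traceNorm_le hn hk hβ hε hε1 hδ hδ1 hN (Nat.le_ceil _) hH hH1
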